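/- Let $L\subseteq\{0,1\}^*$ be a regular language (the language of a regular grammar $G$). For $N\ge 1$ let $m_p=m_p(N)$ and $m_n=m_n(N)=2^N-m_p(N)$ be the numbers of strings of length $N$ that belong, respectively do not belong, to $L$, and let $r_p=m_p/2^N$. Arrange all $2^N$ strings of length $N$ in a row in uniformly random order and let $F$ be the number of pairs of consecutive strings exactly one of which lies in $L$. The entropy of $L$ is $$H(L)=\limsup_{N\to\infty}\frac1N\log_2\mathbb E[F]\qquad(\log_2 0=-\infty).$$ For a sequence $m(N)$ of natural numbers say that - $m$ has polynomial growth if there are $q\ge1$ and real polynomials $P_0,\dots,P_{q-1}$ with $m(N)\sim P_{N\bmod q}(N)$ as $N\to\infty$ (that is, the difference is $o(P_{N\bmod q}(N))$); - $m$ has exponential growth with base $b$ if there are $q\ge1$, $k\in\mathbb N$ and reals $\beta_0,\dots,\beta_{q-1}\ge0$, not all zero, with $m(N)=(\beta_{N\bmod q}+o(1))\,N^k\,b^N$; - $m$ has proportional growth if there are $q\ge1$ and $\alpha_0,\dots,\alpha_{q-1}\in[0,1)$, not all zero, with $m(N)=(\alpha_{N\bmod q}+o(1))\,2^N$. Say that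 $m$ classifies $L$ if all of the following hold: (a) $H(L)=0$ if and only if $m$ has polynomial growth; (b) for every $b\in(1,2)$, $H(L)=\log_2 b$ if and only if $m$ has exponential growth with base $b$; (c) $H(L)=1$ if and only if $m$ has proportional growth. **Theorem.** Let $L\subseteq\{0,1\}^*$ be regular, and suppose that for infinitely many $N$ there are both strings of length $N$ in $L$ and strings of length $N$ outside $L$. Then $H(L)=0$, or $H(L)=\log_2 b$ for some $b\in(1,2)$, or $H(L)=1$. Moreover: 1. $\min(m_p,m_n)$ classifies $L$; 2. if there is $c<1$ with $r_p(N)\le c$ for all large $N$, then $m_p$ classifies $L$; 3. if there is $c>0$ with $r_p(N)\ge c$ for all large $N$, then $m_n$ classifies $L$. The seven Tomita languages are: (1) $1^*$; (2) $(10)^*$; (3) the strings in which every maximal run of 1s of odd length is followed by a (possibly empty) maximal run of 0s of even length; (4) the strings without substring $000$; (5) the strings with an even number of 0s and an even number of 1s; (6) the strings in which the number of 0s minus the number of 1s is a multiple of 3; (7) $0^*1^*0^*1^*$. They are regular and satisfy the hypothesis of the theorem. Languages 1, 2 and 7 have $H=0$ and $m_p$ of polynomial growth. For languages 3 and 4 there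 are $b\in(1,2)$ and $\beta>0$ with $H=\log_2 b$ and $m_p(N)\sim\beta\, b^N$. Languages 5 and 6 have $H=1$ and $m_p$ of proportional growth. -/

import Mathlib

open Filter Set
open scoped Topology Asymptotics Computability

noncomputable section

/-- The positive strings of length `N` of the binary language `L`. -/
def posStrings (L : Language (Fin 2)) (N : ℕ) : Set (Fin N → Fin 2) :=
  {x | List.ofFn x ∈ L}

/-- The negative strings of length `N` of the binary language `L`. -/
def negStrings (L : Language (Fin 2)) (N : ℕ) : Set (Fin N → Fin 2) :=
  {x | List.ofFn x ∉ L}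

/-- `m_p`, the number of positive strings of length `N`. -/
def posCount (L : Language (Fin 2)) (N : ℕ) : ℕ := (posStrings L N).ncard

/-- `m_n`, the number of negative strings of length `N`. -/
def negCount (L : Language (Fin 2)) (N : ℕ) : ℕ := (negStrings L N).ncard

/-- The size of the smaller one of the two classes of strings of length `N`. -/
def minorityCount (L : Language (Fin 2)) (N : ℕ) : ℕ := min (posCount L N) (negCount L N)

/-- `r_p = m_p / 2 ^ N`, the fraction of positive strings of length `N`. -/
def posRatio (L : Language (Fin 2)) (N : ℕ) : ℝ := (posCount L N : ℝ) / 2 ^ N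

/-- For an arrangement `σ` of all `2 ^ N` strings of length `N` in a row, the number of pairs of
consecutive strings that have different labels. -/
def labelChanges (L : Language (Fin 2)) (N : ℕ) (σ : Fin (2 ^ N) ≃ (Fin N → Fin 2)) : ℕ :=
  {p : Fin (2 ^ N) × Fin (2 ^ N) | p.1.val + 1 = p.2.val ∧
    ¬ (σ p.1 ∈ posStrings L N ↔ σ p.2 ∈ posStrings L N)}.ncard

/-- `E[F]`: the expected number of label changes for a uniformly random arrangement of all the
strings of length `N`. -/
def expectedLabelChanges (L : Language (Fin 2)) (N : ℕ) : ℝ :=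
  (∑ σ : Fin (2 ^ N) ≃ (Fin N → Fin 2), (labelChanges L N σ : ℝ)) /
    (Fintype.card (Fin (2 ^ N) ≃ (Fin N → Fin 2)) : ℝ)

/-- `(1 / N) * log₂ E[F]`, with the convention `log₂ 0 = -∞`. -/
def entropyAt (L : Language (Fin 2)) (N : ℕ) : EReal :=
  ENNReal.log (ENNReal.ofReal (expectedLabelChanges L N)) /
    (((N : ℝ) * Real.log 2 : ℝ) : EReal)

/-- The entropy `H(L) = limsup (1 / N) * log₂ E[F]`. -/
def entropy (L : Language (Fin 2)) : EReal := limsup (entropyAt L) atTop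

/-- `m` is asymptotically equivalent to a polynomial in `N` whose coefficients may depend on the
residue of `N` modulo some fixed period. -/
def PolynomialGrowth (m : ℕ → ℕ) : Prop :=
  ∃ q : ℕ, 0 < q ∧ ∃ P : ℕ → Polynomial ℝ,
    (fun N => (m N : ℝ)) ~[atTop] (fun N => (P (N % q)).eval (N : ℝ))

/-- `m N = (β + o(1)) * N ^ k * b ^ N`, where `β ≥ 0` may depend on the residue of `N` modulo some
fixed period and is positive for at least one residue. -/
def ExponentialGrowth (m : ℕ → ℕ) (b : ℝ) : Prop :=
  ∃ q : ℕ, 0 < q ∧ ∃ k : ℕ, ∃ β : ℕ → ℝ,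
    (∀ r, 0 ≤ β r) ∧ (∃ r < q, 0 < β r) ∧
    Tendsto (fun N : ℕ => (m N : ℝ) / ((N : ℝ) ^ k * b ^ N) - β (N % q)) atTop (𝓝 0)

/-- `m N = (α + o(1)) * 2 ^ N`, where `α ∈ [0, 1)` may depend on the residue of `N` modulo some
fixed period and is positive for at least one residue. -/
def ProportionalGrowth (m : ℕ → ℕ) : Prop :=
  ∃ q : ℕ, 0 < q ∧ ∃ α : ℕ → ℝ,
    (∀ r, 0 ≤ α r ∧ α r < 1) ∧ (∃ r < q, 0 < α r) ∧
    Tendsto (fun N : ℕ => (m N : ℝ) / (2 : ℝ) ^ N - α (N % q)) atTop (𝓝 0)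

/-- The entropy of `L` is characterized by the growth of the counting function `m`. -/
def EntropyClassifiedBy (L : Language (Fin 2)) (m : ℕ → ℕ) : Prop :=
  (entropy L = 0 ↔ PolynomialGrowth m) ∧
  (∀ b : ℝ, 1 < b → b < 2 →
    (entropy L = ((Real.logb 2 b : ℝ) : EReal) ↔ ExponentialGrowth m b)) ∧
  (entropy L = 1 ↔ ProportionalGrowth m)

/-- `1*` -/
def tomita1 : Language (Fin 2) := ({[1]} : Language (Fin 2))∗

/-- `(10)*` -/
def tomita2 : Language (Fin 2) := ({[1, 0]} : Language (Fin 2))∗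

/-- Every maximal run of 1s of odd length is followed by a maximal run of 0s of even (possibly
zero) length. -/
def tomita3 : Language (Fin 2) :=
  {w | ∀ (u v : List (Fin 2)) (i j : ℕ),
    w = u ++ List.replicate i 1 ++ List.replicate j 0 ++ v →
    u.getLast? ≠ some 1 → v.head? ≠ some 0 → Odd i → Even j}

/-- No substring `000`. -/
def tomita4 : Language (Fin 2) := {w | ¬ [0, 0, 0] <:+: w}

/-- An even number of 0s and an even number of 1s. -/
def tomita5 : Language (Fin 2) := {w | Even (w.count 0) ∧ Even (w.count 1)}

/-- The difference between the numbers of 0s and of 1s is a multiple of 3. -/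
def tomita6 : Language (Fin 2) := {w | (3 : ℤ) ∣ (w.count 0 : ℤ) - (w.count 1 : ℤ)}

/-- `0*1*0*1*` -/
def tomita7 : Language (Fin 2) :=
  ({[0]} : Language (Fin 2))∗ * ({[1]} : Language (Fin 2))∗ *
    ({[0]} : Language (Fin 2))∗ * ({[1]} : Language (Fin 2))∗

end

/-!
The expected number of label changes is `E[F] = 2 m_p m_n / 2 ^ N`, because all pairs of distinct
positions are equivalent under the symmetric group (`expectedLabelChanges_eq`). It lies between
`min (m_p, m_n)` and twice this number, so the entropy is the exponential growth rate of the size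
of the smaller class, and everything depends on the asymptotics of `m_p(N)` for a regular `L`.

The claim about `m_p` is that along each residue class modulo a suitable `q` it vanishes eventually
or is asymptotic to some `c * N ^ k * b ^ N` with `c > 0`; sequences of the second kind or
eventually zero are called *pure*, and a power series is *tame* (`IsTame`) if its coefficients are
pure along residue classes. The numbers of words accepted from the states of an automaton satisfy a
linear system `x = M x + b` over power series. Gaussian elimination (`isTame_of_linear_system`)
solves it using only sums, products and quasi-inverses `1 / (1 - f)` with `f(0) = 0`, so it suffices
that tame series are closed under these operations:

* Products of pure sequences are pure: if the exponential rates differ, by dominated convergence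
  (`tendsto_conv_of_summable`); if they agree, because the convolution of the binomial scales
  `(n + k).choose k * b ^ n` is a scale again (`tendsto_conv_of_eq`).
* For quasi-inverses (`IsTame.inv_one_sub`), the coefficients of a tame `f ≠ 0` grow so regularly
  that `f` diverges at its radius of convergence. Hence `f(x) = 1` for some `x > 0` *inside* the disc
  of convergence (`IsTame.exists_hasSum_one`), the numbers `f_n x ^ n` form a probability
  distribution with exponentially small tails, and the renewal theorem (`tendsto_renewal`, by the
  argument of Erdős, Feller and Pollard) shows that the coefficients of `1 / (1 - f)` are asymptotic
  to a multiple of `x⁻¹ ^ n` along the multiples of the period. This replaces the Perron–Frobenius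
  theorem.

Pure sequences can be compared, so `min (m_p, m_n)` is tame too, and an integer sequence with tame
generating function that is not eventually zero has exponential growth with some base `b ≥ 1`
(`TameCount.exponentialGrowth`), which is also the base of its growth rate. The three cases of the
classification are `b = 1`, `1 < b < 2` and `b = 2` (`entropyClassifiedBy_of_tameCount`).

For the Tomita languages the left quotients give recurrences for the counts. Bounds on the counts
suffice for languages 1, 2, 5, 6 and 7; languages 3 and 4 have counting series
`(1 + z) ^ 2 / (1 - 2 z ^ 2 - 2 z ^ 3)` and `(1 + z + z ^ 2) / (1 - z - z ^ 2 - z ^ 3)`, to which the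
renewal theorem applies directly.
-/

noncomputable section

/-! ### The renewal theorem -/

/-- The renewal equation `v n = ∑ p i * v (n - i)`, with source term at `n = 0`, for
`∑ v n z ^ n = 1 / (1 - ∑ p n z ^ n)`. -/
theorem renewal_apply {p v : ℕ → ℝ}
    (hv : PowerSeries.mk v * (1 - PowerSeries.mk p) = 1) (n : ℕ) :
    v n = (∑ i ∈ Finset.range (n + 1), p i * v (n - i)) + if n = 0 then 1 else 0 := by
  have h : PowerSeries.mk v = PowerSeries.mk p * PowerSeries.mk v + 1 := by
    linear_combination hv
  have h2 := congrArg (PowerSeries.coeff n) h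
  rw [map_add, PowerSeries.coeff_mul, PowerSeries.coeff_one,
    Finset.Nat.sum_antidiagonal_eq_sum_range_succ
      (f := fun i j => PowerSeries.coeff i (PowerSeries.mk p) * PowerSeries.coeff j
        (PowerSeries.mk v))] at h2
  simpa using h2

theorem renewal_mem_Icc {p v : ℕ → ℝ} (hp : ∀ n, 0 ≤ p n) (hp0 : p 0 = 0) (hp1 : HasSum p 1)
    (hv : PowerSeries.mk v * (1 - PowerSeries.mk p) = 1) (n : ℕ) : v n ∈ Icc (0 : ℝ) 1 := by
  induction n using Nat.strong_induction_on with
  | _ n ih =>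
    rw [renewal_apply hv n]
    rcases Nat.eq_zero_or_pos n with rfl | hn
    · simp [hp0]
    rw [if_neg hn.ne', add_zero]
    have key : ∀ i ∈ Finset.range (n + 1), 0 ≤ p i * v (n - i) ∧ p i * v (n - i) ≤ p i := by
      intro i _
      rcases Nat.eq_zero_or_pos i with rfl | hi
      · simp [hp0]
      · have := ih (n - i) (by omega)
        exact ⟨mul_nonneg (hp i) this.1, mul_le_of_le_one_right (hp i) this.2⟩
    exact ⟨Finset.sum_nonneg fun i hi => (key i hi).1,
      (Finset.sum_le_sum fun i hi => (key i hi).2).trans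
        (sum_le_hasSum _ (fun i _ => hp i) hp1)⟩

/-- The sequence `v` read backwards from `n`, continued by zero. -/
def backward (v : ℕ → ℝ) (n j : ℕ) : ℝ := if j ≤ n then v (n - j) else 0

theorem hasSum_mul_backward {w v : ℕ → ℝ} {n j : ℕ} (h : j ≤ n) :
    HasSum (fun i => w i * backward v n (j + i))
      (∑ i ∈ Finset.range (n - j + 1), w i * v (n - j - i)) := by
  have : ∑ i ∈ Finset.range (n - j + 1), w i * v (n - j - i) =
      ∑ i ∈ Finset.range (n - j + 1), w i * backward v n (j + i) := by
    refine Finset.sum_congr rfl fun i hi => ?_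
    rw [Finset.mem_range] at hi
    rw [backward, if_pos (by omega), Nat.sub_sub]
  rw [this]
  refine hasSum_sum_of_ne_finset_zero fun i hi => ?_
  rw [Finset.mem_range] at hi
  rw [backward, if_neg (by omega), mul_zero]

theorem backward_mem_Icc {v : ℕ → ℝ} (hv : ∀ n, v n ∈ Icc (0 : ℝ) 1) (n j : ℕ) :
    backward v n j ∈ Icc (0 : ℝ) 1 := by
  rw [backward]; split_ifs
  · exact hv _
  · simp

theorem tendsto_tsum_mul_of_mem_Icc {w ℓ : ℕ → ℝ} {u : ℕ → ℕ → ℝ} (hw : ∀ i, 0 ≤ w i)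
    (hws : Summable w) (hu : ∀ n i, u n i ∈ Icc (0 : ℝ) 1) {𝓕 : Filter ℕ}
    (hℓ : ∀ i, Tendsto (fun n => u n i) 𝓕 (𝓝 (ℓ i))) :
    Tendsto (fun n => ∑' i, w i * u n i) 𝓕 (𝓝 (∑' i, w i * ℓ i)) := by
  refine tendsto_tsum_of_dominated_convergence hws (fun i => (hℓ i).const_mul _) ?_
  refine Eventually.of_forall fun n i => ?_
  rw [Real.norm_eq_abs, abs_of_nonneg (mul_nonneg (hw i) (hu n i).1)]
  exact mul_le_of_le_one_right (hw i) (hu n i).2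

/-- The tail sums `∑_{j > i} p j` of a probability distribution. -/
def tailSum (p : ℕ → ℝ) (i : ℕ) : ℝ := 1 - ∑ j ∈ Finset.range (i + 1), p j

theorem tailSum_nonneg {p : ℕ → ℝ} (hp : ∀ n, 0 ≤ p n) (hp1 : HasSum p 1) (i : ℕ) :
    0 ≤ tailSum p i :=
  sub_nonneg.2 (sum_le_hasSum _ (fun i _ => hp i) hp1)

theorem summable_tailSum {p : ℕ → ℝ} (hp : ∀ n, 0 ≤ p n) (hp1 : HasSum p 1) {ρ : ℝ}
    (hρ : 1 < ρ) (hs : Summable fun n => p n * ρ ^ n) : Summable (tailSum p) := by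
  have hρ0 : 0 < ρ := by linarith
  have hg : Summable fun i : ℕ => (∑' n, p n * ρ ^ n) * (ρ⁻¹) ^ i :=
    (summable_geometric_of_lt_one (inv_nonneg.2 hρ0.le) (inv_lt_one_of_one_lt₀ hρ)).mul_left _
  refine Summable.of_nonneg_of_le (tailSum_nonneg hp hp1) (fun i => ?_) hg
  have h1 : tailSum p i = ∑' j, p (j + (i + 1)) := by
    rw [tailSum, ← hp1.tsum_eq, ← hp1.summable.sum_add_tsum_nat_add (i + 1)]; ring
  have h2 : (∑' j, p (j + (i + 1)) * ρ ^ (j + (i + 1))) ≤ ∑' n, p n * ρ ^ n := by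
    rw [← hs.sum_add_tsum_nat_add (i + 1)]
    exact le_add_of_nonneg_left (Finset.sum_nonneg fun n _ => mul_nonneg (hp n) (by positivity))
  rw [h1, inv_pow, ← div_eq_mul_inv, le_div_iff₀ (by positivity)]
  refine le_trans ?_ h2
  rw [← tsum_mul_right]
  refine Summable.tsum_le_tsum (fun j => ?_) ?_ ?_
  · exact mul_le_mul_of_nonneg_left (pow_le_pow_right₀ hρ.le (by omega)) (hp _)
  · exact ((summable_nat_add_iff (i + 1)).2 hp1.summable).mul_right _
  · exact (summable_nat_add_iff (f := fun n => p n * ρ ^ n) (i + 1)).2 hs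

theorem mk_tailSum_mul (p : ℕ → ℝ) :
    PowerSeries.mk (tailSum p) * (1 - PowerSeries.X) = 1 - PowerSeries.mk p := by
  ext n
  rw [mul_sub, mul_one, map_sub, map_sub, PowerSeries.coeff_mk, PowerSeries.coeff_mk,
    PowerSeries.coeff_one]
  rcases n with _ | n
  · simp [tailSum]
  · rw [PowerSeries.coeff_succ_mul_X, PowerSeries.coeff_mk, tailSum, tailSum,
      Finset.sum_range_succ _ (n + 1)]
    simp

/-- `∑ tailSum p i * v (n - i) = 1`: there is exactly one last renewal up to time `n`. -/
theorem sum_tailSum_mul {p v : ℕ → ℝ} (hv : PowerSeries.mk v * (1 - PowerSeries.mk p) = 1)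
    (n : ℕ) : ∑ i ∈ Finset.range (n + 1), tailSum p i * v (n - i) = 1 := by
  have h : PowerSeries.mk (tailSum p) * PowerSeries.mk v = PowerSeries.mk (1 : ℕ → ℝ) := by
    have h1 := mk_tailSum_mul p
    have h2 := PowerSeries.mk_one_mul_one_sub_eq_one ℝ
    generalize PowerSeries.mk (tailSum p) = T at h1 ⊢
    generalize (PowerSeries.mk 1 : PowerSeries ℝ) = O at h2 ⊢
    generalize PowerSeries.mk p = P at h1 hv
    generalize PowerSeries.mk v = V at hv ⊢
    linear_combination O * (hv + V * h1) - T * V * h2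
  have h2 := congrArg (PowerSeries.coeff n) h
  rw [PowerSeries.coeff_mul,
    Finset.Nat.sum_antidiagonal_eq_sum_range_succ
      (f := fun i j => PowerSeries.coeff i (PowerSeries.mk (tailSum p)) * PowerSeries.coeff j
        (PowerSeries.mk v))] at h2
  simpa using h2

/-- The step of the Erdős–Feller–Pollard argument: along an ultrafilter on which `v` tends to an
extremal cluster point `a` (a largest one for `s = 1`, a smallest one for `s = -1`), all shifts
of `v` by large amounts tend to `a` too, and the identity `∑ i, tailSum p i * v (n - i) = 1`
passes to the limit. -/
theorem mul_tsum_tailSum_of_extremal {p v : ℕ → ℝ} (hp : ∀ n, 0 ≤ p n) (hp0 : p 0 = 0)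
    (hp1 : HasSum p 1) (hT : Summable (tailSum p)) (hgcd : Nat.setGcd {n | 0 < p n} = 1)
    (hv : PowerSeries.mk v * (1 - PowerSeries.mk p) = 1) {a s : ℝ} (hs : s ≠ 0)
    (ha : MapClusterPt a atTop v) (hmax : ∀ y, MapClusterPt y atTop v → s * y ≤ s * a) :
    (∑' i, tailSum p i) * a = 1 := by
  have hI := renewal_mem_Icc hp hp0 hp1 hv
  obtain ⟨U, hU, hUa⟩ := mapClusterPt_iff_ultrafilter.1 ha
  have hlim : ∀ j, ∃ l, Tendsto (fun n => backward v n j) U (𝓝 l) := by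
    intro j
    obtain ⟨l, _, hl⟩ := isCompact_Icc.ultrafilter_le_nhds (U.map fun n => backward v n j)
      (le_principal_iff.2 (mem_map.2 (Eventually.of_forall fun n => backward_mem_Icc hI n j)))
    exact ⟨l, hl⟩
  choose ℓ hℓ using hlim
  have hshift : ∀ j, Tendsto (fun n => v (n - j)) U (𝓝 (ℓ j)) := fun j =>
    (hℓ j).congr' (by
      filter_upwards [hU (eventually_ge_atTop j)] with n hn
      rw [backward, if_pos hn])
  have hle : ∀ j, s * ℓ j ≤ s * a := by
    intro j
    refine hmax _ (mapClusterPt_iff_ultrafilter.2 ⟨U.map (fun n => n - j), ?_, ?_⟩)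
    · exact (tendsto_sub_atTop_nat j).mono_left hU
    · exact tendsto_map'_iff.2 (hshift j)
  have hℓ0 : ℓ 0 = a := tendsto_nhds_unique (hshift 0) hUa
  have hℓI : ∀ j, ℓ j ∈ Icc (0 : ℝ) 1 := fun j =>
    isClosed_Icc.mem_of_tendsto (hshift j) (Eventually.of_forall fun n => hI _)
  -- The limits form a harmonic function, whose value at `0` is extremal.
  have hharm : ∀ j, ∑' i, p i * ℓ (j + i) = ℓ j := by
    intro j
    refine tendsto_nhds_unique (tendsto_tsum_mul_of_mem_Icc hp hp1.summable
      (fun n i => backward_mem_Icc hI n (j + i)) fun i => hℓ (j + i)) ((hshift j).congr' ?_)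
    filter_upwards [hU (eventually_gt_atTop j)] with n hn
    rw [(hasSum_mul_backward hn.le).tsum_eq, renewal_apply hv (n - j),
      if_neg (by omega), add_zero]
  have hstep : ∀ j i, ℓ j = a → 0 < p i → ℓ (j + i) = a := by
    intro j i hj hi
    have hS : Summable fun i => p i * ℓ (j + i) :=
      Summable.of_nonneg_of_le (fun i => mul_nonneg (hp i) (hℓI _).1)
        (fun i => mul_le_of_le_one_right (hp i) (hℓI _).2) hp1.summable
    have h0 : HasSum (fun i => p i * (s * a - s * ℓ (j + i))) 0 := by
      have := ((hp1.mul_right a).sub hS.hasSum).mul_left s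
      rw [hharm, hj, one_mul, sub_self, mul_zero] at this
      exact this.congr_fun fun i => by ring
    have h1 := (hasSum_zero_iff_of_nonneg fun i =>
      mul_nonneg (hp i) (sub_nonneg.2 (hle (j + i)))).1 h0
    have h2 := congrFun h1 i
    simp only [Pi.zero_apply, mul_eq_zero, hi.ne', false_or] at h2
    exact (mul_left_cancel₀ hs (sub_eq_zero.1 h2)).symm
  have hcl : ∀ i ∈ AddSubmonoid.closure {n | 0 < p n}, ∀ j, ℓ j = a → ℓ (j + i) = a := by
    intro i hi
    induction hi using AddSubmonoid.closure_induction with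
    | mem i hi => exact fun j hj => hstep j i hj hi
    | zero => exact fun j hj => hj
    | add x y _ _ hx hy => exact fun j hj => by rw [← add_assoc]; exact hy _ (hx j hj)
  -- By aperiodicity, all large numbers are sums of elements of the support of `p`.
  obtain ⟨J, hJ⟩ := Nat.exists_mem_closure_of_ge {n | 0 < p n}
  have hJa : ∀ i, ℓ (J + i) = a := fun i => by
    have := hcl (J + i) (hJ _ (by omega) (by rw [hgcd]; exact one_dvd _)) 0 hℓ0
    rwa [zero_add] at this
  have hone : ∑' i, tailSum p i * ℓ (J + i) = 1 := by
    refine tendsto_nhds_unique (tendsto_tsum_mul_of_mem_Icc (tailSum_nonneg hp hp1) hT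
      (fun n i => backward_mem_Icc hI n (J + i)) fun i => hℓ (J + i))
      (tendsto_const_nhds.congr' ?_)
    filter_upwards [hU (eventually_ge_atTop J)] with n hn
    rw [(hasSum_mul_backward hn).tsum_eq, sum_tailSum_mul hv]
  simp_rw [hJa] at hone
  rwa [tsum_mul_right] at hone

/-- **Renewal theorem** for an aperiodic distribution with an exponential moment. -/
theorem tendsto_renewal {p v : ℕ → ℝ} (hp : ∀ n, 0 ≤ p n) (hp0 : p 0 = 0)
    (hp1 : HasSum p 1) {ρ : ℝ} (hρ : 1 < ρ) (hs : Summable fun n => p n * ρ ^ n)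
    (hgcd : Nat.setGcd {n | 0 < p n} = 1)
    (hv : PowerSeries.mk v * (1 - PowerSeries.mk p) = 1) :
    ∃ c, 0 < c ∧ Tendsto v atTop (𝓝 c) := by
  have hT := summable_tailSum hp hp1 hρ hs
  have hI := renewal_mem_Icc hp hp0 hp1 hv
  have hK : IsCompact {y | MapClusterPt y atTop v} := by
    refine isCompact_Icc.of_isClosed_subset isClosed_setOfPred_clusterPt
      (s := Icc (0 : ℝ) 1) fun y hy => ?_
    exact isClosed_Icc.mem_of_mapClusterPt hy (Eventually.of_forall hI)
  have hne : {y | MapClusterPt y atTop v}.Nonempty := by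
    obtain ⟨y, _, hy⟩ := isCompact_Icc.exists_mapClusterPt (f := atTop) (u := v)
      (s := Icc (0 : ℝ) 1) (le_principal_iff.2 (mem_map.2 (Eventually.of_forall hI)))
    exact ⟨y, hy⟩
  obtain ⟨a, ha, hamax⟩ := hK.exists_isGreatest hne
  obtain ⟨b, hb, hbmin⟩ := hK.exists_isLeast hne
  have h1 := mul_tsum_tailSum_of_extremal hp hp0 hp1 hT hgcd hv one_ne_zero ha
    fun y hy => by simpa using hamax hy
  have h2 := mul_tsum_tailSum_of_extremal hp hp0 hp1 hT hgcd hv (neg_ne_zero.2 one_ne_zero) hb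
    fun y hy => by simpa using hbmin hy
  have hab : b = a := mul_left_cancel₀ (left_ne_zero_of_mul_eq_one h1) (h2.trans h1.symm)
  have ha0 : 0 ≤ a := (isClosed_Icc.mem_of_mapClusterPt ha (Eventually.of_forall hI)).1
  refine ⟨a, lt_of_le_of_ne ha0 (right_ne_zero_of_mul_eq_one h1).symm, ?_⟩
  refine isCompact_Icc.tendsto_nhds_of_unique_mapClusterPt (s := Icc (0 : ℝ) 1)
    (Eventually.of_forall hI) fun y _ hy => le_antisymm (hamax hy) ?_
  exact hab ▸ hbmin hy

/-! ### Scales of growth and Cauchy products -/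

/-- The sequence `n ↦ (n + k).choose k * lam ^ n`, the coefficients of `(1 - lam * X)⁻¹ ^ (k + 1)`. -/
def scale (k : ℕ) (lam : ℝ) (n : ℕ) : ℝ := ((k + n).choose k : ℝ) * lam ^ n

theorem scale_pos (k : ℕ) {lam : ℝ} (h : 0 < lam) (n : ℕ) : 0 < scale k lam n :=
  mul_pos (by exact_mod_cast Nat.choose_pos (Nat.le_add_right k n)) (pow_pos h n)

theorem pow_le_scale (k : ℕ) {lam : ℝ} (h : 0 < lam) (n : ℕ) : lam ^ n ≤ scale k lam n :=
  le_mul_of_one_le_left (pow_pos h n).le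
    (by exact_mod_cast Nat.choose_pos (Nat.le_add_right k n))

theorem summable_scale (k : ℕ) {lam : ℝ} (h0 : 0 ≤ lam) (h1 : lam < 1) :
    Summable (scale k lam) := by
  have := summable_choose_mul_geometric_of_norm_lt_one k (r := lam)
    (by rwa [Real.norm_eq_abs, abs_of_nonneg h0])
  refine this.congr fun n => ?_
  rw [scale, add_comm]

theorem scale_mul (k : ℕ) (lam x : ℝ) (n : ℕ) : scale k lam n * x ^ n = scale k (lam * x) n := by
  rw [scale, scale, mul_pow, mul_assoc]

theorem tendsto_scale_div_of_lt {k l : ℕ} {lam mu : ℝ} (h0 : 0 < lam) (h : lam < mu) :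
    Tendsto (fun n => scale k lam n / scale l mu n) atTop (𝓝 0) := by
  have hmu : 0 < mu := h0.trans h
  have h1 := (summable_scale k (div_pos h0 hmu).le ((div_lt_one hmu).2 h)).tendsto_atTop_zero
  refine squeeze_zero (fun n => (div_pos (scale_pos k h0 n) (scale_pos l hmu n)).le)
    (fun n => ?_) h1
  rw [div_le_iff₀ (scale_pos l hmu n), div_eq_mul_inv, ← scale_mul, mul_assoc]
  refine le_mul_of_one_le_right (scale_pos k h0 n).le ?_
  rw [inv_pow, inv_mul_eq_div, one_le_div (pow_pos hmu n)]
  exact pow_le_scale l hmu n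

theorem tendsto_scale_div_of_lt_left {k l : ℕ} {lam : ℝ} (h0 : 0 < lam) (h : k < l) :
    Tendsto (fun n => scale k lam n / scale l lam n) atTop (𝓝 0) := by
  have h1 : Tendsto (fun n : ℕ => ((k : ℝ) + 1) * ((n : ℝ) + 1)⁻¹) atTop (𝓝 0) := by
    have := tendsto_one_div_add_atTop_nhds_zero_nat (𝕜 := ℝ)
    simpa using this.const_mul ((k : ℝ) + 1)
  refine squeeze_zero (fun n => (div_pos (scale_pos k h0 n) (scale_pos l h0 n)).le)
    (fun n => ?_) h1
  have hc : (n + 1) * (k + n).choose k ≤ (k + 1) * (l + n).choose l := by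
    have e1 : (k + 1 + n).choose (k + 1) ≤ (l + n).choose l := by
      rw [Nat.choose_symm_add, Nat.choose_symm_add]
      exact Nat.choose_le_choose n (by omega)
    have e2 := Nat.add_one_mul_choose_eq (k + n) k
    have e3 : k + n + 1 = k + 1 + n := by omega
    calc (n + 1) * (k + n).choose k ≤ (k + n + 1) * (k + n).choose k :=
          Nat.mul_le_mul_right _ (by omega)
      _ = (k + 1) * (k + 1 + n).choose (k + 1) := by rw [e2, e3, mul_comm]
      _ ≤ _ := Nat.mul_le_mul_left _ e1
  have hc' : ((n : ℝ) + 1) * ((k + n).choose k : ℝ) ≤ ((k : ℝ) + 1) * ((l + n).choose l : ℝ) := by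
    exact_mod_cast hc
  rw [div_le_iff₀ (scale_pos l h0 n), mul_assoc, mul_left_comm, inv_mul_eq_div,
    le_div_iff₀ (by positivity), scale, scale]
  calc _ = ((n : ℝ) + 1) * ((k + n).choose k : ℝ) * lam ^ n := by ring
    _ ≤ ((k : ℝ) + 1) * ((l + n).choose l : ℝ) * lam ^ n :=
        mul_le_mul_of_nonneg_right hc' (pow_pos h0 n).le
    _ = _ := by ring

/-- Two scales are equal, or one of them is negligible compared to the other. -/
theorem scale_trichotomy (k l : ℕ) {lam mu : ℝ} (h0 : 0 < lam) (h0' : 0 < mu) :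
    (k = l ∧ lam = mu) ∨ Tendsto (fun n => scale k lam n / scale l mu n) atTop (𝓝 0) ∨
      Tendsto (fun n => scale l mu n / scale k lam n) atTop (𝓝 0) := by
  rcases lt_trichotomy lam mu with h | rfl | h
  · exact Or.inr (Or.inl (tendsto_scale_div_of_lt h0 h))
  · rcases lt_trichotomy k l with h | rfl | h
    · exact Or.inr (Or.inl (tendsto_scale_div_of_lt_left h0 h))
    · exact Or.inl ⟨rfl, rfl⟩
    · exact Or.inr (Or.inr (tendsto_scale_div_of_lt_left h0 h))
  · exact Or.inr (Or.inr (tendsto_scale_div_of_lt h0' h))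

theorem scale_sub_le (k : ℕ) {lam : ℝ} (h0 : 0 < lam) {n j : ℕ} (h : j ≤ n) :
    scale k lam (n - j) ≤ scale k lam n * (lam⁻¹) ^ j := by
  have h1 : lam ^ (n - j) = lam ^ n * (lam⁻¹) ^ j := by
    rw [inv_pow, pow_sub₀ _ h0.ne' h]
  rw [scale, scale, h1, ← mul_assoc]
  refine mul_le_mul_of_nonneg_right (mul_le_mul_of_nonneg_right ?_ (pow_pos h0 n).le)
    (pow_pos (inv_pos.2 h0) j).le
  exact_mod_cast Nat.choose_le_choose k (by omega)

theorem tendsto_scale_sub_div (k : ℕ) {lam : ℝ} (h0 : 0 < lam) (j : ℕ) :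
    Tendsto (fun n => scale k lam (n - j) / scale k lam n) atTop (𝓝 ((lam⁻¹) ^ j)) := by
  rw [← tendsto_add_atTop_iff_nat j]
  simp only [Nat.add_sub_cancel]
  induction j with
  | zero => simpa using tendsto_const_nhds.congr fun n => (div_self (scale_pos k h0 n).ne').symm
  | succ j ih =>
    have h1 : Tendsto (fun n => scale k lam n / scale k lam (n + 1)) atTop (𝓝 lam⁻¹) := by
      have h2 : ∀ n : ℕ, scale k lam n / scale k lam (n + 1) =
          ((1 : ℝ) - (k : ℝ) / ((n : ℝ) + ((k : ℝ) + 1))) * lam⁻¹ := by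
        intro n
        have e2 : (k + n + 1 : ℝ) * ((k + n).choose k : ℝ) =
            ((k + (n + 1)).choose k : ℝ) * ((n : ℝ) + 1) := by
          have := Nat.add_one_mul_choose_eq (k + n) n
          rw [← Nat.choose_symm_add (a := k) (b := n), show (k + n + 1).choose (n + 1) =
            (k + (n + 1)).choose k from (Nat.choose_symm_add (a := k) (b := n + 1)).symm] at this
          exact_mod_cast this
        have p1 : (0 : ℝ) < ((k + (n + 1)).choose k : ℝ) := by
          exact_mod_cast Nat.choose_pos (Nat.le_add_right k (n + 1))
        rw [scale, scale, pow_succ]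
        have : (0 : ℝ) < (n : ℝ) + ((k : ℝ) + 1) := by positivity
        field_simp
        linear_combination e2
      simp_rw [h2]
      have h3 : Tendsto (fun n : ℕ => (k : ℝ) / ((n : ℝ) + ((k : ℝ) + 1))) atTop (𝓝 0) :=
        tendsto_const_nhds.div_atTop
          (tendsto_atTop_add_const_right _ _ tendsto_natCast_atTop_atTop)
      simpa using ((tendsto_const_nhds (x := (1 : ℝ))).sub h3).mul_const lam⁻¹
    have h2 := ih.mul (h1.comp (tendsto_add_atTop_nat j))
    rw [pow_succ]
    refine h2.congr fun n => ?_
    simp only [Function.comp_apply]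
    rw [div_mul_div_cancel₀ (scale_pos k h0 _).ne', add_assoc]

/-- The convolution of two scales with the same rate is a scale:
`(1 - lam z)⁻¹ ^ (k + 1) * (1 - lam z)⁻¹ ^ (l + 1) = (1 - lam z)⁻¹ ^ (k + l + 2)`. -/
theorem sum_scale_mul_scale (k l : ℕ) (lam : ℝ) (n : ℕ) :
    ∑ i ∈ Finset.range (n + 1), scale k lam i * scale l lam (n - i) =
      scale (k + l + 1) lam n := by
  have h := PowerSeries.mk_one_pow_eq_mk_choose_add ℝ (d := k + l + 1)
  rw [show k + l + 1 + 1 = (k + 1) + (l + 1) by ring, pow_add,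
    PowerSeries.mk_one_pow_eq_mk_choose_add, PowerSeries.mk_one_pow_eq_mk_choose_add] at h
  have h2 := congrArg (PowerSeries.coeff n) h
  rw [PowerSeries.coeff_mul, PowerSeries.coeff_mk,
    Finset.Nat.sum_antidiagonal_eq_sum_range_succ
      (f := fun i j => PowerSeries.coeff i (PowerSeries.mk fun n => ((k + n).choose k : ℝ)) *
        PowerSeries.coeff j (PowerSeries.mk fun n => ((l + n).choose l : ℝ)))] at h2
  simp only [PowerSeries.coeff_mk] at h2
  rw [scale, ← h2, Finset.sum_mul]
  refine Finset.sum_congr rfl fun i hi => ?_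
  rw [Finset.mem_range] at hi
  rw [scale, scale, show lam ^ n = lam ^ i * lam ^ (n - i) by rw [← pow_add]; congr 1; omega]
  ring

/-- Weighted averages whose weights move off to infinity preserve limits. -/
theorem tendsto_weighted_average {w : ℕ → ℕ → ℝ} {a : ℕ → ℝ} (hw0 : ∀ n i, i ≤ n → 0 ≤ w n i)
    (hw1 : ∀ n, ∑ i ∈ Finset.range (n + 1), w n i = 1)
    (hw : ∀ i, Tendsto (fun n => w n i) atTop (𝓝 0)) (ha : Tendsto a atTop (𝓝 0)) :
    Tendsto (fun n => ∑ i ∈ Finset.range (n + 1), w n i * a i) atTop (𝓝 0) := by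
  rw [Metric.tendsto_atTop] at ha
  rw [Metric.tendsto_nhds]
  intro ε hε
  obtain ⟨J, hJ⟩ := ha (ε / 2) (half_pos hε)
  have h1 : Tendsto (fun n => ∑ i ∈ Finset.range J, w n i * |a i|) atTop (𝓝 0) := by
    simpa using tendsto_finsetSum (Finset.range J) fun i _ => (hw i).mul_const |a i|
  filter_upwards [h1.eventually_lt_const (half_pos hε), eventually_ge_atTop J] with n hn hnJ
  rw [Real.dist_eq, sub_zero]
  have hsplit : ∀ f : ℕ → ℝ, ∑ i ∈ Finset.range (n + 1), f i =
      ∑ i ∈ Finset.range J, f i + ∑ i ∈ Finset.Ico J (n + 1), f i := fun f =>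
    (Finset.sum_range_add_sum_Ico f (by omega)).symm
  have h2 : ∑ i ∈ Finset.Ico J (n + 1), w n i * |a i| ≤ ε / 2 := by
    calc _ ≤ ∑ i ∈ Finset.Ico J (n + 1), w n i * (ε / 2) := by
          refine Finset.sum_le_sum fun i hi => ?_
          rw [Finset.mem_Ico] at hi
          have := hJ i hi.1
          rw [Real.dist_eq, sub_zero] at this
          exact mul_le_mul_of_nonneg_left this.le (hw0 n i (by omega))
      _ = (∑ i ∈ Finset.Ico J (n + 1), w n i) * (ε / 2) := (Finset.sum_mul _ _ _).symm
      _ ≤ 1 * (ε / 2) := by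
          refine mul_le_mul_of_nonneg_right ?_ (half_pos hε).le
          rw [← hw1 n, hsplit]
          refine le_add_of_nonneg_left (Finset.sum_nonneg fun i hi => hw0 n i ?_)
          rw [Finset.mem_range] at hi; omega
      _ = _ := one_mul _
  calc |∑ i ∈ Finset.range (n + 1), w n i * a i|
      ≤ ∑ i ∈ Finset.range (n + 1), w n i * |a i| := by
        refine (Finset.abs_sum_le_sum_abs _ _).trans (Finset.sum_le_sum fun i hi => ?_)
        rw [Finset.mem_range] at hi
        rw [abs_mul, abs_of_nonneg (hw0 n i (by omega))]
    _ < ε := by rw [hsplit]; linarith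

theorem sum_range_reverse (n : ℕ) (f : ℕ → ℕ → ℝ) :
    ∑ i ∈ Finset.range (n + 1), f i (n - i) = ∑ i ∈ Finset.range (n + 1), f (n - i) i := by
  rw [← Finset.Nat.sum_antidiagonal_eq_sum_range_succ, ← Finset.Nat.sum_antidiagonal_swap]
  exact Finset.Nat.sum_antidiagonal_eq_sum_range_succ (f := fun i j => f j i) n

theorem exists_bound_of_tendsto_div {f s : ℕ → ℝ} {c : ℝ} (hs : ∀ n, 0 < s n)
    (h : Tendsto (fun n => f n / s n) atTop (𝓝 c)) : ∃ C, 0 ≤ C ∧ ∀ n, f n ≤ C * s n := by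
  obtain ⟨C, hC⟩ := h.bddAbove_range
  refine ⟨max C 0, le_max_right _ _, fun n => ?_⟩
  rw [← div_le_iff₀ (hs n)]
  exact (hC (mem_range_self n)).trans (le_max_left _ _)

/-- The weights `scale k lam i * scale l lam (n - i) / scale (k + l + 1) lam n`, which have sum one
over `i ≤ n`, satisfy the last hypothesis of `tendsto_weighted_average`. -/
theorem tendsto_scale_weight (k l : ℕ) {lam : ℝ} (h0 : 0 < lam) (i : ℕ) :
    Tendsto (fun n => scale k lam i * scale l lam (n - i) / scale (k + l + 1) lam n) atTop
      (𝓝 0) := by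
  have h1 := ((tendsto_scale_sub_div l h0 i).mul
    (tendsto_scale_div_of_lt_left (k := l) (l := k + l + 1) h0 (by omega))).const_mul
    (scale k lam i)
  rw [mul_zero, mul_zero] at h1
  refine h1.congr fun n => ?_
  rw [div_mul_div_cancel₀ (scale_pos l h0 n).ne', mul_div_assoc]

/-- Cauchy product of two sequences of the same exponential growth. -/
theorem tendsto_conv_of_eq {f g : ℕ → ℝ} {k l : ℕ} {lam c d : ℝ} (h0 : 0 < lam)
    (hf : Tendsto (fun n => f n / scale k lam n) atTop (𝓝 c))
    (hg : Tendsto (fun n => g n / scale l lam n) atTop (𝓝 d)) :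
    Tendsto (fun n => (∑ i ∈ Finset.range (n + 1), f i * g (n - i)) / scale (k + l + 1) lam n)
      atTop (𝓝 (c * d)) := by
  set w : ℕ → ℕ → ℝ := fun n i =>
    scale k lam i * scale l lam (n - i) / scale (k + l + 1) lam n with hwdef
  set w' : ℕ → ℕ → ℝ := fun n i =>
    scale l lam i * scale k lam (n - i) / scale (k + l + 1) lam n with hwdef'
  have hw0 : ∀ n i, 0 ≤ w n i := fun n i => (div_pos (mul_pos (scale_pos k h0 _)
    (scale_pos l h0 _)) (scale_pos _ h0 _)).le
  have hw0' : ∀ n i, 0 ≤ w' n i := fun n i => (div_pos (mul_pos (scale_pos l h0 _)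
    (scale_pos k h0 _)) (scale_pos _ h0 _)).le
  have hw1 : ∀ n, ∑ i ∈ Finset.range (n + 1), w n i = 1 := fun n => by
    rw [hwdef, ← Finset.sum_div, sum_scale_mul_scale, div_self (scale_pos _ h0 n).ne']
  have hw1' : ∀ n, ∑ i ∈ Finset.range (n + 1), w' n i = 1 := fun n => by
    rw [hwdef', ← Finset.sum_div, sum_scale_mul_scale, add_comm l k,
      div_self (scale_pos _ h0 n).ne']
  have hlim' : ∀ i, Tendsto (fun n => w' n i) atTop (𝓝 0) := fun i => by
    have := tendsto_scale_weight l k h0 i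
    rwa [add_comm l k] at this
  set a : ℕ → ℝ := fun n => f n / scale k lam n with hadef
  set b : ℕ → ℝ := fun n => g n / scale l lam n with hbdef
  obtain ⟨B, hB⟩ : ∃ B, ∀ n, |b n| ≤ B := by
    obtain ⟨B, hB⟩ := (hg.abs).bddAbove_range
    exact ⟨B, fun n => hB (mem_range_self n)⟩
  have ha0 : Tendsto (fun n => |a n - c|) atTop (𝓝 0) := by
    simpa using (hf.sub_const c).abs
  have hb0 : Tendsto (fun n => |b n - d|) atTop (𝓝 0) := by
    simpa using (hg.sub_const d).abs
  have t1 := (tendsto_weighted_average (fun n i _ => hw0 n i) hw1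
    (tendsto_scale_weight k l h0) ha0).const_mul B
  have t2 := (tendsto_weighted_average (fun n i _ => hw0' n i) hw1' hlim' hb0).const_mul |c|
  have t3 := t1.add t2
  rw [mul_zero, mul_zero, add_zero] at t3
  refine tendsto_iff_norm_sub_tendsto_zero.2 (squeeze_zero (fun n => norm_nonneg _)
    (fun n => ?_) t3)
  have e1 : (∑ i ∈ Finset.range (n + 1), f i * g (n - i)) / scale (k + l + 1) lam n =
      ∑ i ∈ Finset.range (n + 1), w n i * (a i * b (n - i)) := by
    rw [Finset.sum_div]
    refine Finset.sum_congr rfl fun i _ => ?_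
    simp only [hwdef, hadef, hbdef]
    have := (scale_pos k h0 i).ne'
    have := (scale_pos l h0 (n - i)).ne'
    field_simp
  have e2 : c * d = ∑ i ∈ Finset.range (n + 1), w n i * (c * d) := by
    rw [← Finset.sum_mul, hw1, one_mul]
  have e3 : ∑ i ∈ Finset.range (n + 1), w' n i * |b i - d| =
      ∑ i ∈ Finset.range (n + 1), w n i * |b (n - i) - d| := by
    have := sum_range_reverse n fun i j => scale l lam i * scale k lam j /
      scale (k + l + 1) lam n * |b i - d|
    simp only [hwdef', hwdef]
    rw [this]
    exact Finset.sum_congr rfl fun i _ => by rw [mul_comm (scale l lam (n - i))]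
  rw [e1, e2, ← Finset.sum_sub_distrib, e3, Real.norm_eq_abs, Finset.mul_sum, Finset.mul_sum,
    ← Finset.sum_add_distrib]
  refine (Finset.abs_sum_le_sum_abs _ _).trans (Finset.sum_le_sum fun i _ => ?_)
  rw [← mul_sub, abs_mul, abs_of_nonneg (hw0 n i)]
  have e4 : a i * b (n - i) - c * d = (a i - c) * b (n - i) + c * (b (n - i) - d) := by ring
  calc w n i * |a i * b (n - i) - c * d|
      ≤ w n i * (|a i - c| * B + |c| * |b (n - i) - d|) := by
        refine mul_le_mul_of_nonneg_left ?_ (hw0 n i)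
        rw [e4]
        refine (abs_add_le _ _).trans ?_
        rw [abs_mul, abs_mul]
        exact add_le_add_left (mul_le_mul_of_nonneg_left (hB _) (abs_nonneg _)) _
    _ = _ := by ring

/-- Cauchy product of a sequence `g` with one of smaller exponential growth. -/
theorem tendsto_conv_of_summable {f g : ℕ → ℝ} {l : ℕ} {mu d : ℝ} (h0 : 0 < mu)
    (hf0 : ∀ n, 0 ≤ f n) (hg0 : ∀ n, 0 ≤ g n) (hf : Summable fun n => f n * (mu⁻¹) ^ n)
    (hg : Tendsto (fun n => g n / scale l mu n) atTop (𝓝 d)) :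
    Tendsto (fun n => (∑ i ∈ Finset.range (n + 1), f i * g (n - i)) / scale l mu n)
      atTop (𝓝 ((∑' n, f n * (mu⁻¹) ^ n) * d)) := by
  obtain ⟨C, hC0, hC⟩ := exists_bound_of_tendsto_div (scale_pos l h0) hg
  set F : ℕ → ℕ → ℝ := fun n i => if i ≤ n then f i * (g (n - i) / scale l mu n) else 0
  have hlim : ∀ i, Tendsto (fun n => F n i) atTop (𝓝 (f i * (mu⁻¹) ^ i * d)) := by
    intro i
    have h1 := (((hg.comp (tendsto_sub_atTop_nat i)).mul (tendsto_scale_sub_div l h0 i))).const_mul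
      (f i)
    rw [mul_comm d, ← mul_assoc] at h1
    refine h1.congr' ?_
    filter_upwards [eventually_ge_atTop i] with n hn
    simp only [F, if_pos hn, Function.comp_apply]
    rw [div_mul_div_cancel₀ (scale_pos l h0 _).ne']
  have key := tendsto_tsum_of_dominated_convergence (𝓕 := atTop) (f := F)
    (bound := fun i => f i * (mu⁻¹) ^ i * C) (hf.mul_right C) hlim
    (Eventually.of_forall fun n i => by
      have hnn : 0 ≤ f i * (mu⁻¹) ^ i * C :=
        mul_nonneg (mul_nonneg (hf0 i) (pow_pos (inv_pos.2 h0) i).le) hC0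
      simp only [F]
      split_ifs with h
      · rw [Real.norm_eq_abs, abs_of_nonneg (mul_nonneg (hf0 i)
          (div_nonneg (hg0 _) (scale_pos l h0 n).le)), mul_assoc]
        refine mul_le_mul_of_nonneg_left ?_ (hf0 i)
        rw [div_le_iff₀ (scale_pos l h0 n)]
        refine (hC _).trans ((mul_le_mul_of_nonneg_left (scale_sub_le l h0 h) hC0).trans
          (le_of_eq ?_))
        ring
      · simpa using hnn)
  rw [← tsum_mul_right]
  refine key.congr fun n => ?_
  rw [tsum_eq_sum (s := Finset.range (n + 1)), Finset.sum_div]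
  · refine Finset.sum_congr rfl fun i hi => ?_
    rw [Finset.mem_range] at hi
    simp only [F]
    rw [if_pos (by omega), mul_div_assoc]
  · intro i hi
    rw [Finset.mem_range] at hi
    simp only [F]
    rw [if_neg (by omega)]

/-! ### Asymptotics of binomial coefficients -/

theorem tendsto_choose_div_pow (k : ℕ) :
    Tendsto (fun n : ℕ => ((k + n).choose k : ℝ) / (n : ℝ) ^ k) atTop
      (𝓝 (1 / (k.factorial : ℝ))) := by
  have hk : (k.factorial : ℝ) ≠ 0 := by exact_mod_cast k.factorial_ne_zero
  have h1 : Tendsto (fun n : ℕ => (n.choose k : ℝ) / (n : ℝ) ^ k) atTop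
      (𝓝 (1 / (k.factorial : ℝ))) := by
    have h := (Asymptotics.isEquivalent_iff_tendsto_one (by
      filter_upwards [eventually_gt_atTop 0] with n hn
      positivity)).1 (isEquivalent_choose k)
    have h2 := h.mul_const (1 / (k.factorial : ℝ))
    rw [one_mul] at h2
    refine h2.congr fun n => ?_
    simp only [Pi.div_apply]
    field_simp
  have h2 : Tendsto (fun n : ℕ => (((k + n : ℕ) : ℝ) / (n : ℝ)) ^ k) atTop (𝓝 1) := by
    have h3 : Tendsto (fun n : ℕ => ((k + n : ℕ) : ℝ) / (n : ℝ)) atTop (𝓝 1) := by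
      have h4 := (tendsto_const_div_atTop_nhds_zero_nat (k : ℝ)).add_const 1
      rw [zero_add] at h4
      refine h4.congr' ?_
      filter_upwards [eventually_gt_atTop 0] with n hn
      have : (n : ℝ) ≠ 0 := by exact_mod_cast hn.ne'
      push_cast
      field_simp
    simpa using h3.pow k
  have h3 := (h1.comp (tendsto_add_atTop_nat k)).mul h2
  rw [mul_one] at h3
  refine h3.congr' ?_
  filter_upwards [eventually_gt_atTop 0] with n hn
  have : (n : ℝ) ≠ 0 := by exact_mod_cast hn.ne'
  have h5 : ((k : ℝ) + n) ≠ 0 := by positivity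
  simp only [Function.comp_apply]
  rw [add_comm n k, div_pow]
  push_cast
  field_simp

theorem tendsto_affine (q r : ℕ) (hq : q ≠ 0) : Tendsto (fun n => q * n + r) atTop atTop :=
  tendsto_atTop_mono (fun n => (Nat.le_mul_of_pos_left n (Nat.pos_of_ne_zero hq)).trans
    (Nat.le_add_right _ r)) tendsto_id

theorem tendsto_affine_div (q r : ℕ) :
    Tendsto (fun n : ℕ => ((q * n + r : ℕ) : ℝ) / (n : ℝ)) atTop (𝓝 q) := by
  have h4 := (tendsto_const_div_atTop_nhds_zero_nat (r : ℝ)).const_add (q : ℝ)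
  rw [add_zero] at h4
  refine h4.congr' ?_
  filter_upwards [eventually_gt_atTop 0] with n hn
  have : (n : ℝ) ≠ 0 := by exact_mod_cast hn.ne'
  push_cast
  field_simp

theorem tendsto_scale_affine (k : ℕ) {lam : ℝ} (h0 : 0 < lam) {q : ℕ} (hq : q ≠ 0) (r : ℕ) :
    Tendsto (fun n => scale k lam (q * n + r) / scale k (lam ^ q) n) atTop
      (𝓝 ((q : ℝ) ^ k * lam ^ r)) := by
  have hk : (k.factorial : ℝ) ≠ 0 := by exact_mod_cast k.factorial_ne_zero
  have h1 := (tendsto_choose_div_pow k).comp (tendsto_affine q r hq)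
  have h2 := (tendsto_choose_div_pow k).inv₀ (by positivity)
  have h3 := (tendsto_affine_div q r).pow k
  have h4 := ((h1.mul h2).mul h3).mul_const (lam ^ r)
  rw [mul_inv_cancel₀ (by positivity), one_mul] at h4
  refine h4.congr' ?_
  filter_upwards [eventually_gt_atTop 0] with n hn
  have hn' : (n : ℝ) ≠ 0 := by exact_mod_cast hn.ne'
  have hqn : ((q * n + r : ℕ) : ℝ) ≠ 0 := by
    have : 0 < q * n := Nat.mul_pos (Nat.pos_of_ne_zero hq) hn
    exact_mod_cast (by omega : q * n + r ≠ 0)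
  have hc : ((k + n).choose k : ℝ) ≠ 0 := by
    exact_mod_cast (Nat.choose_pos (Nat.le_add_right k n)).ne'
  simp only [Function.comp_apply, scale]
  rw [pow_add, pow_mul, div_pow]
  have := (pow_pos (pow_pos h0 q) n).ne'
  field_simp

/-! ### Pure sequences -/

/-- A nonnegative sequence that vanishes eventually or is asymptotic to a positive multiple of
`n ^ k * lam ^ n` (written with binomial coefficients, so that it makes sense for all `n`). -/
def IsPure (f : ℕ → ℝ) : Prop :=
  (∀ n, 0 ≤ f n) ∧ ((∀ᶠ n in atTop, f n = 0) ∨ ∃ (k : ℕ) (lam c : ℝ), 0 < lam ∧ 0 < c ∧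
    Tendsto (fun n => f n / scale k lam n) atTop (𝓝 c))

namespace IsPure

theorem zero : IsPure fun _ => 0 := ⟨fun _ => le_rfl, Or.inl (Eventually.of_forall fun _ => rfl)⟩

theorem congr {f g : ℕ → ℝ} (hf : IsPure f) (hg : ∀ n, 0 ≤ g n) (h : ∀ᶠ n in atTop, f n = g n) :
    IsPure g := by
  refine ⟨hg, ?_⟩
  rcases hf.2 with h0 | ⟨k, lam, c, hl, hc, ht⟩
  · left; filter_upwards [h0, h] with n h1 h2; rw [← h2, h1]
  · right
    refine ⟨k, lam, c, hl, hc, ht.congr' ?_⟩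
    filter_upwards [h] with n hn; rw [hn]

/-- The possible comparisons of two pure sequences. -/
theorem compare {f g : ℕ → ℝ} (hf : IsPure f) (hg : IsPure g) :
    (∀ᶠ n in atTop, f n = 0) ∨ (∀ᶠ n in atTop, g n = 0) ∨
    ∃ (k : ℕ) (lam c d : ℝ), 0 < lam ∧ 0 ≤ c ∧ 0 ≤ d ∧ (0 < c ∨ 0 < d) ∧
      Tendsto (fun n => f n / scale k lam n) atTop (𝓝 c) ∧
      Tendsto (fun n => g n / scale k lam n) atTop (𝓝 d) := by
  rcases hf.2 with h0 | ⟨k, lam, c, hl, hc, ht⟩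
  · exact Or.inl h0
  rcases hg.2 with h0 | ⟨l, mu, d, hm, hd, ht'⟩
  · exact Or.inr (Or.inl h0)
  refine Or.inr (Or.inr ?_)
  rcases scale_trichotomy k l hl hm with ⟨rfl, rfl⟩ | h | h
  · exact ⟨k, lam, c, d, hl, hc.le, hd.le, Or.inl hc, ht, ht'⟩
  · refine ⟨l, mu, 0, d, hm, le_rfl, hd.le, Or.inr hd, ?_, ht'⟩
    have := ht.mul h
    rw [mul_zero] at this
    refine this.congr fun n => ?_
    rw [div_mul_div_cancel₀ (scale_pos k hl n).ne']
  · refine ⟨k, lam, c, 0, hl, hc.le, le_rfl, Or.inl hc, ht, ?_⟩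
    have := ht'.mul h
    rw [mul_zero] at this
    refine this.congr fun n => ?_
    rw [div_mul_div_cancel₀ (scale_pos l hm n).ne']

theorem add {f g : ℕ → ℝ} (hf : IsPure f) (hg : IsPure g) : IsPure fun n => f n + g n := by
  have h0 : ∀ n, 0 ≤ f n + g n := fun n => add_nonneg (hf.1 n) (hg.1 n)
  rcases hf.compare hg with h | h | ⟨k, lam, c, d, hl, hc, hd, hcd, hf', hg'⟩
  · exact hg.congr h0 (by filter_upwards [h] with n hn; rw [hn, zero_add])
  · exact hf.congr h0 (by filter_upwards [h] with n hn; rw [hn, add_zero])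
  · refine ⟨h0, Or.inr ⟨k, lam, c + d, hl, ?_, ?_⟩⟩
    · rcases hcd with h | h <;> linarith
    · exact (hf'.add hg').congr fun n => (add_div _ _ _).symm

theorem finsetSum {ι : Type*} (s : Finset ι) {f : ι → ℕ → ℝ} (h : ∀ i ∈ s, IsPure (f i)) :
    IsPure fun n => ∑ i ∈ s, f i n := by
  classical
  induction s using Finset.induction_on with
  | empty => simpa using zero
  | insert a s ha ih =>
    simp_rw [Finset.sum_insert ha]
    exact (h a (Finset.mem_insert_self a s)).add
      (ih fun i hi => h i (Finset.mem_insert_of_mem hi))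

theorem min {f g : ℕ → ℝ} (hf : IsPure f) (hg : IsPure g) : IsPure fun n => min (f n) (g n) := by
  have h0 : ∀ n, 0 ≤ Min.min (f n) (g n) := fun n => le_min (hf.1 n) (hg.1 n)
  rcases hf.2 with h | ⟨k, lam, c, hl, hc, ht⟩
  · exact hf.congr h0 (by
      filter_upwards [h] with n hn; rw [hn, min_eq_left (hg.1 n)])
  rcases hg.2 with h | ⟨l, mu, d, hm, hd, ht'⟩
  · exact hg.congr h0 (by
      filter_upwards [h] with n hn; rw [hn, min_eq_right (hf.1 n)])
  rcases scale_trichotomy k l hl hm with ⟨rfl, rfl⟩ | h | h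
  · refine ⟨h0, Or.inr ⟨k, lam, Min.min c d, hl, lt_min hc hd, (ht.min ht').congr fun n => ?_⟩⟩
    exact (min_div_div_right (scale_pos k hl n).le _ _)
  · refine hf.congr h0 ?_
    have h1 := ht.mul h
    rw [mul_zero] at h1
    filter_upwards [h1.eventually_lt ht' hd] with n hn
    rw [div_mul_div_cancel₀ (scale_pos k hl n).ne',
      div_lt_div_iff_of_pos_right (scale_pos l hm n)] at hn
    rw [min_eq_left hn.le]
  · refine hg.congr h0 ?_
    have h1 := ht'.mul h
    rw [mul_zero] at h1
    filter_upwards [h1.eventually_lt ht hc] with n hn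
    rw [div_mul_div_cancel₀ (scale_pos l hm n).ne',
      div_lt_div_iff_of_pos_right (scale_pos k hl n)] at hn
    rw [min_eq_right hn.le]

theorem affine {f : ℕ → ℝ} (hf : IsPure f) {q : ℕ} (hq : q ≠ 0) (r : ℕ) :
    IsPure fun n => f (q * n + r) := by
  refine ⟨fun n => hf.1 _, ?_⟩
  rcases hf.2 with h | ⟨k, lam, c, hl, hc, ht⟩
  · exact Or.inl ((tendsto_affine q r hq).eventually h)
  · refine Or.inr ⟨k, lam ^ q, c * ((q : ℝ) ^ k * lam ^ r), pow_pos hl q, ?_, ?_⟩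
    · have : (0 : ℝ) < q := by exact_mod_cast Nat.pos_of_ne_zero hq
      positivity
    · refine ((ht.comp (tendsto_affine q r hq)).mul (tendsto_scale_affine k hl hq r)).congr
        fun n => ?_
      simp only [Function.comp_apply]
      rw [div_mul_div_cancel₀ (scale_pos k hl _).ne']

theorem conv_of_summable {f g : ℕ → ℝ} {l : ℕ} {mu d : ℝ} (h0 : 0 < mu) (hd : 0 < d)
    (hf0 : ∀ n, 0 ≤ f n) (hg0 : ∀ n, 0 ≤ g n) (hf : Summable fun n => f n * (mu⁻¹) ^ n)
    (hg : Tendsto (fun n => g n / scale l mu n) atTop (𝓝 d)) :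
    IsPure fun n => ∑ i ∈ Finset.range (n + 1), f i * g (n - i) := by
  by_cases hz : ∀ n, f n = 0
  · simpa [hz] using zero
  push Not at hz
  obtain ⟨m, hm⟩ := hz
  refine ⟨fun n => Finset.sum_nonneg fun i _ => mul_nonneg (hf0 _) (hg0 _), Or.inr
    ⟨l, mu, _, h0, mul_pos ?_ hd, tendsto_conv_of_summable h0 hf0 hg0 hf hg⟩⟩
  have hp : ∀ n, 0 < mu⁻¹ ^ n := fun n => pow_pos (inv_pos.2 h0) n
  exact hf.tsum_pos (fun n => mul_nonneg (hf0 n) (hp n).le) m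
    (mul_pos (lt_of_le_of_ne (hf0 m) hm.symm) (hp m))

theorem conv {f g : ℕ → ℝ} (hf : IsPure f) (hg : IsPure g) :
    IsPure fun n => ∑ i ∈ Finset.range (n + 1), f i * g (n - i) := by
  have hcomm : ∀ n, ∑ i ∈ Finset.range (n + 1), f i * g (n - i) =
      ∑ i ∈ Finset.range (n + 1), g i * f (n - i) := fun n => by
    rw [sum_range_reverse n fun i j => f i * g j]
    exact Finset.sum_congr rfl fun i _ => mul_comm _ _
  have hfin : ∀ (u : ℕ → ℝ) (mu : ℝ), (∀ᶠ n in atTop, u n = 0) →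
      Summable fun n => u n * (mu⁻¹) ^ n := by
    intro u mu hu
    obtain ⟨N, hN⟩ := eventually_atTop.1 hu
    refine summable_of_ne_finset_zero (s := Finset.range N) fun n hn => ?_
    rw [hN n (by simpa using hn), zero_mul]
  have hsm : ∀ (u : ℕ → ℝ) (k : ℕ) (lam c mu : ℝ), (∀ n, 0 ≤ u n) → 0 < lam → lam < mu →
      Tendsto (fun n => u n / scale k lam n) atTop (𝓝 c) →
      Summable fun n => u n * (mu⁻¹) ^ n := by
    intro u k lam c mu hu hl hlm ht
    have hmu : 0 < mu := hl.trans hlm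
    obtain ⟨C, _, hC⟩ := exists_bound_of_tendsto_div (scale_pos k hl) ht
    refine Summable.of_nonneg_of_le
      (fun n => mul_nonneg (hu n) (pow_pos (inv_pos.2 hmu) n).le) (fun n => ?_)
      ((summable_scale k (div_pos hl hmu).le ((div_lt_one hmu).2 hlm)).mul_left C)
    rw [div_eq_mul_inv, ← scale_mul, ← mul_assoc]
    exact mul_le_mul_of_nonneg_right (hC n) (pow_pos (inv_pos.2 hmu) n).le
  rcases hf.2 with h | ⟨k, lam, c, hl, hc, ht⟩ <;> rcases hg.2 with h' | ⟨l, mu, d, hm, hd, ht'⟩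
  · refine ⟨fun n => Finset.sum_nonneg fun i _ => mul_nonneg (hf.1 _) (hg.1 _), Or.inl ?_⟩
    obtain ⟨N, hN⟩ := eventually_atTop.1 h
    obtain ⟨M, hM⟩ := eventually_atTop.1 h'
    filter_upwards [eventually_ge_atTop (N + M)] with n hn
    refine Finset.sum_eq_zero fun i _ => ?_
    rcases le_total N i with hi | hi
    · rw [hN i hi, zero_mul]
    · rw [hM (n - i) (by omega), mul_zero]
  · exact conv_of_summable hm hd hf.1 hg.1 (hfin f mu h) ht'
  · simp_rw [hcomm]
    exact conv_of_summable hl hc hg.1 hf.1 (hfin g lam h') ht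
  · rcases lt_trichotomy lam mu with hlm | rfl | hlm
    · exact conv_of_summable hm hd hf.1 hg.1 (hsm f k lam c mu hf.1 hl hlm ht) ht'
    · exact ⟨fun n => Finset.sum_nonneg fun i _ => mul_nonneg (hf.1 _) (hg.1 _), Or.inr
        ⟨_, _, _, hl, mul_pos hc hd, tendsto_conv_of_eq hl ht ht'⟩⟩
    · simp_rw [hcomm]
      exact conv_of_summable hl hc hg.1 hf.1 (hsm g l mu d lam hg.1 hm hlm ht') ht

theorem coeff_mul {f g : PowerSeries ℝ} (hf : IsPure fun n => PowerSeries.coeff n f)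
    (hg : IsPure fun n => PowerSeries.coeff n g) :
    IsPure fun n => PowerSeries.coeff n (f * g) := by
  refine (hf.conv hg).congr (fun n => ?_) (Eventually.of_forall fun n => ?_)
  · rw [PowerSeries.coeff_mul]
    exact Finset.sum_nonneg fun i _ => mul_nonneg (hf.1 _) (hg.1 _)
  · rw [PowerSeries.coeff_mul, Finset.Nat.sum_antidiagonal_eq_sum_range_succ
      (f := fun i j => PowerSeries.coeff i f * PowerSeries.coeff j g)]

theorem coeff_X_pow (m : ℕ) :
    IsPure fun n => PowerSeries.coeff n (PowerSeries.X ^ m : PowerSeries ℝ) := by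
  refine ⟨fun n => ?_, Or.inl ?_⟩
  · simp only [PowerSeries.coeff_X_pow]; split_ifs <;> norm_num
  · filter_upwards [eventually_gt_atTop m] with n hn
    rw [PowerSeries.coeff_X_pow, if_neg hn.ne']

end IsPure

/-! ### Power series with tame coefficients -/

/-- All subsequences of the coefficients of `f` along residue classes modulo `q` are pure. -/
def IsTameMod (q : ℕ) (f : PowerSeries ℝ) : Prop :=
  ∀ r, IsPure fun n => PowerSeries.coeff (q * n + r) f

/-- `f` is tame for some positive modulus. -/
def IsTame (f : PowerSeries ℝ) : Prop := ∃ q, q ≠ 0 ∧ IsTameMod q f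

/-- The power series of the coefficients of `f` with index in `r + q * ℕ`. -/
def residueSection (q r : ℕ) (f : PowerSeries ℝ) : PowerSeries ℝ :=
  PowerSeries.mk fun n => PowerSeries.coeff (q * n + r) f

theorem eq_sum_residueSection {q : ℕ} (hq : q ≠ 0) (f : PowerSeries ℝ) :
    f = ∑ r ∈ Finset.range q,
      PowerSeries.X ^ r * PowerSeries.expand q hq (residueSection q r f) := by
  ext n
  rw [map_sum, Finset.sum_eq_single (n % q)]
  · rw [PowerSeries.coeff_X_pow_mul', if_pos (Nat.mod_le n q),
      show n - n % q = q * (n / q) by have := Nat.div_add_mod n q; omega,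
      PowerSeries.coeff_expand_mul, residueSection, PowerSeries.coeff_mk, Nat.div_add_mod]
  · intro r hr hne
    rw [Finset.mem_range] at hr
    rw [PowerSeries.coeff_X_pow_mul']
    split_ifs with h
    · refine PowerSeries.coeff_expand_of_not_dvd q hq _ fun hd => hne ?_
      have := (Nat.modEq_iff_dvd' h).2 hd
      rw [Nat.ModEq, Nat.mod_eq_of_lt hr] at this
      exact this
    · rfl
  · intro h
    exact absurd (Finset.mem_range.2 (Nat.mod_lt n (Nat.pos_of_ne_zero hq))) h

namespace IsTameMod

theorem coeff_nonneg {q : ℕ} {f : PowerSeries ℝ} (hf : IsTameMod q f) (n : ℕ) :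
    0 ≤ PowerSeries.coeff n f := by
  simpa using (hf n).1 0

theorem add {q : ℕ} {f g : PowerSeries ℝ} (hf : IsTameMod q f) (hg : IsTameMod q g) :
    IsTameMod q (f + g) := fun r => by
  simpa only [map_add] using (hf r).add (hg r)

theorem finsetSum {q : ℕ} {ι : Type*} (s : Finset ι) {f : ι → PowerSeries ℝ}
    (h : ∀ i ∈ s, IsTameMod q (f i)) : IsTameMod q (∑ i ∈ s, f i) := fun r => by
  simpa only [map_sum] using IsPure.finsetSum s fun i hi => h i hi r

theorem mul_right {q t : ℕ} {f : PowerSeries ℝ} (hf : IsTameMod q f) (ht : t ≠ 0) :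
    IsTameMod (q * t) f := fun r => by
  have := (hf r).affine ht 0
  simpa only [add_zero, mul_assoc] using this

/-- The building blocks `X ^ m * h(X ^ q)` with `h` pure, of which by `eq_sum_residueSection` every
series that is tame modulo `q` is a sum. -/
theorem X_pow_mul_expand {q : ℕ} (hq : q ≠ 0) (m : ℕ) {h : PowerSeries ℝ}
    (hh : IsPure fun n => PowerSeries.coeff n h) :
    IsTameMod q (PowerSeries.X ^ m * PowerSeries.expand q hq h) := by
  intro r
  by_cases hmod : r ≡ m [MOD q]
  · rcases le_total m r with hle | hle
    · obtain ⟨a, ha⟩ := (Nat.modEq_iff_dvd' hle).1 hmod.symm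
      have := hh.affine one_ne_zero a
      refine this.congr (fun n => ?_) (Eventually.of_forall fun n => ?_) <;>
      rw [PowerSeries.coeff_X_pow_mul', if_pos (by omega),
        show q * n + r - m = q * (1 * n + a) by rw [one_mul, mul_add]; omega,
        PowerSeries.coeff_expand_mul]
      exact this.1 n
    · obtain ⟨a, ha⟩ := (Nat.modEq_iff_dvd' hle).1 hmod
      have h1 := (IsPure.coeff_X_pow a).coeff_mul hh
      have h2 : ∀ n, PowerSeries.coeff (q * n + r) (PowerSeries.X ^ m *
          PowerSeries.expand q hq h) = PowerSeries.coeff n (PowerSeries.X ^ a * h) := by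
        intro n
        rw [PowerSeries.coeff_X_pow_mul', PowerSeries.coeff_X_pow_mul']
        by_cases hn : a ≤ n
        · have := Nat.mul_le_mul_left q hn
          rw [if_pos (by omega), if_pos hn, show q * n + r - m = q * (n - a) by
            rw [Nat.mul_sub]; omega, PowerSeries.coeff_expand_mul]
        · have : q * (n + 1) ≤ q * a := Nat.mul_le_mul_left q (by omega)
          rw [mul_add] at this
          have := Nat.pos_of_ne_zero hq
          rw [if_neg hn]
          split_ifs with h3
          · exfalso; omega
          · rfl
      simpa only [h2] using h1
  · have h2 : ∀ n, PowerSeries.coeff (q * n + r) (PowerSeries.X ^ m *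
          PowerSeries.expand q hq h) = 0 := by
      intro n
      rw [PowerSeries.coeff_X_pow_mul']
      split_ifs with h3
      · refine PowerSeries.coeff_expand_of_not_dvd q hq _ fun hd => hmod ?_
        have h4 := (Nat.modEq_iff_dvd' h3).2 hd
        have h5 : q * n + r ≡ r [MOD q] := by simp [Nat.ModEq]
        exact (h4.trans h5).symm
      · rfl
    simpa only [h2] using IsPure.zero

theorem mul {q : ℕ} (hq : q ≠ 0) {f g : PowerSeries ℝ} (hf : IsTameMod q f)
    (hg : IsTameMod q g) : IsTameMod q (f * g) := by
  rw [eq_sum_residueSection hq f, eq_sum_residueSection hq g, Finset.sum_mul_sum]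
  refine finsetSum _ fun i _ => finsetSum _ fun j _ => ?_
  rw [mul_mul_mul_comm, ← pow_add, ← map_mul]
  refine X_pow_mul_expand hq _ (IsPure.coeff_mul ?_ ?_)
  · simpa only [residueSection, PowerSeries.coeff_mk] using hf i
  · simpa only [residueSection, PowerSeries.coeff_mk] using hg j

end IsTameMod

namespace IsTame

theorem exists_common {f g : PowerSeries ℝ} (hf : IsTame f) (hg : IsTame g) :
    ∃ q, q ≠ 0 ∧ IsTameMod q f ∧ IsTameMod q g := by
  obtain ⟨q, hq, hf⟩ := hf
  obtain ⟨t, ht, hg⟩ := hg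
  exact ⟨q * t, mul_ne_zero hq ht, hf.mul_right ht, mul_comm t q ▸ hg.mul_right hq⟩

theorem coeff_nonneg {f : PowerSeries ℝ} (hf : IsTame f) (n : ℕ) : 0 ≤ PowerSeries.coeff n f := by
  obtain ⟨q, -, hf'⟩ := hf; exact hf'.coeff_nonneg n

theorem add {f g : PowerSeries ℝ} (hf : IsTame f) (hg : IsTame g) : IsTame (f + g) := by
  obtain ⟨q, hq, hf, hg⟩ := hf.exists_common hg
  exact ⟨q, hq, hf.add hg⟩

theorem mul {f g : PowerSeries ℝ} (hf : IsTame f) (hg : IsTame g) : IsTame (f * g) := by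
  obtain ⟨q, hq, hf, hg⟩ := hf.exists_common hg
  exact ⟨q, hq, hf.mul hq hg⟩

theorem of_isPure {f : PowerSeries ℝ} (hf : IsPure fun n => PowerSeries.coeff n f) : IsTame f :=
  ⟨1, one_ne_zero, fun r => hf.affine one_ne_zero r⟩

theorem of_coeff_eq_zero {f : PowerSeries ℝ} (h0 : ∀ n, 0 ≤ PowerSeries.coeff n f)
    (h : ∀ᶠ n in atTop, PowerSeries.coeff n f = 0) : IsTame f := of_isPure ⟨h0, Or.inl h⟩

theorem zero : IsTame 0 := of_coeff_eq_zero (by simp) (by simp)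

theorem natCast (a : ℕ) : IsTame (a : PowerSeries ℝ) := by
  have h : (a : PowerSeries ℝ) = PowerSeries.C (a : ℝ) := by simp
  rw [h]
  refine of_coeff_eq_zero (fun n => ?_) ?_
  · rw [PowerSeries.coeff_C]; split_ifs <;> simp
  · filter_upwards [eventually_gt_atTop 0] with n hn
    rw [PowerSeries.coeff_C, if_neg hn.ne']

theorem X : IsTame PowerSeries.X := of_isPure (by simpa using IsPure.coeff_X_pow 1)

theorem finsetSum {ι : Type*} (s : Finset ι) {f : ι → PowerSeries ℝ}
    (h : ∀ i ∈ s, IsTame (f i)) : IsTame (∑ i ∈ s, f i) :=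
  Finset.sum_induction _ IsTame (fun _ _ => add) zero h

end IsTame

/-! ### Quasi-inverses of tame series -/

/-- At a point where the terms of a power series with pure coefficients tend to zero, the
exponential growth rate of the coefficients leaves some room. -/
theorem IsPure.exists_gt_bounded {f : ℕ → ℝ} (hf : IsPure f) {q : ℕ} {x : ℝ}
    (hx : 0 ≤ x) (h : Tendsto (fun n => f n * (x ^ q) ^ n) atTop (𝓝 0)) :
    ∃ y > x, ∃ C, ∀ z, 0 ≤ z → z ≤ y → ∀ n, f n * (z ^ q) ^ n ≤ C := by
  have main : ∃ y > x, ∃ C, ∀ n, f n * (y ^ q) ^ n ≤ C := by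
    rcases hf.2 with h0 | ⟨k, lam, c, hl, hc, ht⟩
    · refine ⟨x + 1, by simp, ?_⟩
      have : Tendsto (fun n => f n * ((x + 1) ^ q) ^ n) atTop (𝓝 0) :=
        tendsto_const_nhds.congr' (by filter_upwards [h0] with n hn; rw [hn, zero_mul])
      obtain ⟨C, hC⟩ := this.bddAbove_range
      exact ⟨C, fun n => hC (mem_range_self n)⟩
    · have hlt : lam * x ^ q < 1 := by
        by_contra! hge
        have h1 : ∀ᶠ n in atTop, c / 2 ≤ f n * (x ^ q) ^ n := by
          filter_upwards [ht.eventually_const_lt (half_lt_self hc)] with n hn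
          rw [lt_div_iff₀ (scale_pos k hl n)] at hn
          calc c / 2 ≤ c / 2 * (lam * x ^ q) ^ n :=
                le_mul_of_one_le_right (half_pos hc).le (one_le_pow₀ hge)
            _ = (c / 2 * lam ^ n) * (x ^ q) ^ n := by rw [mul_pow]; ring
            _ ≤ (c / 2 * scale k lam n) * (x ^ q) ^ n := by
                refine mul_le_mul_of_nonneg_right ?_ (by positivity)
                exact mul_le_mul_of_nonneg_left (pow_le_scale k hl n) (half_pos hc).le
            _ ≤ _ := mul_le_mul_of_nonneg_right hn.le (by positivity)
        have := ge_of_tendsto h h1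
        linarith
      obtain ⟨y, hy, hxy⟩ : ∃ y, lam * y ^ q < 1 ∧ x < y := by
        have hcont : Continuous fun y : ℝ => lam * y ^ q := by fun_prop
        have h1 : ∀ᶠ y in 𝓝[>] x, lam * y ^ q < 1 :=
          (hcont.tendsto x).mono_left nhdsWithin_le_nhds |>.eventually_lt_const hlt
        obtain ⟨y, hy⟩ := (h1.and self_mem_nhdsWithin).exists
        exact ⟨y, hy⟩
      have hy0 : 0 < y := hx.trans_lt hxy
      refine ⟨y, hxy, ?_⟩
      have h2 := (summable_scale k (lam := lam * y ^ q) (by positivity) hy).tendsto_atTop_zero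
      have h3 := ht.mul h2
      obtain ⟨C, hC⟩ := h3.bddAbove_range
      refine ⟨C, fun n => ?_⟩
      have := hC (mem_range_self n)
      rwa [← scale_mul, ← mul_assoc, div_mul_cancel₀ _ (scale_pos k hl n).ne'] at this
  obtain ⟨y, hy, C, hC⟩ := main
  refine ⟨y, hy, C, fun z hz hzy n => (mul_le_mul_of_nonneg_left ?_ (hf.1 n)).trans (hC n)⟩
  exact pow_le_pow_left₀ (pow_nonneg hz q) (pow_le_pow_left₀ hz hzy q) n

theorem IsTame.exists_gt_bounded {f : PowerSeries ℝ} (hf : IsTame f) {x : ℝ} (hx : 0 ≤ x)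
    (h : Tendsto (fun n => PowerSeries.coeff n f * x ^ n) atTop (𝓝 0)) :
    ∃ y > x, ∃ C, ∀ n, PowerSeries.coeff n f * y ^ n ≤ C := by
  obtain ⟨q, hq, hf⟩ := hf
  have hres : ∀ r, ∃ y > x, ∃ C, ∀ z, x < z → z ≤ y → ∀ n,
      PowerSeries.coeff (q * n + r) f * (z ^ q) ^ n ≤ C := by
    intro r
    have ht : Tendsto (fun n => PowerSeries.coeff (q * n + r) f * (x ^ q) ^ n) atTop (𝓝 0) := by
      rcases hx.eq_or_lt with rfl | hx
      · refine tendsto_const_nhds.congr' ?_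
        filter_upwards [eventually_gt_atTop 0] with n hn
        rw [zero_pow hq, zero_pow hn.ne', mul_zero]
      · have h1 := (h.comp (tendsto_affine q r hq)).mul_const (x ^ r)⁻¹
        rw [zero_mul] at h1
        refine h1.congr fun n => ?_
        have := (pow_pos hx r).ne'
        simp only [Function.comp_apply]
        rw [pow_add, pow_mul]
        field_simp
    obtain ⟨y, hy, C, hC⟩ := (hf r).exists_gt_bounded hx ht
    exact ⟨y, hy, C, fun z hz hzy n => hC z (hx.trans hz.le) hzy n⟩
  choose Y hY C hC using hres
  have hq0 : (Finset.range q).Nonempty := Finset.nonempty_range_iff.2 hq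
  obtain ⟨r₀, hr₀, hmin⟩ := Finset.exists_min_image (Finset.range q) Y hq0
  obtain ⟨r₁, hr₁, hmax⟩ := Finset.exists_max_image (Finset.range q)
    (fun r => C r * Y r₀ ^ r) hq0
  refine ⟨Y r₀, hY r₀, C r₁ * Y r₀ ^ r₁, fun n => ?_⟩
  have hr : n % q ∈ Finset.range q := Finset.mem_range.2 (Nat.mod_lt n (Nat.pos_of_ne_zero hq))
  refine le_trans ?_ (hmax _ hr)
  have h1 := hC (n % q) (Y r₀) (hY r₀) (hmin _ hr) (n / q)
  rw [Nat.div_add_mod] at h1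
  have h2 : Y r₀ ^ n = (Y r₀ ^ q) ^ (n / q) * Y r₀ ^ (n % q) := by
    rw [← pow_mul, ← pow_add, Nat.div_add_mod]
  rw [h2, ← mul_assoc]
  exact mul_le_mul_of_nonneg_right h1 (pow_nonneg (hx.trans (hY r₀).le) _)

/-- A tame series diverges on the boundary of its disc of convergence. -/
theorem IsTame.exists_gt_summable {f : PowerSeries ℝ} (hf : IsTame f) {x : ℝ} (hx : 0 ≤ x)
    (h : Summable fun n => PowerSeries.coeff n f * x ^ n) :
    ∃ y > x, Summable fun n => PowerSeries.coeff n f * y ^ n := by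
  obtain ⟨y, hy, C, hC⟩ := hf.exists_gt_bounded hx h.tendsto_atTop_zero
  obtain ⟨q, -, hf'⟩ := hf
  refine ⟨(x + y) / 2, by linarith, ?_⟩
  have hy0 : 0 < y := hx.trans_lt hy
  have hz0 : 0 ≤ (x + y) / 2 := by linarith
  have hlt : (x + y) / 2 / y < 1 := by rw [div_lt_one hy0]; linarith
  refine Summable.of_nonneg_of_le
    (fun n => mul_nonneg (hf'.coeff_nonneg n) (pow_nonneg hz0 n)) (fun n => ?_)
    ((summable_geometric_of_lt_one (div_nonneg hz0 hy0.le) hlt).mul_left C)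
  have h1 : PowerSeries.coeff n f * ((x + y) / 2) ^ n =
      (PowerSeries.coeff n f * y ^ n) * ((x + y) / 2 / y) ^ n := by
    rw [div_pow _ y]
    have := (pow_pos hy0 n).ne'
    field_simp
  rw [h1]
  exact mul_le_mul_of_nonneg_right (hC n) (pow_nonneg (div_nonneg hz0 hy0.le) n)

/-- A nonzero tame series without constant term takes the value one inside its disc of
convergence. -/
theorem IsTame.exists_hasSum_one {f : PowerSeries ℝ} (hf : IsTame f)
    (h0 : PowerSeries.coeff 0 f = 0) {m : ℕ} (hm : 0 < PowerSeries.coeff m f) :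
    ∃ x > 0, HasSum (fun n => PowerSeries.coeff n f * x ^ n) 1 ∧
      ∃ y > x, Summable fun n => PowerSeries.coeff n f * y ^ n := by
  have hnn := hf.coeff_nonneg
  -- `S` is a compact interval; the solution is its right end point.
  set S : Set ℝ := {x | 0 ≤ x ∧ ∀ N, ∑ n ∈ Finset.range N, PowerSeries.coeff n f * x ^ n ≤ 1}
    with hS
  have hSclosed : IsClosed S := by
    have : S = Ici 0 ∩ ⋂ N, {x | ∑ n ∈ Finset.range N, PowerSeries.coeff n f * x ^ n ≤ 1} := by
      ext x; simp [hS]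
    rw [this]
    exact isClosed_Ici.inter (isClosed_iInter fun N =>
      isClosed_le (by fun_prop) continuous_const)
  have hS0 : (0 : ℝ) ∈ S := by
    refine ⟨le_rfl, fun N => ?_⟩
    rw [Finset.sum_eq_zero]
    · exact zero_le_one
    · intro n _
      rcases Nat.eq_zero_or_pos n with rfl | hn
      · rw [h0, zero_mul]
      · rw [zero_pow hn.ne', mul_zero]
  have hm0 : m ≠ 0 := by rintro rfl; exact hm.ne' h0
  have hSbdd : BddAbove S := by
    refine ⟨max 1 (PowerSeries.coeff m f)⁻¹, fun x hx => ?_⟩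
    rcases le_total x 1 with h1 | h1
    · exact h1.trans (le_max_left _ _)
    · refine le_trans ?_ (le_max_right _ _)
      have h2 : PowerSeries.coeff m f * x ^ m ≤ 1 :=
        (Finset.single_le_sum (f := fun n => PowerSeries.coeff n f * x ^ n)
          (fun n _ => mul_nonneg (hnn n) (pow_nonneg hx.1 n))
          (Finset.self_mem_range_succ m)).trans (hx.2 (m + 1))
      have h3 : x ≤ x ^ m := le_self_pow₀ h1 hm0
      rw [← one_div, le_div_iff₀ hm, mul_comm]
      exact (mul_le_mul_of_nonneg_left h3 hm.le).trans h2
  have hx := hSclosed.csSup_mem ⟨0, hS0⟩ hSbdd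
  set x := sSup S with hxdef
  have hsum : Summable fun n => PowerSeries.coeff n f * x ^ n :=
    summable_of_sum_range_le (fun n => mul_nonneg (hnn n) (pow_nonneg hx.1 n)) hx.2
  obtain ⟨y, hy, hys⟩ := hf.exists_gt_summable hx.1 hsum
  have hle : ∑' n, PowerSeries.coeff n f * x ^ n ≤ 1 :=
    Real.tsum_le_of_sum_range_le (fun n => mul_nonneg (hnn n) (pow_nonneg hx.1 n)) hx.2
  have heq : ∑' n, PowerSeries.coeff n f * x ^ n = 1 := by
    by_contra hne
    have hlt := lt_of_le_of_ne hle hne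
    have hcont : Tendsto (fun z => ∑' n, PowerSeries.coeff n f * z ^ n) (𝓝[>] x)
        (𝓝 (∑' n, PowerSeries.coeff n f * x ^ n)) := by
      refine tendsto_tsum_of_dominated_convergence hys (fun n => ?_) ?_
      · have : Continuous fun z : ℝ => PowerSeries.coeff n f * z ^ n := by fun_prop
        exact (this.tendsto x).mono_left nhdsWithin_le_nhds
      · filter_upwards [Ioo_mem_nhdsGT hy] with z hz n
        have hz0 := hx.1.trans hz.1.le
        rw [Real.norm_eq_abs, abs_of_nonneg (mul_nonneg (hnn n) (pow_nonneg hz0 n))]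
        exact mul_le_mul_of_nonneg_left (pow_le_pow_left₀ hz0 hz.2.le n) (hnn n)
    obtain ⟨z, hz1, hz2⟩ := ((hcont.eventually_lt_const hlt).and (Ioo_mem_nhdsGT hy)).exists
    have hz0 := hx.1.trans hz2.1.le
    have hzS : z ∈ S := by
      refine ⟨hz0, fun N => (Summable.sum_le_tsum _ (fun n _ =>
        mul_nonneg (hnn n) (pow_nonneg hz0 n)) ?_).trans hz1.le⟩
      exact Summable.of_nonneg_of_le (fun n => mul_nonneg (hnn n) (pow_nonneg hz0 n))
        (fun n => mul_le_mul_of_nonneg_left (pow_le_pow_left₀ hz0 hz2.2.le n) (hnn n)) hys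
    exact absurd (le_csSup hSbdd hzS) (not_le.2 hz2.1)
  refine ⟨x, lt_of_le_of_ne hx.1 fun hx0 => ?_, heq ▸ hsum.hasSum, y, hy, hys⟩
  rw [← hx0] at heq
  have : ∑' n, PowerSeries.coeff n f * (0 : ℝ) ^ n = 0 := by
    rw [tsum_eq_single 0 fun n hn => by rw [zero_pow hn, mul_zero], h0, zero_mul]
  rw [this] at heq
  exact zero_ne_one heq

/-- The renewal theorem for a power series `f` whose exponents have greatest common divisor one:
if `f` takes the value one at `x`, inside its disc of convergence, then the coefficients of
`1 / (1 - f)` are asymptotic to a multiple of `x⁻¹ ^ n`. -/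
theorem tendsto_coeff_inv_one_sub {f u : PowerSeries ℝ} (hnn : ∀ n, 0 ≤ PowerSeries.coeff n f)
    (h0 : PowerSeries.coeff 0 f = 0) (hgcd : Nat.setGcd {n | 0 < PowerSeries.coeff n f} = 1)
    {x y : ℝ} (hx : 0 < x) (hxy : x < y) (h1 : HasSum (fun n => PowerSeries.coeff n f * x ^ n) 1)
    (hy : Summable fun n => PowerSeries.coeff n f * y ^ n) (hu : u * (1 - f) = 1) :
    ∃ c > 0, Tendsto (fun n => PowerSeries.coeff n u / (x⁻¹) ^ n) atTop (𝓝 c) := by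
  have hmk : ∀ g : PowerSeries ℝ, PowerSeries.mk (fun n => PowerSeries.coeff n g * x ^ n) =
      PowerSeries.rescale x g := fun g => by
    ext n; rw [PowerSeries.coeff_mk, PowerSeries.coeff_rescale, mul_comm]
  obtain ⟨c, hc, ht⟩ := tendsto_renewal (p := fun n => PowerSeries.coeff n f * x ^ n)
    (v := fun n => PowerSeries.coeff n u * x ^ n) (ρ := y / x)
    (fun n => mul_nonneg (hnn n) (pow_pos hx n).le) (by simp [h0]) h1
    ((one_lt_div hx).2 hxy) (hy.congr fun n => by
      rw [div_pow]; have := (pow_pos hx n).ne'; field_simp)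
    (by
      rw [← hgcd]; congr 1; ext n
      exact mul_pos_iff_of_pos_right (pow_pos hx n))
    (by rw [hmk, hmk, ← map_one (PowerSeries.rescale x), ← map_sub, ← map_mul, hu, map_one])
  refine ⟨c, hc, ht.congr fun n => ?_⟩
  rw [inv_pow, div_inv_eq_mul]

/-- Tame series without constant term have tame quasi-inverses. The series is written as
`f = g(X ^ d)`, where the exponents of `g` have greatest common divisor one. -/
theorem IsTame.inv_one_sub {f u : PowerSeries ℝ} (hf : IsTame f)
    (h0 : PowerSeries.coeff 0 f = 0) (hu : u * (1 - f) = 1) : IsTame u := by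
  obtain ⟨q, hq, hfq⟩ := id hf
  by_cases hz : ∀ n, PowerSeries.coeff n f = 0
  · have : f = 0 := by ext n; simp [hz]
    rw [this, sub_zero, mul_one] at hu
    rw [hu]; exact_mod_cast natCast 1
  push Not at hz
  obtain ⟨m, hm⟩ := hz
  have hm : 0 < PowerSeries.coeff m f := lt_of_le_of_ne (hfq.coeff_nonneg m) hm.symm
  have hm0 : m ≠ 0 := by rintro rfl; exact hm.ne' h0
  set d := Nat.setGcd {n | 0 < PowerSeries.coeff n f} with hd
  have hd0 : d ≠ 0 := by
    intro h
    rw [hd, Nat.setGcd_eq_zero_iff] at h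
    exact hm0 (h hm)
  have hsupp : ∀ n, ¬ d ∣ n → PowerSeries.coeff n f = 0 := by
    intro n hn
    by_contra hne
    exact hn (Nat.setGcd_dvd_of_mem (lt_of_le_of_ne (hfq.coeff_nonneg n) (Ne.symm hne)))
  set g := residueSection d 0 f with hg
  have hgc : ∀ n, PowerSeries.coeff n g = PowerSeries.coeff (d * n) f := fun n => by
    rw [hg, residueSection, PowerSeries.coeff_mk, add_zero]
  have hfg : f = PowerSeries.expand d hd0 g := by
    ext n
    rw [PowerSeries.coeff_expand]
    split_ifs with h
    · rw [hgc, Nat.mul_div_cancel' h]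
    · exact hsupp n h
  have hgt : IsTame g := by
    refine ⟨q, hq, fun r => ?_⟩
    have := (hfq (d * r)).affine hd0 0
    refine this.congr (fun n => ?_) (Eventually.of_forall fun n => ?_)
    · rw [hgc]; exact hfq.coeff_nonneg _
    · rw [hgc, add_zero, mul_add, mul_left_comm q]
  have hgnn : ∀ n, 0 ≤ PowerSeries.coeff n g := fun n => by
    rw [hgc]; exact hfq.coeff_nonneg _
  have hg0 : PowerSeries.coeff 0 g = 0 := by rw [hgc, mul_zero, h0]
  have hgcd : Nat.setGcd {n | 0 < PowerSeries.coeff n g} = 1 := by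
    have h1 : d * Nat.setGcd {n | 0 < PowerSeries.coeff n g} ∣ d := by
      nth_rw 2 [hd]
      rw [Nat.dvd_setGcd_iff]
      intro n hn
      obtain ⟨k, rfl⟩ := Nat.setGcd_dvd_of_mem hn
      refine Nat.mul_dvd_mul_left d (Nat.setGcd_dvd_of_mem ?_)
      rw [Set.mem_ofPred_eq, hgc]
      exact hn
    exact Nat.dvd_one.1 (Nat.dvd_of_mul_dvd_mul_left (Nat.pos_of_ne_zero hd0) (by simpa using h1))
  obtain ⟨k, rfl⟩ : d ∣ m := by
    by_contra h; exact hm.ne' (hsupp m h)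
  obtain ⟨x, hx, h1, y, hxy, hy⟩ := hgt.exists_hasSum_one hg0 (m := k) (by rwa [hgc])
  have hcc : PowerSeries.constantCoeff (1 - g) ≠ 0 := by
    rw [map_sub, map_one, ← PowerSeries.coeff_zero_eq_constantCoeff_apply, hg0]; norm_num
  have hv : (1 - g)⁻¹ * (1 - g) = 1 := PowerSeries.inv_mul_cancel _ hcc
  obtain ⟨c, hc, ht⟩ := tendsto_coeff_inv_one_sub hgnn hg0 hgcd hx hxy h1 hy hv
  have huv : u = PowerSeries.expand d hd0 (1 - g)⁻¹ := by
    have h2 := congrArg (PowerSeries.expand d hd0) hv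
    rw [map_mul, map_sub, map_one, ← hfg] at h2
    exact left_inv_eq_right_inv hu (by rw [mul_comm]; exact h2)
  have hnnv : ∀ n, 0 ≤ PowerSeries.coeff n (1 - g)⁻¹ := by
    have hrec : (1 - g)⁻¹ = g * (1 - g)⁻¹ + 1 := by linear_combination hv
    intro n
    induction n using Nat.strong_induction_on with
    | _ n ih =>
      rw [hrec, map_add, PowerSeries.coeff_mul, PowerSeries.coeff_one]
      refine add_nonneg (Finset.sum_nonneg fun i hi => ?_) (by split_ifs <;> norm_num)
      rw [Finset.HasAntidiagonal.mem_antidiagonal] at hi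
      rcases Nat.eq_zero_or_pos i.1 with h | h
      · rw [h, hg0, zero_mul]
      · exact mul_nonneg (hgnn _) (ih _ (by omega))
  refine ⟨d, hd0, ?_⟩
  have hpure : IsPure fun n => PowerSeries.coeff n (1 - g)⁻¹ :=
    ⟨hnnv, Or.inr ⟨0, x⁻¹, c, inv_pos.2 hx, hc, by simpa [scale] using ht⟩⟩
  have := IsTameMod.X_pow_mul_expand hd0 0 hpure
  rwa [pow_zero, one_mul, ← huv] at this

/-! ### Linear systems over tame series -/

/-- Gaussian elimination: the components of a solution of a linear system with tame coefficients
are tame. -/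
theorem isTame_of_linear_system : ∀ {n : ℕ} (M : Fin n → Fin n → PowerSeries ℝ)
    (b x : Fin n → PowerSeries ℝ), (∀ i j, IsTame (M i j)) →
    (∀ i j, PowerSeries.coeff 0 (M i j) = 0) → (∀ i, IsTame (b i)) →
    (∀ i, x i = ∑ j, M i j * x j + b i) → ∀ i, IsTame (x i)
  | 0, _, _, _, _, _, _, _ => fun i => i.elim0
  | n + 1, M, b, x, hM, hM0, hb, hx => by
    have hcc : PowerSeries.constantCoeff (1 - M 0 0) ≠ 0 := by
      rw [map_sub, map_one, ← PowerSeries.coeff_zero_eq_constantCoeff_apply, hM0]; norm_num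
    set u := (1 - M 0 0)⁻¹ with hu
    have hu1 : u * (1 - M 0 0) = 1 := PowerSeries.inv_mul_cancel _ hcc
    have hut : IsTame u := (hM 0 0).inv_one_sub (hM0 0 0) hu1
    have hx0 : x 0 = u * (∑ j : Fin n, M 0 j.succ * x j.succ + b 0) := by
      have h1 := hx 0
      rw [Fin.sum_univ_succ] at h1
      linear_combination (-(x 0)) * hu1 + u * h1
    have hsucc : ∀ i : Fin n, IsTame (x i.succ) := by
      refine isTame_of_linear_system
        (fun i j => M i.succ j.succ + M i.succ 0 * u * M 0 j.succ)
        (fun i => b i.succ + M i.succ 0 * u * b 0) (fun i => x i.succ)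
        (fun i j => (hM _ _).add (((hM _ _).mul hut).mul (hM _ _))) (fun i j => ?_)
        (fun i => (hb _).add (((hM _ _).mul hut).mul (hb _))) (fun i => ?_)
      · simp only [PowerSeries.coeff_zero_eq_constantCoeff_apply, map_add, map_mul] at hM0 ⊢
        rw [hM0, hM0, hM0]; simp
      · rw [hx i.succ, Fin.sum_univ_succ, hx0, Finset.sum_congr rfl fun j _ => add_mul _ _ _,
          Finset.sum_add_distrib, mul_add, mul_add]
        have : ∑ j : Fin n, M i.succ 0 * u * M 0 j.succ * x j.succ =
            M i.succ 0 * u * ∑ j : Fin n, M 0 j.succ * x j.succ := by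
          rw [Finset.mul_sum]; exact Finset.sum_congr rfl fun j _ => by ring
        rw [this]; ring
    intro i
    refine Fin.cases ?_ hsucc i
    rw [hx0]
    exact hut.mul ((IsTame.finsetSum _ fun j _ => (hM _ _).mul (hsucc j)).add (hb 0))

/-! ### Counting the words of a language -/

open Classical in
theorem posCount_eq_sum (L : Language (Fin 2)) (N : ℕ) :
    posCount L N = ∑ x : Fin N → Fin 2, if List.ofFn x ∈ L then 1 else 0 := by
  rw [posCount, Set.ncard_eq_toFinset_card', ← Finset.card_filter]
  congr 1
  ext x
  rw [Set.mem_toFinset, Finset.mem_filter]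
  exact (and_iff_right (Finset.mem_univ x)).symm

theorem negCount_eq_posCount_compl (L : Language (Fin 2)) (N : ℕ) :
    negCount L N = posCount Lᶜ N := rfl

theorem posCount_add_negCount (L : Language (Fin 2)) (N : ℕ) :
    posCount L N + negCount L N = 2 ^ N := by
  have h : negStrings L N = (posStrings L N)ᶜ := rfl
  rw [posCount, negCount, h, Set.ncard_add_ncard_compl]
  simp

theorem posCount_le (L : Language (Fin 2)) (N : ℕ) : posCount L N ≤ 2 ^ N := by
  have := posCount_add_negCount L N; omega

open Classical in
theorem posCount_zero (L : Language (Fin 2)) : posCount L 0 = if [] ∈ L then 1 else 0 := by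
  rw [posCount_eq_sum]; simp

/-- Counting words by their first letter. -/
theorem posCount_succ {L L₀ L₁ : Language (Fin 2)} (h₀ : ∀ w, 0 :: w ∈ L ↔ w ∈ L₀)
    (h₁ : ∀ w, 1 :: w ∈ L ↔ w ∈ L₁) (N : ℕ) :
    posCount L (N + 1) = posCount L₀ N + posCount L₁ N := by
  classical
  rw [posCount_eq_sum, posCount_eq_sum, posCount_eq_sum,
    ← (Fin.consEquiv fun _ : Fin (N + 1) => Fin 2).sum_comp, Fintype.sum_prod_type,
    Fin.sum_univ_two]
  congr 1 <;> refine Finset.sum_congr rfl fun x _ => ?_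
  · simp [Fin.consEquiv, List.ofFn_succ, h₀]
  · simp [Fin.consEquiv, List.ofFn_succ, h₁]

/-- The generating function of the number of words of `L` of given length. -/
def countSeries (L : Language (Fin 2)) : PowerSeries ℝ :=
  PowerSeries.mk fun N => (posCount L N : ℝ)

open Classical in
theorem countSeries_eq {L L₀ L₁ : Language (Fin 2)} (h₀ : ∀ w, 0 :: w ∈ L ↔ w ∈ L₀)
    (h₁ : ∀ w, 1 :: w ∈ L ↔ w ∈ L₁) :
    countSeries L = PowerSeries.X * (countSeries L₀ + countSeries L₁) +
      ((if [] ∈ L then 1 else 0 : ℕ) : PowerSeries ℝ) := by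
  ext N
  rcases N with _ | N
  · rw [map_add, PowerSeries.coeff_zero_X_mul, countSeries, PowerSeries.coeff_mk, posCount_zero]
    split_ifs <;> simp
  · rw [map_add, PowerSeries.coeff_succ_X_mul, countSeries, PowerSeries.coeff_mk,
      posCount_succ h₀ h₁, map_add, countSeries, countSeries, PowerSeries.coeff_mk,
      PowerSeries.coeff_mk]
    split_ifs <;> simp [PowerSeries.coeff_one]

/-- A finite family of languages that is closed under left quotients by letters consists of regular
languages. -/
theorem isRegular_of_cons_mem_iff {σ : Type} [Fintype σ] {K : σ → Language (Fin 2)}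
    {δ : σ → Fin 2 → σ} (h : ∀ s a w, a :: w ∈ K s ↔ w ∈ K (δ s a)) (s : σ) :
    (K s).IsRegular := by
  refine ⟨σ, inferInstance, ⟨δ, s, {t | [] ∈ K t}⟩, ?_⟩
  ext w
  rw [DFA.mem_accepts, DFA.eval]
  induction w generalizing s with
  | nil => exact Iff.rfl
  | cons a w ih => rw [h]; exact ih (δ s a)

theorem isTame_countSeries_of_cons_mem_iff {σ : Type} [Fintype σ] {K : σ → Language (Fin 2)}
    {δ : σ → Fin 2 → σ} (h : ∀ s a w, a :: w ∈ K s ↔ w ∈ K (δ s a)) (s : σ) :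
    IsTame (countSeries (K s)) := by
  classical
  let e := Fintype.equivFin σ
  have key := isTame_of_linear_system
    (fun i j => PowerSeries.X * (((if e (δ (e.symm i) 0) = j then 1 else 0 : ℕ) : PowerSeries ℝ) +
      ((if e (δ (e.symm i) 1) = j then 1 else 0 : ℕ) : PowerSeries ℝ)))
    (fun i => ((if [] ∈ K (e.symm i) then 1 else 0 : ℕ) : PowerSeries ℝ))
    (fun i => countSeries (K (e.symm i)))
    (fun i j => IsTame.X.mul ((IsTame.natCast _).add (IsTame.natCast _)))
    (fun i j => by simp)
    (fun i => IsTame.natCast _)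
    (fun i => by
      rw [countSeries_eq (h (e.symm i) 0) (h (e.symm i) 1)]
      congr 1
      have : ∀ t : σ, ∑ j, ((if e t = j then 1 else 0 : ℕ) : PowerSeries ℝ) *
          countSeries (K (e.symm j)) = countSeries (K t) := by
        intro t
        rw [Finset.sum_eq_single (e t)]
        · simp
        · intro j _ hj; simp [Ne.symm hj]
        · simp
      rw [← this (δ (e.symm i) 0), ← this (δ (e.symm i) 1), ← Finset.sum_add_distrib,
        Finset.mul_sum]
      exact Finset.sum_congr rfl fun j _ => by ring) (e s)
  simpa using key

theorem isTame_countSeries {L : Language (Fin 2)} (hL : L.IsRegular) :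
    IsTame (countSeries L) := by
  obtain ⟨σ, _, M, rfl⟩ := hL
  exact isTame_countSeries_of_cons_mem_iff (K := M.acceptsFrom) (δ := M.step)
    (fun s a w => Iff.rfl) M.start

/-! ### The expected number of label changes -/

theorem exists_perm_apply_eq {α : Type*} [DecidableEq α] {i j i' j' : α} (h : i ≠ j)
    (h' : i' ≠ j') : ∃ τ : Equiv.Perm α, τ i = i' ∧ τ j = j' := by
  refine ⟨(Equiv.swap i i').trans (Equiv.swap (Equiv.swap i i' j) j'), ?_, ?_⟩
  · rw [Equiv.trans_apply, Equiv.swap_apply_left]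
    refine Equiv.swap_apply_of_ne_of_ne (fun h2 => h ?_) h'
    apply (Equiv.swap i i').injective
    rw [Equiv.swap_apply_left, ← h2]
  · rw [Equiv.trans_apply, Equiv.swap_apply_left]

/-- By symmetry, all pairs of distinct positions have the same number of arrangements in which
their labels differ. -/
theorem sum_changes_mul_card {α : Type*} [Fintype α] [DecidableEq α] (D : α → α → ℝ)
    (hD : ∀ x, D x x = 0) (m : ℕ) :
    (∑ σ : Fin (m + 1) ≃ α, ∑ i : Fin m, D (σ i.castSucc) (σ i.succ)) * (m + 1 : ℝ) =
      Fintype.card (Fin (m + 1) ≃ α) * ∑ x, ∑ y, D x y := by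
  set S : Fin (m + 1) → Fin (m + 1) → ℝ := fun i j => ∑ σ : Fin (m + 1) ≃ α, D (σ i) (σ j) with hS
  have hsymm : ∀ i j i' j', i ≠ j → i' ≠ j' → S i' j' = S i j := by
    intro i j i' j' h h'
    obtain ⟨τ, rfl, rfl⟩ := exists_perm_apply_eq h h'
    exact (Equiv.sum_comp (Equiv.equivCongr τ.symm (Equiv.refl α))
      fun σ : Fin (m + 1) ≃ α => D (σ i) (σ j))
  have htot : ∑ i, ∑ j, S i j = Fintype.card (Fin (m + 1) ≃ α) * ∑ x, ∑ y, D x y := by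
    have h1 : ∑ i, ∑ j, S i j = ∑ σ : Fin (m + 1) ≃ α, ∑ i, ∑ j, D (σ i) (σ j) := by
      rw [Finset.sum_comm]
      simp_rw [hS]
      rw [Finset.sum_congr rfl fun i _ => Finset.sum_comm, Finset.sum_comm]
      exact Finset.sum_congr rfl fun σ _ => Finset.sum_comm
    have h2 : ∀ σ : Fin (m + 1) ≃ α, ∑ i, ∑ j, D (σ i) (σ j) = ∑ x, ∑ y, D x y := fun σ => by
      rw [← σ.sum_comp fun x => ∑ y, D x y]
      exact Finset.sum_congr rfl fun i _ => σ.sum_comp fun y => D (σ i) y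
    rw [h1, Finset.sum_congr rfl fun σ _ => h2 σ, Finset.sum_const, nsmul_eq_mul,
      Finset.card_univ]
  rw [← htot, Finset.sum_comm]
  change (∑ i : Fin m, S i.castSucc i.succ) * _ = _
  rcases m with _ | m
  · simp [hS, hD]
  · have h1 : ∀ i : Fin (m + 1), S i.castSucc i.succ = S 0 1 := fun i =>
      hsymm _ _ _ _ (by simp) (Fin.castSucc_lt_succ).ne
    have h2 : ∀ i, ∑ j, S i j = (m + 1 : ℝ) * S 0 1 := by
      intro i
      rw [← Finset.add_sum_erase _ _ (Finset.mem_univ i), Finset.sum_congr rfl fun j hj =>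
        hsymm 0 1 i j (by simp) (Finset.ne_of_mem_erase hj).symm]
      simp [hS, hD]
    rw [Finset.sum_congr rfl fun i _ => h1 i, Finset.sum_congr rfl fun i _ => h2 i]
    simp only [Finset.sum_const, Finset.card_univ, Fintype.card_fin, nsmul_eq_mul]
    push_cast
    ring

theorem cast_ncard_setOf {α : Type*} [Fintype α] (Q : α → Prop) [DecidablePred Q] :
    ({x | Q x}.ncard : ℝ) = ∑ x, if Q x then 1 else 0 := by
  classical
  rw [Set.ncard_eq_toFinset_card', show {x | Q x}.toFinset = Finset.univ.filter Q by ext i; simp,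
    Finset.natCast_card_filter]

open Classical in
theorem ncard_changes_eq {α : Type*} (P : α → Prop) (m : ℕ) (σ : Fin (m + 1) ≃ α) :
    (({p : Fin (m + 1) × Fin (m + 1) | p.1.val + 1 = p.2.val ∧ ¬ (P (σ p.1) ↔ P (σ p.2))}.ncard :
      ℕ) : ℝ) = ∑ i : Fin m, if (P (σ i.castSucc) ↔ P (σ i.succ)) then 0 else 1 := by
  have h1 : {p : Fin (m + 1) × Fin (m + 1) | p.1.val + 1 = p.2.val ∧
      ¬ (P (σ p.1) ↔ P (σ p.2))} = (fun i : Fin m => (i.castSucc, i.succ)) ''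
        {i | ¬ (P (σ i.castSucc) ↔ P (σ i.succ))} := by
    ext ⟨a, b⟩
    constructor
    · rintro ⟨h1, h2⟩
      simp only at h1 h2
      obtain ⟨i, rfl⟩ : ∃ i : Fin m, i.castSucc = a := ⟨⟨a.val, by omega⟩, rfl⟩
      obtain rfl : i.succ = b := Fin.ext (by simpa using h1)
      exact ⟨i, h2, rfl⟩
    · rintro ⟨i, hi, h⟩
      simp only [Prod.mk.injEq] at h
      obtain ⟨rfl, rfl⟩ := h
      exact ⟨by simp, hi⟩
  rw [h1, Set.ncard_image_of_injective _ fun i j h => Fin.castSucc_injective m (congrArg Prod.fst h),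
    cast_ncard_setOf]
  exact Finset.sum_congr rfl fun i _ => by rw [ite_not]

open Classical in
theorem sum_sum_differ {α : Type*} [Fintype α] (P : α → Prop) :
    ∑ x, ∑ y, (if (P x ↔ P y) then 0 else 1 : ℝ) =
      2 * ({x | P x}.ncard : ℝ) * ({x | ¬ P x}.ncard : ℝ) := by
  have h : ∀ x y, (if (P x ↔ P y) then 0 else 1 : ℝ) =
      (if P x then 1 else 0) * (if ¬ P y then 1 else 0) +
      (if ¬ P x then 1 else 0) * (if P y then 1 else 0) := fun x y => by
    by_cases hx : P x <;> by_cases hy : P y <;> simp [hx, hy]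
  simp_rw [h, Finset.sum_add_distrib, ← Finset.mul_sum, ← Finset.sum_mul]
  rw [cast_ncard_setOf, cast_ncard_setOf]
  ring

/-- `E[F] = 2 m_p m_n / 2 ^ N`. -/
theorem expectedLabelChanges_eq (L : Language (Fin 2)) (N : ℕ) :
    expectedLabelChanges L N = 2 * (posCount L N : ℝ) * (negCount L N : ℝ) / 2 ^ N := by
  classical
  have key : ∀ M : ℕ, 0 < M → ∀ [Nonempty (Fin M ≃ (Fin N → Fin 2))],
      (∑ σ : Fin M ≃ (Fin N → Fin 2), (({p : Fin M × Fin M | p.1.val + 1 = p.2.val ∧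
        ¬ (σ p.1 ∈ posStrings L N ↔ σ p.2 ∈ posStrings L N)}.ncard : ℕ) : ℝ)) /
        (Fintype.card (Fin M ≃ (Fin N → Fin 2)) : ℝ) =
      2 * (posCount L N : ℝ) * (negCount L N : ℝ) / M := by
    intro M hM _
    obtain ⟨m, rfl⟩ := Nat.exists_eq_succ_of_ne_zero hM.ne'
    have h1 := sum_changes_mul_card (α := Fin N → Fin 2)
      (fun x y => if (x ∈ posStrings L N ↔ y ∈ posStrings L N) then 0 else 1) (by simp) m
    rw [sum_sum_differ] at h1
    have hc : (Fintype.card (Fin (m + 1) ≃ (Fin N → Fin 2)) : ℝ) ≠ 0 := by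
      exact_mod_cast Fintype.card_ne_zero
    rw [Finset.sum_congr rfl fun σ _ => ncard_changes_eq (fun x => x ∈ posStrings L N) m σ,
      div_eq_div_iff hc (by positivity)]
    push_cast
    rw [h1]
    rw [mul_comm]
    rfl
  have : Nonempty (Fin (2 ^ N) ≃ (Fin N → Fin 2)) :=
    ⟨(Fintype.equivFinOfCardEq (by simp)).symm⟩
  have h := key (2 ^ N) (by positivity)
  push_cast at h
  exact h

theorem minorityCount_le_expectedLabelChanges (L : Language (Fin 2)) (N : ℕ) :
    (minorityCount L N : ℝ) ≤ expectedLabelChanges L N ∧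
      expectedLabelChanges L N ≤ 2 * minorityCount L N := by
  have h : (posCount L N : ℝ) + negCount L N = 2 ^ N := by
    exact_mod_cast posCount_add_negCount L N
  have hp : (0 : ℝ) ≤ posCount L N := Nat.cast_nonneg _
  have hn : (0 : ℝ) ≤ negCount L N := Nat.cast_nonneg _
  have h2 : (0 : ℝ) < 2 ^ N := by positivity
  rw [expectedLabelChanges_eq, minorityCount, Nat.cast_min, le_div_iff₀ h2, div_le_iff₀ h2, ← h]
  rcases le_total (posCount L N : ℝ) (negCount L N) with hle | hle
  · rw [min_eq_left hle]; constructor <;> nlinarith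
  · rw [min_eq_right hle]; constructor <;> nlinarith

/-! ### Exponential growth rates -/

/-- `limsup (1 / N) * log₂ a(N)`, with the convention `log₂ 0 = -∞`. -/
def growthRate (a : ℕ → ℝ) : EReal :=
  limsup (fun N : ℕ => ENNReal.log (ENNReal.ofReal (a N)) / (((N : ℝ) * Real.log 2 : ℝ) : EReal))
    atTop

theorem entropy_eq_growthRate (L : Language (Fin 2)) :
    entropy L = growthRate (expectedLabelChanges L) := rfl

/-- Polynomial factors do not affect the growth rate. -/
theorem tendsto_log_div {C b : ℝ} (hC : 0 < C) (hb : 0 < b) (k : ℕ) :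
    Tendsto (fun N : ℕ => ENNReal.log (ENNReal.ofReal (C * ((N : ℝ) + 1) ^ k * b ^ N)) /
      (((N : ℝ) * Real.log 2 : ℝ) : EReal)) atTop (𝓝 ((Real.logb 2 b : ℝ) : EReal)) := by
  have h2 : 0 < Real.log 2 := Real.log_pos one_lt_two
  have hlog : Tendsto (fun N : ℕ => Real.log ((N : ℝ) + 1) / (N : ℝ)) atTop (𝓝 0) := by
    have h := (Real.tendsto_pow_log_div_mul_add_atTop 1 (-1) 1 one_ne_zero).comp
      (tendsto_atTop_add_const_right atTop (1 : ℝ) tendsto_natCast_atTop_atTop)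
    refine h.congr fun N => ?_
    simp
  have hreal : Tendsto (fun N : ℕ => Real.log (C * ((N : ℝ) + 1) ^ k * b ^ N) /
      ((N : ℝ) * Real.log 2)) atTop (𝓝 (Real.logb 2 b)) := by
    have h3 := (((tendsto_const_div_atTop_nhds_zero_nat (Real.log C)).add
      (hlog.const_mul (k : ℝ))).add_const (Real.log b)).div_const (Real.log 2)
    rw [mul_zero, add_zero, zero_add] at h3
    refine h3.congr' ?_
    filter_upwards [eventually_gt_atTop 0] with N hN
    have hN' : (N : ℝ) ≠ 0 := by exact_mod_cast hN.ne'
    rw [Real.log_mul (by positivity) (by positivity), Real.log_mul hC.ne' (by positivity),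
      Real.log_pow, Real.log_pow]
    field_simp
  refine ((continuous_coe_real_ereal.tendsto _).comp hreal).congr fun N => ?_
  rw [ENNReal.log_ofReal_of_pos (by positivity), Function.comp_apply, EReal.coe_div]

theorem log_ofReal_div_mono {x y : ℝ} (h : x ≤ y) (N : ℕ) :
    ENNReal.log (ENNReal.ofReal x) / (((N : ℝ) * Real.log 2 : ℝ) : EReal) ≤
      ENNReal.log (ENNReal.ofReal y) / (((N : ℝ) * Real.log 2 : ℝ) : EReal) := by
  have h2 : 0 ≤ (N : ℝ) * Real.log 2 := mul_nonneg (Nat.cast_nonneg N) (Real.log_nonneg one_le_two)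
  exact EReal.div_le_div_right_of_nonneg (by exact_mod_cast h2)
    (ENNReal.log_monotone (ENNReal.ofReal_le_ofReal h))

theorem growthRate_le {a : ℕ → ℝ} {C b : ℝ} (hC : 0 < C) (hb : 0 < b) (k : ℕ)
    (h : ∀ᶠ N : ℕ in atTop, a N ≤ C * ((N : ℝ) + 1) ^ k * b ^ N) :
    growthRate a ≤ ((Real.logb 2 b : ℝ) : EReal) := by
  rw [← (tendsto_log_div hC hb k).limsup_eq]
  refine limsup_le_limsup ?_
  filter_upwards [h] with N hN
  exact log_ofReal_div_mono hN N

theorem le_growthRate {a : ℕ → ℝ} {c b : ℝ} (hc : 0 < c) (hb : 0 < b)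
    (h : ∃ᶠ N : ℕ in atTop, c * b ^ N ≤ a N) :
    ((Real.logb 2 b : ℝ) : EReal) ≤ growthRate a := by
  refine le_of_forall_lt fun x hx => ?_
  obtain ⟨y, hxy, hy⟩ := exists_between hx
  refine hxy.trans_le (le_limsup_of_frequently_le ?_)
  refine (h.and_eventually ((tendsto_log_div hc hb 0).eventually_const_lt hy)).mono
    fun N hN => hN.2.le.trans ?_
  rw [pow_zero, mul_one]
  exact log_ofReal_div_mono hN.1 N

/-! ### Residue classes -/

theorem eventually_of_residues {q : ℕ} (hq : q ≠ 0) {P : ℕ → Prop}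
    (h : ∀ r < q, ∀ᶠ n in atTop, P (q * n + r)) : ∀ᶠ N in atTop, P N := by
  have h1 : ∀ᶠ n in atTop, ∀ r ∈ Finset.range q, P (q * n + r) :=
    (Finset.eventually_all _).2 fun r hr => h r (Finset.mem_range.1 hr)
  filter_upwards [(Nat.tendsto_div_const_atTop hq).eventually h1] with N hN
  have := hN (N % q) (Finset.mem_range.2 (Nat.mod_lt N (Nat.pos_of_ne_zero hq)))
  rwa [Nat.div_add_mod] at this

theorem frequently_of_residue {q r : ℕ} (hq : q ≠ 0) {P : ℕ → Prop}
    (h : ∀ᶠ n in atTop, P (q * n + r)) : ∃ᶠ N in atTop, P N :=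
  (tendsto_affine q r hq).frequently h.frequently

theorem tendsto_of_residues {q : ℕ} (hq : q ≠ 0) {f : ℕ → ℝ} {l : Filter ℝ}
    (h : ∀ r < q, Tendsto (fun n => f (q * n + r)) atTop l) : Tendsto f atTop l :=
  fun _ hs => eventually_of_residues hq fun r hr => h r hr hs

theorem tendsto_pow_mul_pow_div {k l : ℕ} {b d : ℝ} (hb : 0 < b)
    (h : b < d ∨ b = d ∧ k < l) :
    Tendsto (fun N : ℕ => ((N : ℝ) ^ k * b ^ N) / ((N : ℝ) ^ l * d ^ N)) atTop (𝓝 0) := by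
  rcases h with h | ⟨rfl, h⟩
  · have hd : 0 < d := hb.trans h
    refine squeeze_zero' (Eventually.of_forall fun N => by positivity) ?_
      (tendsto_pow_const_mul_const_pow_of_lt_one k (div_pos hb hd).le ((div_lt_one hd).2 h))
    filter_upwards [eventually_ge_atTop 1] with N hN
    have h1 : (1 : ℝ) ≤ (N : ℝ) ^ l := one_le_pow₀ (by exact_mod_cast hN)
    rw [div_pow, ← mul_div_assoc]
    exact div_le_div_of_nonneg_left (by positivity) (by positivity)
      (le_mul_of_one_le_left (by positivity) h1)
  · refine squeeze_zero' (Eventually.of_forall fun N => by positivity) ?_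
      tendsto_one_div_atTop_nhds_zero_nat
    filter_upwards [eventually_ge_atTop 1] with N hN
    have h0 : (0 : ℝ) < N := by exact_mod_cast hN
    have h1 : (1 : ℝ) ≤ N := by exact_mod_cast hN
    rw [div_le_div_iff₀ (by positivity) h0, one_mul]
    calc (N : ℝ) ^ k * b ^ N * N = (N : ℝ) ^ (k + 1) * b ^ N := by ring
      _ ≤ (N : ℝ) ^ l * b ^ N :=
        mul_le_mul_of_nonneg_right (pow_le_pow_right₀ h1 h) (by positivity)

/-! ### Counting functions with tame generating function -/

/-- The generating function of `m` is tame. -/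
def TameCount (m : ℕ → ℕ) : Prop := IsTame (PowerSeries.mk fun N => (m N : ℝ))

theorem TameCount.min {m m' : ℕ → ℕ} (h : TameCount m) (h' : TameCount m') :
    TameCount fun N => min (m N) (m' N) := by
  obtain ⟨q, hq, h1, h2⟩ := IsTame.exists_common h h'
  refine ⟨q, hq, fun r => ?_⟩
  have := (h1 r).min (h2 r)
  simpa only [PowerSeries.coeff_mk, Nat.cast_min] using this

/-- The asymptotic behaviour of an integer sequence with tame generating function along a residue
class; `c = 0` means that the sequence vanishes eventually. -/
theorem TameCount.exists_tendsto {m : ℕ → ℕ} (h : TameCount m) : ∃ q, q ≠ 0 ∧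
    ∀ r, ∃ (k : ℕ) (b c : ℝ), 1 ≤ b ∧ 0 ≤ c ∧ (c = 0 → ∀ᶠ n in atTop, m (q * n + r) = 0) ∧
      Tendsto (fun n => (m (q * n + r) : ℝ) / (((q * n + r : ℕ) : ℝ) ^ k * b ^ (q * n + r)))
        atTop (𝓝 c) := by
  obtain ⟨q, hq, h⟩ := h
  refine ⟨q, hq, fun r => ?_⟩
  have hr := (h r).2
  simp only [PowerSeries.coeff_mk] at hr
  by_cases hz : ∀ᶠ n in atTop, m (q * n + r) = 0
  · refine ⟨0, 1, 0, le_rfl, le_rfl, fun _ => hz, tendsto_const_nhds.congr' ?_⟩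
    filter_upwards [hz] with n hn
    simp [hn]
  rcases hr with hr | ⟨k, lam, c, hl, hc, ht⟩
  · exact absurd (hr.mono fun n hn => by exact_mod_cast hn) hz
  obtain ⟨b, hb, rfl⟩ : ∃ b : ℝ, 0 < b ∧ b ^ q = lam :=
    ⟨lam ^ ((q : ℝ)⁻¹), Real.rpow_pos_of_pos hl _, Real.rpow_inv_natCast_pow hl.le hq⟩
  have hq' : (0 : ℝ) < q := by exact_mod_cast Nat.pos_of_ne_zero hq
  have h2 := (tendsto_scale_affine k hb hq r).inv₀ (by positivity)
  have h3 := (tendsto_choose_div_pow k).comp (tendsto_affine q r hq)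
  have h4 := (ht.mul h2).mul h3
  have hc' : 0 < c * ((q : ℝ) ^ k * b ^ r)⁻¹ * (1 / (k.factorial : ℝ)) := by positivity
  have h5 : Tendsto (fun n => (m (q * n + r) : ℝ) /
      (((q * n + r : ℕ) : ℝ) ^ k * b ^ (q * n + r))) atTop
      (𝓝 (c * ((q : ℝ) ^ k * b ^ r)⁻¹ * (1 / (k.factorial : ℝ)))) := by
    refine h4.congr fun n => ?_
    have h6 := (scale_pos k (pow_pos hb q) n).ne'
    have h7 : ((k + (q * n + r)).choose k : ℝ) ≠ 0 := by
      exact_mod_cast (Nat.choose_pos (Nat.le_add_right k _)).ne'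
    have h8 := (pow_pos hb (q * n + r)).ne'
    simp only [Function.comp_apply]
    rw [inv_div, div_mul_div_cancel₀ h6, scale, div_mul_div_comm,
      mul_comm (m _ : ℝ), mul_assoc, mul_div_mul_left _ _ h7, mul_comm (b ^ _)]
  refine ⟨k, b, _, ?_, hc'.le, fun h => absurd h hc'.ne', h5⟩
  -- For `b < 1` the integers `m (q * n + r)` would tend to zero.
  by_contra! hb1
  have h6 := (tendsto_pow_const_mul_const_pow_of_lt_one k hb.le hb1).comp (tendsto_affine q r hq)
  have h7 := h5.mul h6
  rw [mul_zero] at h7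
  refine hz ?_
  filter_upwards [h7.eventually_lt_const one_pos, eventually_gt_atTop 0] with n hn hn0
  have h8 : (0 : ℝ) < ((q * n + r : ℕ) : ℝ) := by
    have := Nat.mul_pos (Nat.pos_of_ne_zero hq) hn0
    exact_mod_cast (by omega : 0 < q * n + r)
  simp only [Function.comp_apply] at hn
  rw [div_mul_cancel₀ _ (by positivity)] at hn
  exact Nat.lt_one_iff.1 (by exact_mod_cast hn)

/-- The base and the exponent of `m` are the lexicographically largest ones that occur along a
residue class. -/
theorem TameCount.exponentialGrowth {m : ℕ → ℕ} (h : TameCount m)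
    (hpos : ∃ᶠ N in atTop, 0 < m N) :
    ∃ b : ℝ, 1 ≤ b ∧ ExponentialGrowth m b ∧ (b = 1 → PolynomialGrowth m) := by
  obtain ⟨q, hq, h⟩ := h.exists_tendsto
  choose k b c hb hc hc0 ht using h
  set A := (Finset.range q).filter fun r => 0 < c r with hA
  have hAne : A.Nonempty := by
    by_contra hne
    rw [Finset.not_nonempty_iff_eq_empty, hA, Finset.filter_eq_empty_iff] at hne
    refine hpos ((eventually_of_residues (P := fun N => m N = 0) hq fun r hr =>
      hc0 r ?_).mono fun N hN => by simp [hN])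
    exact le_antisymm (not_lt.1 (hne (Finset.mem_range.2 hr))) (hc r)
  obtain ⟨s, hs, hmax⟩ := Finset.exists_max_image A (fun r => toLex (b r, k r)) hAne
  rw [hA, Finset.mem_filter, Finset.mem_range] at hs
  have hlex : ∀ r < q, 0 < c r → b r < b s ∨ b r = b s ∧ k r ≤ k s := by
    intro r hr hcr
    have := hmax r (by rw [hA, Finset.mem_filter, Finset.mem_range]; exact ⟨hr, hcr⟩)
    rwa [Prod.Lex.toLex_le_toLex] at this
  refine ⟨b s, hb s, ⟨q, Nat.pos_of_ne_zero hq, k s,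
    fun r => if b r = b s ∧ k r = k s then c r else 0, fun r => ?_, ⟨s, hs.1, ?_⟩, ?_⟩, ?_⟩
  · dsimp only
    split_ifs
    · exact hc r
    · exact le_rfl
  · simpa using hs.2
  · refine tendsto_of_residues hq fun r hr => ?_
    have hmod : ∀ n, (q * n + r) % q = r := fun n => by
      rw [Nat.mul_add_mod, Nat.mod_eq_of_lt hr]
    simp only [hmod]
    rw [tendsto_sub_nhds_zero_iff]
    split_ifs with heq
    · rw [← heq.1, ← heq.2]; exact ht r
    · rcases (hc r).eq_or_lt with h0 | h0
      · refine tendsto_const_nhds.congr' ?_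
        filter_upwards [hc0 r h0.symm] with n hn
        simp [hn]
      · have hlt : b r < b s ∨ b r = b s ∧ k r < k s := by
          rcases hlex r hr h0 with h1 | ⟨h1, h2⟩
          · exact Or.inl h1
          · exact Or.inr ⟨h1, lt_of_le_of_ne h2 fun h3 => heq ⟨h1, h3⟩⟩
        have hbr : 0 < b r := one_pos.trans_le (hb r)
        have h1 := (ht r).mul ((tendsto_pow_mul_pow_div hbr hlt).comp (tendsto_affine q r hq))
        rw [mul_zero] at h1
        refine h1.congr' ?_
        filter_upwards [eventually_gt_atTop 0] with n hn0
        have h8 : (0 : ℝ) < ((q * n + r : ℕ) : ℝ) := by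
          have := Nat.mul_pos (Nat.pos_of_ne_zero hq) hn0
          exact_mod_cast (by omega : 0 < q * n + r)
        simp only [Function.comp_apply]
        rw [div_mul_div_cancel₀ (by positivity)]
  · intro hbs
    have hb1 : ∀ r < q, 0 < c r → b r = 1 := by
      intro r hr hcr
      have h1 : b r ≤ b s := by
        rcases hlex r hr hcr with h1 | h1
        · exact h1.le
        · exact h1.1.le
      exact le_antisymm (h1.trans hbs.le) (hb r)
    refine ⟨q, Nat.pos_of_ne_zero hq, fun r => Polynomial.C (c r) * Polynomial.X ^ k r, ?_⟩
    rw [Asymptotics.IsEquivalent, Asymptotics.isLittleO_iff]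
    intro ε hε
    refine eventually_of_residues hq fun r hr => ?_
    have hmod : ∀ n, (q * n + r) % q = r := fun n => by
      rw [Nat.mul_add_mod, Nat.mod_eq_of_lt hr]
    simp only [Pi.sub_apply, hmod, Polynomial.eval_mul, Polynomial.eval_C, Polynomial.eval_pow,
      Polynomial.eval_X, Real.norm_eq_abs]
    rcases (hc r).eq_or_lt with h0 | h0
    · filter_upwards [hc0 r h0.symm] with n hn
      simp [hn, ← h0]
    · have h1 := ht r
      simp only [hb1 r hr h0, one_pow, mul_one] at h1
      have h2 := (Metric.tendsto_nhds.1 h1) (ε * c r) (by positivity)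
      filter_upwards [h2, eventually_gt_atTop 0] with n hn hn0
      have h8 : (0 : ℝ) < ((q * n + r : ℕ) : ℝ) := by
        have := Nat.mul_pos (Nat.pos_of_ne_zero hq) hn0
        exact_mod_cast (by omega : 0 < q * n + r)
      have h9 : (0 : ℝ) < ((q * n + r : ℕ) : ℝ) ^ k r := by positivity
      rw [Real.dist_eq] at hn
      rw [abs_of_nonneg (a := c r * _) (by positivity)]
      have h10 : (m (q * n + r) : ℝ) - c r * ((q * n + r : ℕ) : ℝ) ^ k r =
          ((m (q * n + r) : ℝ) / ((q * n + r : ℕ) : ℝ) ^ k r - c r) *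
            ((q * n + r : ℕ) : ℝ) ^ k r := by
        rw [sub_mul, div_mul_cancel₀ _ h9.ne']
      rw [h10, abs_mul, abs_of_pos h9, ← mul_assoc]
      exact mul_le_mul_of_nonneg_right hn.le h9.le

/-! ### Growth classes determine the growth rate -/

theorem frequently_le_of_exponential {m : ℕ → ℕ} {b : ℝ} {q k r : ℕ} (hq : 0 < q) {β : ℕ → ℝ}
    (hr : r < q) (hβ : 0 < β r) (hb : 0 < b)
    (ht : Tendsto (fun N : ℕ => (m N : ℝ) / ((N : ℝ) ^ k * b ^ N) - β (N % q)) atTop (𝓝 0)) :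
    ∃ᶠ N : ℕ in atTop, β r / 2 * ((N : ℝ) ^ k * b ^ N) ≤ m N := by
  refine frequently_of_residue hq.ne' (r := r) ?_
  have h1 := ht.comp (tendsto_affine q r hq.ne')
  have h2 := h1.eventually_const_lt (show -(β r / 2) < 0 by linarith)
  filter_upwards [h2, eventually_gt_atTop 0] with n hn hn0
  have h8 : (0 : ℝ) < ((q * n + r : ℕ) : ℝ) := by
    have := Nat.mul_pos hq hn0
    exact_mod_cast (by omega : 0 < q * n + r)
  simp only [Function.comp_apply] at hn
  rw [Nat.mul_add_mod, Nat.mod_eq_of_lt hr] at hn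
  rw [← le_div_iff₀ (by positivity)]
  linarith

theorem growthRate_of_exponentialGrowth {m : ℕ → ℕ} {b : ℝ} (hb : 0 < b)
    (h : ExponentialGrowth m b) {a : ℕ → ℝ} {c₁ c₂ : ℝ} (hc₁ : 0 < c₁) (hc₂ : 0 < c₂)
    (ha₁ : ∀ᶠ N in atTop, c₁ * m N ≤ a N) (ha₂ : ∀ᶠ N in atTop, a N ≤ c₂ * m N) :
    growthRate a = ((Real.logb 2 b : ℝ) : EReal) := by
  obtain ⟨q, hq, k, β, hβ0, ⟨r, hr, hβ⟩, ht⟩ := h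
  refine le_antisymm ?_ ?_
  · set B := 1 + ∑ i ∈ Finset.range q, β i with hB
    have hB0 : 0 < B := by
      have := Finset.sum_nonneg fun i (_ : i ∈ Finset.range q) => hβ0 i
      linarith
    refine growthRate_le (C := c₂ * B) (by positivity) hb k ?_
    filter_upwards [ha₂, ht.eventually_lt_const one_pos, eventually_gt_atTop 0] with N h1 h2 h3
    have h8 : (0 : ℝ) < N := by exact_mod_cast h3
    have h4 : β (N % q) ≤ ∑ i ∈ Finset.range q, β i :=
      Finset.single_le_sum (fun i _ => hβ0 i) (Finset.mem_range.2 (Nat.mod_lt N hq))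
    have h5 : (m N : ℝ) / ((N : ℝ) ^ k * b ^ N) ≤ B := by linarith
    rw [div_le_iff₀ (by positivity)] at h5
    refine h1.trans ?_
    rw [mul_assoc, mul_assoc]
    refine mul_le_mul_of_nonneg_left (h5.trans ?_) hc₂.le
    refine mul_le_mul_of_nonneg_left (mul_le_mul_of_nonneg_right ?_ (by positivity)) hB0.le
    exact pow_le_pow_left₀ h8.le (by linarith) k
  · refine le_growthRate (c := c₁ * (β r / 2)) (by positivity) hb ?_
    refine ((frequently_le_of_exponential hq hr hβ hb ht).and_eventually
      (ha₁.and (eventually_ge_atTop 1))).mono fun N hN => ?_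
    obtain ⟨h1, h2, h3⟩ := hN
    refine le_trans ?_ h2
    rw [mul_assoc]
    refine mul_le_mul_of_nonneg_left (le_trans ?_ h1) hc₁.le
    refine mul_le_mul_of_nonneg_left (le_mul_of_one_le_left (by positivity) ?_) (by positivity)
    exact one_le_pow₀ (by exact_mod_cast h3)

theorem abs_eval_natCast_le (P : Polynomial ℝ) (N : ℕ) :
    |P.eval (N : ℝ)| ≤ (∑ i ∈ Finset.range (P.natDegree + 1), |P.coeff i|) *
      ((N : ℝ) + 1) ^ P.natDegree := by
  rw [Polynomial.eval_eq_sum_range, Finset.sum_mul]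
  refine (Finset.abs_sum_le_sum_abs _ _).trans (Finset.sum_le_sum fun i hi => ?_)
  rw [Finset.mem_range] at hi
  have h0 : (0 : ℝ) ≤ N := Nat.cast_nonneg N
  rw [abs_mul, abs_of_nonneg (pow_nonneg h0 i)]
  refine mul_le_mul_of_nonneg_left ?_ (abs_nonneg _)
  exact (pow_le_pow_left₀ h0 (by linarith) i).trans
    (pow_le_pow_right₀ (by linarith) (by omega))

theorem growthRate_of_polynomialGrowth {m : ℕ → ℕ} (h : PolynomialGrowth m)
    (hpos : ∃ᶠ N in atTop, 0 < m N) {a : ℕ → ℝ} {c₁ c₂ : ℝ} (hc₁ : 0 < c₁) (hc₂ : 0 < c₂)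
    (ha₁ : ∀ᶠ N in atTop, c₁ * m N ≤ a N) (ha₂ : ∀ᶠ N in atTop, a N ≤ c₂ * m N) :
    growthRate a = 0 := by
  have h0 : ((Real.logb 2 1 : ℝ) : EReal) = 0 := by simp
  rw [← h0]
  refine le_antisymm ?_ ?_
  · obtain ⟨q, hq, P, hP⟩ := h
    obtain ⟨K, hK, hKb⟩ := hP.isBigO.exists_pos
    set B : ℕ → ℝ := fun r => ∑ i ∈ Finset.range ((P r).natDegree + 1), |(P r).coeff i| with hB
    have hB0 : ∀ r, 0 ≤ B r := fun r => Finset.sum_nonneg fun i _ => abs_nonneg _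
    set C := 1 + ∑ r ∈ Finset.range q, B r with hC
    have hC0 : 0 < C := by
      have := Finset.sum_nonneg fun r (_ : r ∈ Finset.range q) => hB0 r
      linarith
    refine growthRate_le (C := c₂ * K * C) (by positivity) one_pos
      (∑ r ∈ Finset.range q, (P r).natDegree) ?_
    filter_upwards [ha₂, hKb.bound] with N h1 h2
    rw [one_pow, mul_one]
    have hmem : N % q ∈ Finset.range q := Finset.mem_range.2 (Nat.mod_lt N hq)
    have h3 : B (N % q) ≤ C := by
      have := Finset.single_le_sum (fun r _ => hB0 r) hmem
      linarith
    have h4 : (P (N % q)).natDegree ≤ ∑ r ∈ Finset.range q, (P r).natDegree :=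
      Finset.single_le_sum (f := fun r => (P r).natDegree) (fun r _ => Nat.zero_le _) hmem
    have hN : (1 : ℝ) ≤ (N : ℝ) + 1 := by
      have : (0 : ℝ) ≤ N := Nat.cast_nonneg N
      linarith
    rw [Real.norm_eq_abs, Real.norm_eq_abs, Nat.abs_cast] at h2
    refine h1.trans ?_
    rw [mul_assoc, mul_assoc]
    refine mul_le_mul_of_nonneg_left (h2.trans (mul_le_mul_of_nonneg_left ?_ hK.le)) hc₂.le
    exact (abs_eval_natCast_le _ N).trans (mul_le_mul h3 (pow_le_pow_right₀ hN h4)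
      (by positivity) hC0.le)
  · refine le_growthRate (c := c₁) hc₁ one_pos ((hpos.and_eventually ha₁).mono fun N hN => ?_)
    refine le_trans ?_ hN.2
    rw [one_pow]
    exact mul_le_mul_of_nonneg_left (by exact_mod_cast hN.1) hc₁.le

/-- For `b = 2` the trivial bound `m N ≤ 2 ^ N` excludes a polynomial factor. -/
theorem proportionalGrowth_iff {m : ℕ → ℕ} {c : ℝ} (hc : c < 1)
    (hm : ∀ᶠ N in atTop, (m N : ℝ) ≤ c * 2 ^ N) :
    ProportionalGrowth m ↔ ExponentialGrowth m 2 := by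
  constructor
  · rintro ⟨q, hq, α, hα, hpos, ht⟩
    exact ⟨q, hq, 0, α, fun r => (hα r).1, hpos, by simpa using ht⟩
  · rintro ⟨q, hq, k, β, hβ0, ⟨r, hr, hβ⟩, ht⟩
    obtain rfl : k = 0 := by
      by_contra hk
      have h1 := frequently_le_of_exponential hq hr hβ two_pos ht
      obtain ⟨M, hM⟩ := exists_nat_gt (2 / β r)
      obtain ⟨N, h2, h3, h4, h5⟩ := (h1.and_eventually
        (hm.and ((eventually_ge_atTop M).and (eventually_ge_atTop 1)))).exists
      have h6 : (1 : ℝ) ≤ N := by exact_mod_cast h5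
      have h7 : (N : ℝ) ≤ (N : ℝ) ^ k := le_self_pow₀ h6 hk
      have h8 : (0 : ℝ) < 2 ^ N := by positivity
      have h9 : β r / 2 * (N : ℝ) ^ k * 2 ^ N ≤ 1 * 2 ^ N := by
        rw [mul_assoc]
        exact h2.trans (h3.trans (mul_le_mul_of_nonneg_right hc.le h8.le))
      have h10 := le_of_mul_le_mul_right h9 h8
      have h11 : (M : ℝ) ≤ N := by exact_mod_cast h4
      rw [div_lt_iff₀ hβ] at hM
      nlinarith
    have hle : ∀ s < q, β s ≤ c := by
      intro s hs
      have h1 := ht.comp (tendsto_affine q s hq.ne')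
      have h2 : Tendsto (fun n : ℕ => (m (q * n + s) : ℝ) / 2 ^ (q * n + s)) atTop (𝓝 (β s)) := by
        have h3 := h1.add_const (β s)
        rw [zero_add] at h3
        refine h3.congr fun n => ?_
        simp [Nat.mod_eq_of_lt hs]
      refine le_of_tendsto h2 ?_
      filter_upwards [(tendsto_affine q s hq.ne').eventually hm] with n hn
      rwa [div_le_iff₀ (by positivity)]
    refine ⟨q, hq, fun s => β (s % q), fun s => ⟨hβ0 _, (hle _ (Nat.mod_lt s hq)).trans_lt hc⟩,
      ⟨r, hr, by simpa [Nat.mod_eq_of_lt hr] using hβ⟩, ?_⟩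
    simpa using ht

/-- The classification of the entropy by a counting function `m` which is, up to constant
factors, the expected number of label changes. -/
theorem entropyClassifiedBy_of_tameCount {L : Language (Fin 2)} {m : ℕ → ℕ} (h : TameCount m)
    (hpos : ∃ᶠ N in atTop, 0 < m N) {c : ℝ} (hc : c < 1)
    (hm : ∀ᶠ N in atTop, (m N : ℝ) ≤ c * 2 ^ N) {c₁ c₂ : ℝ} (hc₁ : 0 < c₁) (hc₂ : 0 < c₂)
    (ha₁ : ∀ᶠ N in atTop, c₁ * m N ≤ expectedLabelChanges L N)
    (ha₂ : ∀ᶠ N in atTop, expectedLabelChanges L N ≤ c₂ * m N) :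
    (entropy L = 0 ∨ (∃ b : ℝ, 1 < b ∧ b < 2 ∧ entropy L = ((Real.logb 2 b : ℝ) : EReal)) ∨
      entropy L = 1) ∧ EntropyClassifiedBy L m := by
  rw [EntropyClassifiedBy, proportionalGrowth_iff hc hm, entropy_eq_growthRate]
  have hexp : ∀ b, 0 < b → ExponentialGrowth m b →
      growthRate (expectedLabelChanges L) = ((Real.logb 2 b : ℝ) : EReal) := fun b hb h =>
    growthRate_of_exponentialGrowth hb h hc₁ hc₂ ha₁ ha₂
  obtain ⟨b, hb1, hb, hb_poly⟩ := h.exponentialGrowth hpos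
  have hb0 : 0 < b := one_pos.trans_le hb1
  have hrate := hexp b hb0 hb
  have hb2 : b ≤ 2 := by
    have h1 := growthRate_of_exponentialGrowth hb0 hb (a := fun N => (m N : ℝ)) one_pos one_pos
      (by simp) (by simp)
    have h2 : growthRate (fun N => (m N : ℝ)) ≤ ((Real.logb 2 2 : ℝ) : EReal) := by
      refine growthRate_le (C := 1) one_pos two_pos 0 ?_
      filter_upwards [hm] with N hN
      rw [pow_zero, mul_one]
      exact hN.trans (mul_le_mul_of_nonneg_right hc.le (by positivity))
    rw [h1, EReal.coe_le_coe_iff] at h2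
    exact (Real.logb_le_logb one_lt_two hb0 two_pos).1 h2
  have hinj : ∀ d, 0 < d → (growthRate (expectedLabelChanges L) = ((Real.logb 2 d : ℝ) : EReal) ↔
      b = d) := by
    intro d hd
    rw [hrate, EReal.coe_eq_coe_iff]
    exact ⟨fun h => Real.logb_injOn_pos one_lt_two (mem_Ioi.2 hb0) (mem_Ioi.2 hd) h,
      fun h => by rw [h]⟩
  have hiff : ∀ d, 0 < d → (growthRate (expectedLabelChanges L) = ((Real.logb 2 d : ℝ) : EReal) ↔
      ExponentialGrowth m d) := fun d hd =>
    ⟨fun h => (hinj d hd).1 h ▸ hb, hexp d hd⟩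
  have h0 : ((Real.logb 2 1 : ℝ) : EReal) = 0 := by simp
  have h1 : ((Real.logb 2 2 : ℝ) : EReal) = 1 := by
    rw [Real.logb_self_eq_one one_lt_two, EReal.coe_one]
  refine ⟨?_, ⟨fun h => ?_, fun h => ?_⟩, fun d hd1 _ => hiff d (one_pos.trans hd1), ?_⟩
  · rcases hb1.eq_or_lt with h | h
    · left; rw [← h0, hinj 1 one_pos, h]
    · rcases hb2.eq_or_lt with h' | h'
      · right; right; rw [← h1, hinj 2 two_pos, h']
      · exact Or.inr (Or.inl ⟨b, h, h', hrate⟩)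
  · rw [← h0, hinj 1 one_pos] at h
    exact hb_poly h
  · exact growthRate_of_polynomialGrowth h hpos hc₁ hc₂ ha₁ ha₂
  · rw [← h1]; exact hiff 2 two_pos

theorem tameCount_posCount {L : Language (Fin 2)} (hL : L.IsRegular) : TameCount (posCount L) :=
  isTame_countSeries hL

theorem posRatio_le_iff (L : Language (Fin 2)) (N : ℕ) (c : ℝ) :
    posRatio L N ≤ c ↔ (posCount L N : ℝ) ≤ c * 2 ^ N :=
  div_le_iff₀ (by positivity)

theorem cast_posCount_add_negCount (L : Language (Fin 2)) (N : ℕ) :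
    (posCount L N : ℝ) + negCount L N = 2 ^ N := by
  exact_mod_cast posCount_add_negCount L N

/-- If the negative strings form a positive proportion of all strings, then `m_p` classifies. -/
theorem classified_posCount {L : Language (Fin 2)} (hL : L.IsRegular)
    (h : ∃ᶠ N in atTop, 0 < posCount L N) {c : ℝ} (hc : c < 1)
    (hr : ∀ᶠ N in atTop, (posCount L N : ℝ) ≤ c * 2 ^ N) :
    (entropy L = 0 ∨ (∃ b : ℝ, 1 < b ∧ b < 2 ∧ entropy L = ((Real.logb 2 b : ℝ) : EReal)) ∨
      entropy L = 1) ∧ EntropyClassifiedBy L (posCount L) := by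
  refine entropyClassifiedBy_of_tameCount (tameCount_posCount hL) h hc hr (c₁ := 2 * (1 - c))
    (c₂ := 2) (by linarith) two_pos ?_ ?_
  · filter_upwards [hr] with N hN
    have h1 := cast_posCount_add_negCount L N
    have h2 : (0 : ℝ) < 2 ^ N := by positivity
    rw [expectedLabelChanges_eq, le_div_iff₀ h2]
    have h3 : (1 - c) * 2 ^ N ≤ (negCount L N : ℝ) := by linarith
    have h4 : (0 : ℝ) ≤ posCount L N := Nat.cast_nonneg _
    nlinarith
  · refine Eventually.of_forall fun N => (minorityCount_le_expectedLabelChanges L N).2.trans ?_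
    refine mul_le_mul_of_nonneg_left ?_ zero_le_two
    exact_mod_cast min_le_left _ _

theorem entropy_compl (L : Language (Fin 2)) : entropy Lᶜ = entropy L := by
  have h : expectedLabelChanges Lᶜ = expectedLabelChanges L := by
    funext N
    have h1 : negCount Lᶜ N = posCount L N := by
      rw [negCount_eq_posCount_compl, Language.compl_compl]
    rw [expectedLabelChanges_eq, expectedLabelChanges_eq, h1, ← negCount_eq_posCount_compl]
    ring
  rw [entropy_eq_growthRate, h, entropy_eq_growthRate]

/-- The general part of the classification, with the trivial bound
`min (m_p, m_n) ≤ 2 ^ N / 2` in the first case. -/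
theorem regular_classification {L : Language (Fin 2)} (hL : L.IsRegular)
    (h : ∃ᶠ N in atTop, 0 < posCount L N ∧ 0 < negCount L N) :
    (entropy L = 0 ∨
        (∃ b : ℝ, 1 < b ∧ b < 2 ∧ entropy L = ((Real.logb 2 b : ℝ) : EReal)) ∨
        entropy L = 1) ∧
      EntropyClassifiedBy L (minorityCount L) ∧
      ((∃ c : ℝ, c < 1 ∧ ∀ᶠ N in atTop, posRatio L N ≤ c) →
        EntropyClassifiedBy L (posCount L)) ∧
      ((∃ c : ℝ, 0 < c ∧ ∀ᶠ N in atTop, c ≤ posRatio L N) →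
        EntropyClassifiedBy L (negCount L)) := by
  have hle : ∀ N, (minorityCount L N : ℝ) ≤ 1 / 2 * 2 ^ N := by
    intro N
    have h1 := cast_posCount_add_negCount L N
    have h2 : (minorityCount L N : ℝ) ≤ posCount L N := by exact_mod_cast min_le_left _ _
    have h3 : (minorityCount L N : ℝ) ≤ negCount L N := by exact_mod_cast min_le_right _ _
    linarith
  have hneg : negCount L = posCount Lᶜ := funext fun N => negCount_eq_posCount_compl L N
  have htame : TameCount (minorityCount L) := by
    have h1 := (tameCount_posCount hL).min (tameCount_posCount hL.compl)
    rw [← hneg] at h1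
    exact h1
  have hpos : ∃ᶠ N in atTop, 0 < minorityCount L N := h.mono fun N hN => by
    rw [minorityCount]; exact lt_min hN.1 hN.2
  have hE := minorityCount_le_expectedLabelChanges L
  have hmin := entropyClassifiedBy_of_tameCount htame hpos (show (1 / 2 : ℝ) < 1 by norm_num)
    (Eventually.of_forall hle) one_pos two_pos
    (Eventually.of_forall fun N => by rw [one_mul]; exact (hE N).1)
    (Eventually.of_forall fun N => (hE N).2)
  refine ⟨hmin.1, hmin.2, ?_, ?_⟩
  · rintro ⟨c, hc, hr⟩
    exact (classified_posCount hL (h.mono fun N hN => hN.1) hc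
      (hr.mono fun N hN => (posRatio_le_iff L N c).1 hN)).2
  · rintro ⟨c, hc, hr⟩
    have h1 := (classified_posCount hL.compl (hneg ▸ h.mono fun N hN => hN.2) (c := 1 - c)
      (by linarith) (hr.mono fun N hN => by
        rw [posRatio, le_div_iff₀ (by positivity)] at hN
        have h1 := cast_posCount_add_negCount L N
        rw [← negCount_eq_posCount_compl]
        linarith)).2
    rw [EntropyClassifiedBy, entropy_compl, ← hneg] at h1
    exact h1

/-! ### Reading off the entropy from the growth of `m_p` -/

theorem frequently_pos_and_neg {L : Language (Fin 2)} (h : ∃ᶠ N in atTop, 0 < posCount L N)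
    {c : ℝ} (hc : c < 1) (hr : ∀ᶠ N in atTop, (posCount L N : ℝ) ≤ c * 2 ^ N) :
    ∃ᶠ N in atTop, 0 < posCount L N ∧ 0 < negCount L N := by
  refine (h.and_eventually hr).mono fun N hN => ⟨hN.1, ?_⟩
  have h1 := cast_posCount_add_negCount L N
  have h2 : (0 : ℝ) < 2 ^ N := by positivity
  have h3 : (0 : ℝ) < negCount L N := by nlinarith [hN.2]
  exact_mod_cast h3

theorem expectedLabelChanges_le (L : Language (Fin 2)) (N : ℕ) :
    expectedLabelChanges L N ≤ 2 * posCount L N := by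
  refine (minorityCount_le_expectedLabelChanges L N).2.trans ?_
  exact mul_le_mul_of_nonneg_left (by exact_mod_cast min_le_left _ _) zero_le_two

theorem le_expectedLabelChanges {L : Language (Fin 2)} {N : ℕ}
    (h : (posCount L N : ℝ) ≤ 1 / 2 * 2 ^ N) : (posCount L N : ℝ) ≤ expectedLabelChanges L N := by
  refine le_trans (le_of_eq ?_) (minorityCount_le_expectedLabelChanges L N).1
  have h1 := cast_posCount_add_negCount L N
  have h2 : (posCount L N : ℝ) ≤ negCount L N := by linarith
  rw [minorityCount, min_eq_left (by exact_mod_cast h2)]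

/-- By the classification, polynomially bounded counts have polynomial growth. -/
theorem entropy_eq_zero_of_le {L : Language (Fin 2)} (hL : L.IsRegular)
    (h : ∃ᶠ N in atTop, 0 < posCount L N) {k : ℕ}
    (hle : ∀ N, (posCount L N : ℝ) ≤ ((N : ℝ) + 1) ^ k) :
    L.IsRegular ∧ (∃ᶠ N in atTop, 0 < posCount L N ∧ 0 < negCount L N) ∧
      entropy L = 0 ∧ PolynomialGrowth (posCount L) := by
  have hhalf : ∀ᶠ N in atTop, (posCount L N : ℝ) ≤ 1 / 2 * 2 ^ N := by
    have h1 := (tendsto_pow_const_div_const_pow_of_one_lt k (one_lt_two (α := ℝ))).comp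
      (tendsto_add_atTop_nat 1)
    filter_upwards [h1.eventually_lt_const (show (0 : ℝ) < 1 / 4 by norm_num)] with N hN
    simp only [Function.comp_apply] at hN
    rw [div_lt_iff₀ (by positivity), pow_succ] at hN
    push_cast at hN
    linarith [hle N]
  have hH : entropy L = 0 := by
    have h0 : ((Real.logb 2 1 : ℝ) : EReal) = 0 := by simp
    rw [entropy_eq_growthRate, ← h0]
    refine le_antisymm (growthRate_le two_pos one_pos k (Eventually.of_forall fun N => ?_))
      (le_growthRate one_pos one_pos ((h.and_eventually hhalf).mono fun N hN => ?_))
    · rw [one_pow, mul_one]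
      exact (expectedLabelChanges_le L N).trans (mul_le_mul_of_nonneg_left (hle N) zero_le_two)
    · rw [one_pow, mul_one]
      exact le_trans (by exact_mod_cast hN.1) (le_expectedLabelChanges hN.2)
  exact ⟨hL, frequently_pos_and_neg h (by norm_num) hhalf, hH,
    (classified_posCount hL h (by norm_num) hhalf).2.1.1 hH⟩

/-- By the classification, counts that are at least `c * 2 ^ N` infinitely often have proportional
growth. -/
theorem entropy_eq_one_of_le {L : Language (Fin 2)} (hL : L.IsRegular) {c : ℝ} (hc : 0 < c)
    (h : ∃ᶠ N in atTop, c * 2 ^ N ≤ posCount L N)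
    (hhalf : ∀ᶠ N in atTop, (posCount L N : ℝ) ≤ 1 / 2 * 2 ^ N) :
    L.IsRegular ∧ (∃ᶠ N in atTop, 0 < posCount L N ∧ 0 < negCount L N) ∧
      entropy L = 1 ∧ ProportionalGrowth (posCount L) := by
  have hpos : ∃ᶠ N in atTop, 0 < posCount L N := h.mono fun N hN => by
    have : (0 : ℝ) < posCount L N := lt_of_lt_of_le (by positivity) hN
    exact_mod_cast this
  have hH : entropy L = 1 := by
    have h1 : ((Real.logb 2 2 : ℝ) : EReal) = 1 := by
      rw [Real.logb_self_eq_one one_lt_two, EReal.coe_one]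
    rw [entropy_eq_growthRate, ← h1]
    refine le_antisymm (growthRate_le two_pos two_pos 0 (Eventually.of_forall fun N => ?_))
      (le_growthRate hc two_pos ((h.and_eventually hhalf).mono fun N hN => ?_))
    · rw [pow_zero, mul_one]
      refine (expectedLabelChanges_le L N).trans (mul_le_mul_of_nonneg_left ?_ zero_le_two)
      exact_mod_cast posCount_le L N
    · exact hN.1.trans (le_expectedLabelChanges hN.2)
  exact ⟨hL, frequently_pos_and_neg hpos (by norm_num) hhalf, hH,
    (classified_posCount hL hpos (by norm_num) hhalf).2.2.2.1 hH⟩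

theorem entropy_eq_logb_of_tendsto {L : Language (Fin 2)} (hL : L.IsRegular) {b β : ℝ}
    (hb1 : 1 < b) (hb2 : b < 2) (hβ : 0 < β)
    (ht : Tendsto (fun N => (posCount L N : ℝ) / b ^ N) atTop (𝓝 β)) :
    L.IsRegular ∧ (∃ᶠ N in atTop, 0 < posCount L N ∧ 0 < negCount L N) ∧
      ∃ b β : ℝ, 1 < b ∧ b < 2 ∧ 0 < β ∧
        entropy L = ((Real.logb 2 b : ℝ) : EReal) ∧
        (fun N => (posCount L N : ℝ)) ~[atTop] (fun N => β * b ^ N) := by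
  have hb0 : 0 < b := one_pos.trans hb1
  have hpos : ∃ᶠ N in atTop, 0 < posCount L N := by
    refine Eventually.frequently ?_
    filter_upwards [ht.eventually_const_lt hβ] with N hN
    rw [div_pos_iff_of_pos_right (by positivity)] at hN
    exact_mod_cast hN
  have hhalf : ∀ᶠ N in atTop, (posCount L N : ℝ) ≤ 1 / 2 * 2 ^ N := by
    have h1 := ht.mul (tendsto_pow_atTop_nhds_zero_of_lt_one (r := b / 2) (by positivity)
      (by linarith))
    rw [mul_zero] at h1
    filter_upwards [h1.eventually_lt_const (show (0 : ℝ) < 1 / 2 by norm_num)] with N hN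
    rw [div_pow, div_mul_div_cancel₀ (by positivity), div_lt_iff₀ (by positivity)] at hN
    exact hN.le
  have hexp : ExponentialGrowth (posCount L) b :=
    ⟨1, one_pos, 0, fun _ => β, fun _ => hβ.le, ⟨0, one_pos, hβ⟩, by
      simpa using ht.sub_const β⟩
  refine ⟨hL, frequently_pos_and_neg hpos (by norm_num) hhalf, b, β, hb1, hb2, hβ,
    ((classified_posCount hL hpos (by norm_num) hhalf).2.2.1 b hb1 hb2).2 hexp, ?_⟩
  refine (Asymptotics.isEquivalent_iff_tendsto_one (Eventually.of_forall fun N => by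
    positivity)).2 ?_
  have h2 := ht.div_const β
  rw [div_self hβ.ne'] at h2
  refine h2.congr fun N => ?_
  rw [Pi.div_apply, div_div, mul_comm]

/-! ### Languages of polynomial growth -/

theorem mem_star_singleton_mul {c : Fin 2} {M : Language (Fin 2)} {w : List (Fin 2)} :
    w ∈ ({[c]} : Language (Fin 2))∗ * M ↔
      w ∈ M ∨ ∃ v, w = c :: v ∧ v ∈ ({[c]} : Language (Fin 2))∗ * M := by
  conv_lhs => rw [← Language.one_add_self_mul_kstar_eq_kstar, add_mul, one_mul, mul_assoc]
  rw [Language.mem_add]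
  refine or_congr Iff.rfl ?_
  generalize ({[c]} : Language (Fin 2))∗ * M = P
  rw [Language.mem_mul]
  constructor
  · rintro ⟨a, rfl, b, hb, rfl⟩
    exact ⟨b, rfl, hb⟩
  · rintro ⟨v, rfl, hv⟩
    exact ⟨[c], rfl, v, hv, rfl⟩

theorem cons_mem_star_singleton_mul {a c : Fin 2} {M : Language (Fin 2)} {w : List (Fin 2)} :
    a :: w ∈ ({[c]} : Language (Fin 2))∗ * M ↔
      a :: w ∈ M ∨ (a = c ∧ w ∈ ({[c]} : Language (Fin 2))∗ * M) := by
  rw [mem_star_singleton_mul]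
  refine or_congr Iff.rfl ⟨?_, ?_⟩
  · rintro ⟨v, h, hv⟩
    obtain ⟨rfl, rfl⟩ := List.cons.inj h
    exact ⟨rfl, hv⟩
  · rintro ⟨rfl, hw⟩
    exact ⟨w, rfl, hw⟩

/-- The left quotients of `0*1*0*1*`, in increasing order: `∅`, `1*`, `0*1*`, `1*0*1*` and
`0*1*0*1*`. -/
def blockLanguage : Fin 5 → Language (Fin 2)
  | 0 => 0
  | 1 => ({[1]} : Language (Fin 2))∗ * 1
  | 2 => ({[0]} : Language (Fin 2))∗ * (({[1]} : Language (Fin 2))∗ * 1)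
  | 3 => ({[1]} : Language (Fin 2))∗ * (({[0]} : Language (Fin 2))∗ *
      (({[1]} : Language (Fin 2))∗ * 1))
  | 4 => ({[0]} : Language (Fin 2))∗ * (({[1]} : Language (Fin 2))∗ *
      (({[0]} : Language (Fin 2))∗ * (({[1]} : Language (Fin 2))∗ * 1)))

/-- The effect of removing the first letter from the words of `blockLanguage s`. -/
def blockStep : Fin 5 → Fin 2 → Fin 5 :=
  ![![0, 0], ![0, 1], ![2, 1], ![2, 3], ![4, 3]]

theorem cons_mem_blockLanguage (s : Fin 5) (a : Fin 2) (w : List (Fin 2)) :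
    a :: w ∈ blockLanguage s ↔ w ∈ blockLanguage (blockStep s a) := by
  have hsub : ∀ (c : Fin 2) (M : Language (Fin 2)), w ∈ M →
      w ∈ ({[c]} : Language (Fin 2))∗ * M := fun c M h => mem_star_singleton_mul.2 (Or.inl h)
  have h10 : (1 : Fin 2) ≠ 0 := by decide
  have h01 : (0 : Fin 2) ≠ 1 := by decide
  fin_cases s <;> fin_cases a <;>
    simp only [blockLanguage, blockStep, cons_mem_star_singleton_mul, Language.mem_one,
      Language.notMem_zero, Fin.mk_zero, Fin.mk_one, Fin.reduceFinMk, Fin.isValue,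
      Matrix.cons_val, Matrix.cons_val_zero, Matrix.cons_val_one, h10, h01,
      false_and, true_and, or_false, false_or, reduceCtorEq]
  all_goals exact or_iff_right_of_imp fun h => hsub _ _ (hsub _ _ h)

theorem tomita1_eq : tomita1 = blockLanguage 1 := (mul_one _).symm

theorem tomita7_eq : tomita7 = blockLanguage 4 := by
  rw [tomita7, blockLanguage, mul_one, mul_assoc, mul_assoc]

theorem posCount_blockLanguage (N : ℕ) :
    posCount (blockLanguage 1) N = 1 ∧
    (1 ≤ posCount (blockLanguage 2) N ∧ posCount (blockLanguage 2) N ≤ N + 1) ∧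
    (1 ≤ posCount (blockLanguage 3) N ∧ posCount (blockLanguage 3) N ≤ (N + 1) ^ 2) ∧
    (1 ≤ posCount (blockLanguage 4) N ∧ posCount (blockLanguage 4) N ≤ (N + 1) ^ 3) := by
  have hnil : ∀ s : Fin 5, s ≠ 0 → [] ∈ blockLanguage s := by
    have h1 : ∀ (c : Fin 2) (M : Language (Fin 2)), [] ∈ M →
      [] ∈ ({[c]} : Language (Fin 2))∗ * M := fun c M h => mem_star_singleton_mul.2 (Or.inl h)
    have h0 := Language.nil_mem_one (α := Fin 2)
    intro s hs
    fin_cases s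
    · exact absurd rfl hs
    · exact h1 _ _ h0
    · exact h1 _ _ (h1 _ _ h0)
    · exact h1 _ _ (h1 _ _ (h1 _ _ h0))
    · exact h1 _ _ (h1 _ _ (h1 _ _ (h1 _ _ h0)))
  have hempty : ∀ n, posCount (blockLanguage 0) n = 0 := fun n => by
    rw [posCount_eq_sum]
    exact Finset.sum_eq_zero fun x _ => if_neg (Language.notMem_zero _)
  have hstep : ∀ s n, posCount (blockLanguage s) (n + 1) =
      posCount (blockLanguage (blockStep s 0)) n + posCount (blockLanguage (blockStep s 1)) n :=
    fun s n => posCount_succ (cons_mem_blockLanguage s 0) (cons_mem_blockLanguage s 1) n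
  induction N with
  | zero =>
    have h : ∀ s : Fin 5, s ≠ 0 → posCount (blockLanguage s) 0 = 1 := fun s hs => by
      rw [posCount_zero, if_pos (hnil s hs)]
    rw [h 1 (by decide), h 2 (by decide), h 3 (by decide), h 4 (by decide)]
    simp
  | succ n ih =>
    obtain ⟨i1, ⟨i2, i2'⟩, ⟨i3, i3'⟩, i4, i4'⟩ := ih
    have e1 : posCount (blockLanguage 1) (n + 1) = _ := hstep 1 n
    have e2 : posCount (blockLanguage 2) (n + 1) =
      posCount (blockLanguage 2) n + posCount (blockLanguage 1) n := hstep 2 n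
    have e3 : posCount (blockLanguage 3) (n + 1) =
      posCount (blockLanguage 2) n + posCount (blockLanguage 3) n := hstep 3 n
    have e4 : posCount (blockLanguage 4) (n + 1) =
      posCount (blockLanguage 4) n + posCount (blockLanguage 3) n := hstep 4 n
    refine ⟨?_, ⟨by omega, by omega⟩, ⟨by omega, ?_⟩, by omega, ?_⟩
    · rw [e1]
      exact congrArg₂ (· + ·) (hempty n) i1
    · rw [e3]; nlinarith
    · rw [e4]; nlinarith

theorem isRegular_tomita1 : tomita1.IsRegular := by
  rw [tomita1_eq]; exact isRegular_of_cons_mem_iff cons_mem_blockLanguage 1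

theorem isRegular_tomita7 : tomita7.IsRegular := by
  rw [tomita7_eq]; exact isRegular_of_cons_mem_iff cons_mem_blockLanguage 4

/-- The left quotients of `(10)*`: `∅`, `(10)*` and `0(10)*`. -/
def alternatingLanguage : Fin 3 → Language (Fin 2)
  | 0 => 0
  | 1 => tomita2
  | 2 => {w | 1 :: w ∈ tomita2}

/-- The effect of removing the first letter from the words of `alternatingLanguage s`. -/
def alternatingStep : Fin 3 → Fin 2 → Fin 3 := ![![0, 0], ![0, 2], ![1, 0]]

theorem mem_tomita2 {w : List (Fin 2)} :
    w ∈ tomita2 ↔ w = [] ∨ ∃ v, w = 1 :: 0 :: v ∧ v ∈ tomita2 := by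
  conv_lhs => rw [tomita2, ← Language.one_add_self_mul_kstar_eq_kstar]
  rw [← tomita2, Language.mem_add, Language.mem_one, Language.mem_mul]
  refine or_congr Iff.rfl ⟨?_, ?_⟩
  · rintro ⟨a, rfl, b, hb, rfl⟩
    exact ⟨b, rfl, hb⟩
  · rintro ⟨v, rfl, hv⟩
    exact ⟨[1, 0], rfl, v, hv, rfl⟩

theorem cons_mem_alternatingLanguage (s : Fin 3) (a : Fin 2) (w : List (Fin 2)) :
    a :: w ∈ alternatingLanguage s ↔ w ∈ alternatingLanguage (alternatingStep s a) := by
  have h00 : 0 :: w ∉ tomita2 := by rw [mem_tomita2]; simp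
  have h11 : 1 :: 1 :: w ∉ tomita2 := by rw [mem_tomita2]; simp
  have h10 : 1 :: 0 :: w ∈ tomita2 ↔ w ∈ tomita2 := by
    rw [mem_tomita2]; simp
  fin_cases s <;> fin_cases a
  · exact Iff.rfl
  · exact Iff.rfl
  · exact iff_of_false h00 (Language.notMem_zero w)
  · exact Iff.rfl
  · exact h10
  · exact iff_of_false h11 (Language.notMem_zero w)

theorem isRegular_tomita2 : tomita2.IsRegular :=
  isRegular_of_cons_mem_iff cons_mem_alternatingLanguage 1

theorem posCount_tomita2 (n : ℕ) :
    posCount tomita2 (2 * n) = 1 ∧ posCount tomita2 (2 * n + 1) = 0 := by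
  have hempty : ∀ n, posCount (alternatingLanguage 0) n = 0 := fun n => by
    rw [posCount_eq_sum]
    exact Finset.sum_eq_zero fun x _ => if_neg (Language.notMem_zero _)
  have hstep : ∀ s n, posCount (alternatingLanguage s) (n + 1) =
      posCount (alternatingLanguage (alternatingStep s 0)) n +
        posCount (alternatingLanguage (alternatingStep s 1)) n :=
    fun s n => posCount_succ (cons_mem_alternatingLanguage s 0) (cons_mem_alternatingLanguage s 1) n
  have h1 : ∀ n, posCount tomita2 (n + 1) = posCount (alternatingLanguage 2) n := fun n => by
    have : posCount tomita2 (n + 1) = posCount (alternatingLanguage 0) n +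
      posCount (alternatingLanguage 2) n := hstep 1 n
    rw [this, hempty, zero_add]
  have h2 : ∀ n, posCount (alternatingLanguage 2) (n + 1) = posCount tomita2 n := fun n => by
    have : posCount (alternatingLanguage 2) (n + 1) = posCount tomita2 n +
      posCount (alternatingLanguage 0) n := hstep 2 n
    rw [this, hempty, add_zero]
  induction n with
  | zero =>
    constructor
    · rw [posCount_zero, if_pos (mem_tomita2.2 (Or.inl rfl))]
    · rw [h1, posCount_zero, if_neg]
      intro h
      have : [1] ∈ tomita2 := h
      rw [mem_tomita2] at this
      simp at this
  | succ n ih =>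
    rw [show 2 * (n + 1) = 2 * n + 1 + 1 by ring, h1, h2, h1, h2]
    exact ih

theorem entropy_tomita_eq_zero : ∀ L ∈ ({tomita1, tomita2, tomita7} : Set (Language (Fin 2))),
    L.IsRegular ∧ (∃ᶠ N in atTop, 0 < posCount L N ∧ 0 < negCount L N) ∧
      entropy L = 0 ∧ PolynomialGrowth (posCount L) := by
  rintro L (rfl | rfl | rfl)
  · refine entropy_eq_zero_of_le isRegular_tomita1 (k := 0) ?_ fun N => ?_
    · refine (Eventually.of_forall fun N => ?_).frequently
      rw [tomita1_eq, (posCount_blockLanguage N).1]; exact one_pos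
    · rw [tomita1_eq, (posCount_blockLanguage N).1]; simp
  · refine entropy_eq_zero_of_le isRegular_tomita2 (k := 0) ?_ fun N => ?_
    · refine frequently_of_residue (q := 2) (r := 0) two_ne_zero (Eventually.of_forall fun n => ?_)
      rw [add_zero, (posCount_tomita2 n).1]; exact one_pos
    · rw [pow_zero]
      obtain ⟨n, rfl | rfl⟩ := Nat.even_or_odd' N
      · rw [(posCount_tomita2 n).1]; simp
      · rw [(posCount_tomita2 n).2]; simp
  · refine entropy_eq_zero_of_le isRegular_tomita7 (k := 3) ?_ fun N => ?_
    · refine (Eventually.of_forall fun N => ?_).frequently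
      rw [tomita7_eq]; exact (posCount_blockLanguage N).2.2.2.1
    · rw [tomita7_eq]; exact_mod_cast (posCount_blockLanguage N).2.2.2.2

/-! ### Languages of proportional growth -/

/-- The words with prescribed parities of the numbers of 0s and 1s. -/
def parityLanguage (p : ZMod 2 × ZMod 2) : Language (Fin 2) :=
  {w | ((w.count 0 : ℕ) : ZMod 2) = p.1 ∧ ((w.count 1 : ℕ) : ZMod 2) = p.2}

theorem cons_mem_parityLanguage (p : ZMod 2 × ZMod 2) (a : Fin 2) (w : List (Fin 2)) :
    a :: w ∈ parityLanguage p ↔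
      w ∈ parityLanguage (if a = 0 then (p.1 - 1, p.2) else (p.1, p.2 - 1)) := by
  change (_ = _ ∧ _ = _) ↔ (_ = _ ∧ _ = _)
  fin_cases a <;> simp [eq_sub_iff_add_eq]

theorem tomita5_eq : tomita5 = parityLanguage (0, 0) := by
  ext w
  change (Even _ ∧ Even _) ↔ (_ = (0 : ZMod 2) ∧ _ = (0 : ZMod 2))
  rw [ZMod.natCast_eq_zero_iff_even, ZMod.natCast_eq_zero_iff_even]

/-- The words in which the number of 0s minus the number of 1s has a given residue modulo 3. -/
def differenceLanguage (r : ZMod 3) : Language (Fin 2) :=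
  {w | (((w.count 0 : ℤ) - (w.count 1 : ℤ) : ℤ) : ZMod 3) = r}

theorem cons_mem_differenceLanguage (r : ZMod 3) (a : Fin 2) (w : List (Fin 2)) :
    a :: w ∈ differenceLanguage r ↔ w ∈ differenceLanguage (if a = 0 then r - 1 else r + 1) := by
  change (_ = _) ↔ (_ = _)
  fin_cases a
  · simp [eq_sub_iff_add_eq, sub_add_eq_add_sub]
  · simp [← sub_eq_iff_eq_add, sub_sub]

theorem tomita6_eq : tomita6 = differenceLanguage 0 := by
  ext w
  change (3 : ℤ) ∣ _ ↔ _ = (0 : ZMod 3)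
  exact (ZMod.intCast_zmod_eq_zero_iff_dvd _ 3).symm

/-- For even `N`, half of the strings of length `N` have an even number of 0s and of 1s. -/
theorem posCount_tomita5 (n : ℕ) :
    posCount tomita5 (n + 1) ≤ 2 ^ n ∧ posCount tomita5 (2 * n + 2) = 2 ^ (2 * n + 1) := by
  set c : ZMod 2 → ZMod 2 → ℕ → ℕ := fun i j n => posCount (parityLanguage (i, j)) n with hc
  have hstep : ∀ i j n, c i j (n + 1) = c (i - 1) j n + c i (j - 1) n := fun i j n =>
    posCount_succ (cons_mem_parityLanguage (i, j) 0) (cons_mem_parityLanguage (i, j) 1) n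
  have h00 : ∀ n, c 0 0 (n + 1) = c 1 0 n + c 0 1 n := hstep 0 0
  have h01 : ∀ n, c 0 1 (n + 1) = c 1 1 n + c 0 0 n := hstep 0 1
  have h10 : ∀ n, c 1 0 (n + 1) = c 0 0 n + c 1 1 n := hstep 1 0
  have h11 : ∀ n, c 1 1 (n + 1) = c 0 1 n + c 1 0 n := hstep 1 1
  have z00 : c 0 0 0 = 1 := by
    simp only [hc]; rw [posCount_zero, if_pos]; exact ⟨rfl, rfl⟩
  have z01 : c 0 1 0 = 0 := by
    simp only [hc]; rw [posCount_zero, if_neg]; rintro ⟨-, h⟩; exact absurd h (by decide)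
  have z10 : c 1 0 0 = 0 := by
    simp only [hc]; rw [posCount_zero, if_neg]; rintro ⟨h, -⟩; exact absurd h (by decide)
  have z11 : c 1 1 0 = 0 := by
    simp only [hc]; rw [posCount_zero, if_neg]; rintro ⟨h, -⟩; exact absurd h (by decide)
  have htot : ∀ n, c 0 0 n + c 0 1 n + c 1 0 n + c 1 1 n = 2 ^ n := by
    intro n
    induction n with
    | zero => rw [z00, z01, z10, z11]; rfl
    | succ n ih => rw [h00, h01, h10, h11, pow_succ]; omega
  have heven : ∀ n, c 0 1 (2 * n) = 0 ∧ c 1 0 (2 * n) = 0 := by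
    intro n
    induction n with
    | zero => exact ⟨z01, z10⟩
    | succ n ih =>
      rw [show 2 * (n + 1) = 2 * n + 1 + 1 by ring, h01, h10, h00, h11, ih.1, ih.2]
      exact ⟨rfl, rfl⟩
  rw [tomita5_eq]
  refine ⟨?_, ?_⟩
  · change c 0 0 (n + 1) ≤ _
    have := htot n
    rw [h00]; omega
  · change c 0 0 (2 * n + 2) = _
    have h1 := htot (2 * n)
    have h2 := heven n
    rw [h00, h01, h10, pow_succ]
    omega

/-- Each word of length `n` whose difference is not divisible by 3 has exactly one extension by a
letter to a word with difference divisible by 3, and the other words have none. -/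
theorem posCount_tomita6 (n : ℕ) : posCount tomita6 (n + 1) + posCount tomita6 n = 2 ^ n := by
  set c : ZMod 3 → ℕ → ℕ := fun r n => posCount (differenceLanguage r) n with hc
  have hstep : ∀ r n, c r (n + 1) = c (r - 1) n + c (r + 1) n := fun r n =>
    posCount_succ (cons_mem_differenceLanguage r 0) (cons_mem_differenceLanguage r 1) n
  have h0 : ∀ n, c 0 (n + 1) = c 2 n + c 1 n := hstep 0
  have h1 : ∀ n, c 1 (n + 1) = c 0 n + c 2 n := hstep 1
  have h2 : ∀ n, c 2 (n + 1) = c 1 n + c 0 n := hstep 2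
  have z0 : c 0 0 = 1 := by simp only [hc]; rw [posCount_zero, if_pos]; rfl
  have z1 : c 1 0 = 0 := by
    simp only [hc]; rw [posCount_zero, if_neg]; intro h
    exact absurd (show (0 : ZMod 3) = 1 from h) (by decide)
  have z2 : c 2 0 = 0 := by
    simp only [hc]; rw [posCount_zero, if_neg]; intro h
    exact absurd (show (0 : ZMod 3) = 2 from h) (by decide)
  have htot : ∀ n, c 0 n + c 1 n + c 2 n = 2 ^ n := by
    intro n
    induction n with
    | zero => rw [z0, z1, z2]; rfl
    | succ n ih => rw [h0, h1, h2, pow_succ]; omega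
  rw [tomita6_eq]
  change c 0 (n + 1) + c 0 n = _
  have := htot n
  rw [h0]; omega

theorem entropy_tomita_eq_one : ∀ L ∈ ({tomita5, tomita6} : Set (Language (Fin 2))),
    L.IsRegular ∧ (∃ᶠ N in atTop, 0 < posCount L N ∧ 0 < negCount L N) ∧
      entropy L = 1 ∧ ProportionalGrowth (posCount L) := by
  have hhalf : ∀ L : Language (Fin 2), (∀ n, posCount L (n + 1) ≤ 2 ^ n) →
      ∀ᶠ N in atTop, (posCount L N : ℝ) ≤ 1 / 2 * 2 ^ N := by
    intro L h
    filter_upwards [eventually_ge_atTop 1] with N hN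
    obtain ⟨n, rfl⟩ := Nat.exists_eq_add_of_le' hN
    have h1 : (posCount L (n + 1) : ℝ) ≤ 2 ^ n := by exact_mod_cast h n
    rw [pow_succ]; linarith
  rintro L (rfl | rfl)
  · refine entropy_eq_one_of_le ?_ (c := 1 / 2) (by norm_num) ?_
      (hhalf _ fun n => (posCount_tomita5 n).1)
    · rw [tomita5_eq]
      exact isRegular_of_cons_mem_iff (δ := fun p a =>
        if a = 0 then (p.1 - 1, p.2) else (p.1, p.2 - 1)) cons_mem_parityLanguage (0, 0)
    · refine frequently_of_residue (q := 2) (r := 2) two_ne_zero (Eventually.of_forall fun n => ?_)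
      rw [(posCount_tomita5 n).2, pow_succ _ (2 * n + 1)]
      push_cast
      linarith
  · refine entropy_eq_one_of_le ?_ (c := 1 / 4) (by norm_num) ?_
      (hhalf _ fun n => by have := posCount_tomita6 n; omega)
    · rw [tomita6_eq]
      exact isRegular_of_cons_mem_iff (δ := fun r a => if a = 0 then r - 1 else r + 1)
        cons_mem_differenceLanguage 0
    · rw [frequently_atTop]
      intro n
      have h1 : (posCount tomita6 (n + 1) : ℝ) + posCount tomita6 n = 2 ^ n := by
        exact_mod_cast posCount_tomita6 n
      rcases le_total ((1 : ℝ) / 4 * 2 ^ n) (posCount tomita6 n) with h | h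
      · exact ⟨n, le_rfl, h⟩
      · exact ⟨n + 1, Nat.le_succ n, by rw [pow_succ]; linarith⟩

/-! ### Languages of exponential growth -/

/-- The asymptotics of the counts of a language with counting series
`(1 + g₁ z + g₂ z²) / (1 - a₁ z - a₂ z² - a₃ z³)`;
the bounds on the `a`s place the root of the denominator between `1 / 2` and `1`. -/
theorem tendsto_posCount_of_cubic {L : Language (Fin 2)} {a₁ a₂ a₃ g₁ g₂ : ℝ} (h₁ : 0 ≤ a₁)
    (h₂ : 0 < a₂) (h₃ : 0 < a₃) (hg₁ : 0 ≤ g₁) (hg₂ : 0 ≤ g₂)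
    (hhalf : a₁ / 2 + a₂ / 4 + a₃ / 8 < 1) (hone : 1 < a₁ + a₂ + a₃)
    (h : countSeries L * (1 - (PowerSeries.C a₁ * PowerSeries.X +
      PowerSeries.C a₂ * PowerSeries.X ^ 2 + PowerSeries.C a₃ * PowerSeries.X ^ 3)) =
      1 + PowerSeries.C g₁ * PowerSeries.X + PowerSeries.C g₂ * PowerSeries.X ^ 2) :
    ∃ b β : ℝ, 1 < b ∧ b < 2 ∧ 0 < β ∧
      Tendsto (fun N => (posCount L N : ℝ) / b ^ N) atTop (𝓝 β) := by
  set f : PowerSeries ℝ := PowerSeries.C a₁ * PowerSeries.X +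
      PowerSeries.C a₂ * PowerSeries.X ^ 2 + PowerSeries.C a₃ * PowerSeries.X ^ 3 with hf
  set g : PowerSeries ℝ := 1 + PowerSeries.C g₁ * PowerSeries.X +
    PowerSeries.C g₂ * PowerSeries.X ^ 2 with hg
  have hfc : ∀ n, PowerSeries.coeff n f = a₁ * (if n = 1 then 1 else 0) +
      a₂ * (if n = 2 then 1 else 0) + a₃ * (if n = 3 then 1 else 0) := fun n => by
    simp only [hf, map_add, PowerSeries.coeff_C_mul, PowerSeries.coeff_X, PowerSeries.coeff_X_pow]
  have hgc : ∀ n, PowerSeries.coeff n g = (if n = 0 then 1 else 0) +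
      g₁ * (if n = 1 then 1 else 0) + g₂ * (if n = 2 then 1 else 0) := fun n => by
    simp only [hg, map_add, PowerSeries.coeff_C_mul, PowerSeries.coeff_X, PowerSeries.coeff_X_pow,
      PowerSeries.coeff_one]
  have hfnn : ∀ n, 0 ≤ PowerSeries.coeff n f := fun n => by
    rw [hfc]; positivity
  have hgnn : ∀ n, 0 ≤ PowerSeries.coeff n g := fun n => by
    rw [hgc]; positivity
  have hfz : ∀ n, 4 ≤ n → PowerSeries.coeff n f = 0 := fun n hn => by
    rw [hfc, if_neg (by omega), if_neg (by omega), if_neg (by omega)]; simp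
  have hgz : ∀ n, 3 ≤ n → PowerSeries.coeff n g = 0 := fun n hn => by
    rw [hgc, if_neg (by omega), if_neg (by omega), if_neg (by omega)]; simp
  have hf0 : PowerSeries.coeff 0 f = 0 := by rw [hfc]; simp
  have hf2 : 0 < PowerSeries.coeff 2 f := by rw [hfc]; simpa using h₂
  have hf3 : 0 < PowerSeries.coeff 3 f := by rw [hfc]; simpa using h₃
  have hgcd : Nat.setGcd {n | 0 < PowerSeries.coeff n f} = 1 := by
    have d2 := Nat.setGcd_dvd_of_mem (s := {n | 0 < PowerSeries.coeff n f}) hf2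
    have d3 := Nat.setGcd_dvd_of_mem (s := {n | 0 < PowerSeries.coeff n f}) hf3
    exact Nat.dvd_one.1 ((Nat.dvd_add_right d2).1 d3)
  have htame : IsTame f := IsTame.of_coeff_eq_zero hfnn (eventually_atTop.2 ⟨4, hfz⟩)
  obtain ⟨x, hx, hsum, y, hxy, hy⟩ := htame.exists_hasSum_one hf0 hf2
  have hx1 : a₁ * x + a₂ * x ^ 2 + a₃ * x ^ 3 = 1 := by
    have h4 : HasSum (fun n => PowerSeries.coeff n f * x ^ n)
        (∑ n ∈ Finset.range 4, PowerSeries.coeff n f * x ^ n) :=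
      hasSum_sum_of_ne_finset_zero fun n hn => by
        rw [hfz n (by simpa using hn), zero_mul]
    have h5 := hsum.unique h4
    rw [h5]
    simp [Finset.sum_range_succ, hfc]
  have hxlt : x < 1 := by
    by_contra! hge
    have e2 : 1 ≤ x ^ 2 := one_le_pow₀ hge
    have e3 : 1 ≤ x ^ 3 := one_le_pow₀ hge
    nlinarith
  have hxgt : 1 / 2 < x := by
    by_contra! hle
    have e2 : x ^ 2 ≤ (1 / 2) ^ 2 := pow_le_pow_left₀ hx.le hle 2
    have e3 : x ^ 3 ≤ (1 / 2) ^ 3 := pow_le_pow_left₀ hx.le hle 3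
    nlinarith
  have hcc : PowerSeries.constantCoeff (1 - f) ≠ 0 := by
    rw [map_sub, map_one, ← PowerSeries.coeff_zero_eq_constantCoeff_apply, hf0]; norm_num
  have hu : (1 - f)⁻¹ * (1 - f) = 1 := PowerSeries.inv_mul_cancel _ hcc
  obtain ⟨c, hc, ht⟩ := tendsto_coeff_inv_one_sub hfnn hf0 hgcd hx hxy hsum hy hu
  have hcount : countSeries L = g * (1 - f)⁻¹ := by
    linear_combination (-(countSeries L)) * hu + (1 - f)⁻¹ * h
  have hunn : ∀ n, 0 ≤ PowerSeries.coeff n (1 - f)⁻¹ :=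
    (htame.inv_one_sub hf0 hu).coeff_nonneg
  have hgs : Summable fun n => PowerSeries.coeff n g * (x⁻¹)⁻¹ ^ n :=
    summable_of_ne_finset_zero (s := Finset.range 3) fun n hn => by
      rw [hgz n (by simpa using hn), zero_mul]
  have hlim := tendsto_conv_of_summable (l := 0) (inv_pos.2 hx) hgnn hunn hgs
    (by simpa [scale] using ht)
  refine ⟨x⁻¹, _, (one_lt_inv₀ hx).2 hxlt, ?_, ?_, hlim.congr fun N => ?_⟩
  · rw [inv_lt_comm₀ hx two_pos]; linarith
  · refine mul_pos (hgs.tsum_pos (fun n => mul_nonneg (hgnn n) (by positivity)) 0 ?_) hc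
    rw [hgc]; simp
  · have e1 : (posCount L N : ℝ) = PowerSeries.coeff N (countSeries L) := by
      rw [countSeries, PowerSeries.coeff_mk]
    rw [e1, hcount, PowerSeries.coeff_mul, Finset.Nat.sum_antidiagonal_eq_sum_range_succ
      (f := fun i j => PowerSeries.coeff i g * PowerSeries.coeff j (1 - f)⁻¹)]
    simp [scale]

theorem countSeries_zero : countSeries 0 = 0 := by
  ext n
  rw [countSeries, PowerSeries.coeff_mk, posCount_eq_sum,
    Finset.sum_eq_zero fun x _ => if_neg (Language.notMem_zero _)]
  simp

/-- The left quotients of the language of words without factor `000`. -/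
def noTripleLanguage : Fin 4 → Language (Fin 2)
  | 0 => tomita4
  | 1 => {w | 0 :: w ∈ tomita4}
  | 2 => {w | 0 :: 0 :: w ∈ tomita4}
  | 3 => 0

/-- The effect of removing the first letter from the words of `noTripleLanguage s`. -/
def noTripleStep : Fin 4 → Fin 2 → Fin 4 := ![![1, 0], ![2, 0], ![3, 0], ![3, 3]]

theorem mem_tomita4 {w : List (Fin 2)} : w ∈ tomita4 ↔ ¬ [0, 0, 0] <:+: w := Iff.rfl

theorem cons_mem_noTripleLanguage (s : Fin 4) (a : Fin 2) (w : List (Fin 2)) :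
    a :: w ∈ noTripleLanguage s ↔ w ∈ noTripleLanguage (noTripleStep s a) := by
  have h1 : ∀ v, 1 :: v ∈ tomita4 ↔ v ∈ tomita4 := fun v => by
    simp [mem_tomita4, List.infix_cons_iff]
  have h01 : 0 :: 1 :: w ∈ tomita4 ↔ w ∈ tomita4 := by
    simp [mem_tomita4, List.infix_cons_iff]
  have h001 : 0 :: 0 :: 1 :: w ∈ tomita4 ↔ w ∈ tomita4 := by
    simp [mem_tomita4, List.infix_cons_iff]
  have h000 : 0 :: 0 :: 0 :: w ∉ tomita4 := by
    simp [mem_tomita4, List.infix_cons_iff]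
  fin_cases s <;> fin_cases a
  · exact Iff.rfl
  · exact h1 w
  · exact Iff.rfl
  · exact h01
  · exact iff_of_false h000 (Language.notMem_zero w)
  · exact h001
  · exact Iff.rfl
  · exact Iff.rfl

theorem isRegular_tomita4 : tomita4.IsRegular :=
  isRegular_of_cons_mem_iff cons_mem_noTripleLanguage 0

theorem countSeries_tomita4 :
    countSeries tomita4 * (1 - (PowerSeries.C 1 * PowerSeries.X +
      PowerSeries.C 1 * PowerSeries.X ^ 2 + PowerSeries.C 1 * PowerSeries.X ^ 3)) =
      1 + PowerSeries.C 1 * PowerSeries.X + PowerSeries.C 1 * PowerSeries.X ^ 2 := by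
  have hnil : ∀ s : Fin 4, s ≠ 3 → [] ∈ noTripleLanguage s := by
    intro s hs
    fin_cases s
    · exact mem_tomita4.2 (by decide)
    · exact mem_tomita4.2 (by decide)
    · exact mem_tomita4.2 (by decide)
    · exact absurd rfl hs
  have hstep := fun s => countSeries_eq (cons_mem_noTripleLanguage s 0)
    (cons_mem_noTripleLanguage s 1)
  have e0 : countSeries tomita4 = PowerSeries.X * (countSeries (noTripleLanguage 1) +
      countSeries tomita4) + 1 := by
    have := hstep 0; rw [if_pos (hnil 0 (by decide)), Nat.cast_one] at this; exact this
  have e1 : countSeries (noTripleLanguage 1) = PowerSeries.X *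
      (countSeries (noTripleLanguage 2) + countSeries tomita4) + 1 := by
    have := hstep 1; rw [if_pos (hnil 1 (by decide)), Nat.cast_one] at this; exact this
  have e2 : countSeries (noTripleLanguage 2) = PowerSeries.X * (0 + countSeries tomita4) + 1 := by
    have := hstep 2; rw [if_pos (hnil 2 (by decide)), Nat.cast_one] at this
    rw [← countSeries_zero]; exact this
  rw [map_one]
  linear_combination e0 + PowerSeries.X * e1 + PowerSeries.X ^ 2 * e2

/-- An automaton for `tomita3`. It is in state 0 while no maximal run of 1s of odd length is
pending, in state 1 inside a run of 1s of odd length so far, in states 2 and 3 inside the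
following run of 0s, after an odd and a positive even number of 0s, respectively, and in the dead
state 4 after a violation. -/
def runParityDFA : DFA (Fin 2) (Fin 5) where
  step := ![![0, 1], ![2, 0], ![3, 4], ![2, 1], ![4, 4]]
  start := 0
  accept := {s | s ≠ 2 ∧ s ≠ 4}

theorem not_mem_tomita3_iff {w : List (Fin 2)} :
    w ∉ tomita3 ↔ ∃ (u v : List (Fin 2)) (i j : ℕ),
      w = u ++ List.replicate i 1 ++ List.replicate j 0 ++ v ∧
      u.getLast? ≠ some 1 ∧ v.head? ≠ some 0 ∧ Odd i ∧ Odd j := by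
  change (¬ ∀ (u v : List (Fin 2)) (i j : ℕ), _) ↔ _
  push Not
  simp only [Nat.not_even_iff_odd]

/-- What a word that leads to a given state of `runParityDFA` looks like. -/
def RunParityTrace (w : List (Fin 2)) : Fin 5 → Prop
  | 0 => ∃ u i, u.getLast? ≠ some 1 ∧ Even i ∧ w = u ++ List.replicate i 1
  | 1 => ∃ u i, u.getLast? ≠ some 1 ∧ Odd i ∧ w = u ++ List.replicate i 1
  | 2 => ∃ u i j, u.getLast? ≠ some 1 ∧ Odd i ∧ Odd j ∧
      w = u ++ List.replicate i 1 ++ List.replicate j 0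
  | 3 => ∃ u i j, u.getLast? ≠ some 1 ∧ Odd i ∧ Even j ∧ 0 < j ∧
      w = u ++ List.replicate i 1 ++ List.replicate j 0
  | 4 => ∃ u v i j, u.getLast? ≠ some 1 ∧ Odd i ∧ Odd j ∧
      w = u ++ List.replicate i 1 ++ List.replicate j 0 ++ 1 :: v

theorem runParityTrace_step {w : List (Fin 2)} {s : Fin 5} (h : RunParityTrace w s) (a : Fin 2) :
    RunParityTrace (w ++ [a]) (runParityDFA.step s a) := by
  have hrep : ∀ (n : ℕ) (c : Fin 2), List.replicate (n + 1) c = List.replicate n c ++ [c] :=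
    fun n c => List.replicate_succ'
  fin_cases s <;> fin_cases a
  · exact ⟨w ++ [0], 0, by simp, Even.zero, by simp⟩
  · obtain ⟨u, i, hu, hi, rfl⟩ := h
    exact ⟨u, i + 1, hu, hi.add_one, by simp [hrep]⟩
  · obtain ⟨u, i, hu, hi, rfl⟩ := h
    exact ⟨u, i, 1, hu, hi, odd_one, by simp⟩
  · obtain ⟨u, i, hu, hi, rfl⟩ := h
    exact ⟨u, i + 1, hu, hi.add_one, by simp [hrep]⟩
  · obtain ⟨u, i, j, hu, hi, hj, rfl⟩ := h
    exact ⟨u, i, j + 1, hu, hi, hj.add_one, Nat.succ_pos j, by simp [hrep]⟩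
  · obtain ⟨u, i, j, hu, hi, hj, rfl⟩ := h
    exact ⟨u, [], i, j, hu, hi, hj, rfl⟩
  · obtain ⟨u, i, j, hu, hi, hj, hj0, rfl⟩ := h
    exact ⟨u, i, j + 1, hu, hi, hj.add_one, by simp [hrep]⟩
  · obtain ⟨u, i, j, hu, hi, hj, hj0, rfl⟩ := h
    obtain ⟨j, rfl⟩ := Nat.exists_eq_succ_of_ne_zero hj0.ne'
    exact ⟨u ++ List.replicate i 1 ++ List.replicate (j + 1) 0, 1, by
      rw [hrep, ← List.append_assoc, List.getLast?_concat]; simp, odd_one, rfl⟩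
  · obtain ⟨u, v, i, j, hu, hi, hj, rfl⟩ := h
    exact ⟨u, v ++ [0], i, j, hu, hi, hj, by simp⟩
  · obtain ⟨u, v, i, j, hu, hi, hj, rfl⟩ := h
    exact ⟨u, v ++ [1], i, j, hu, hi, hj, by simp⟩

theorem runParityTrace_eval (w : List (Fin 2)) : RunParityTrace w (runParityDFA.eval w) := by
  induction w using List.reverseRecOn with
  | nil => exact ⟨[], 0, by simp, Even.zero, rfl⟩
  | append_singleton w a ih =>
    rw [DFA.eval_append_singleton]
    exact runParityTrace_step ih a

/-- Words outside `tomita3` are rejected by `runParityDFA`. -/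
theorem eval_runParityDFA_of_violation {u v : List (Fin 2)} {i j : ℕ}
    (hu : u.getLast? ≠ some 1) (hv : v.head? ≠ some 0) (hi : Odd i) (hj : Odd j) :
    runParityDFA.eval (u ++ List.replicate i 1 ++ List.replicate j 0 ++ v) ∉
      runParityDFA.accept := by
  -- After `u` the automaton is not inside a run of 1s of odd length, so that the maximal run of
  -- `i` 1s leads it to state 1 or 4, and the run of `j` 0s to state 2 or 4.
  have hu1 : runParityDFA.eval u ≠ 1 := by
    rcases List.eq_nil_or_concat u with rfl | ⟨u, a, rfl⟩
    · exact show (0 : Fin 5) ≠ 1 by decide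
    · rw [List.concat_eq_append] at hu ⊢
      rw [List.getLast?_concat] at hu
      rw [DFA.eval_append_singleton]
      generalize runParityDFA.eval u = s
      obtain rfl : a = 0 := by
        by_contra h; exact hu (congrArg some (Fin.eq_one_of_ne_zero a h))
      revert s
      change ∀ s : Fin 5, (![![0, 1], ![2, 0], ![3, 4], ![2, 1], ![4, 4]] :
        Fin 5 → Fin 2 → Fin 5) s 0 ≠ 1
      decide
  have hstep1 : ∀ s : Fin 5, s ≠ 1 → runParityDFA.step s 1 = 1 ∨ runParityDFA.step s 1 = 4 := by
    change ∀ s : Fin 5, s ≠ 1 → (![![0, 1], ![2, 0], ![3, 4], ![2, 1], ![4, 4]] :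
        Fin 5 → Fin 2 → Fin 5) s 1 = 1 ∨ (![![0, 1], ![2, 0], ![3, 4], ![2, 1], ![4, 4]] :
        Fin 5 → Fin 2 → Fin 5) s 1 = 4
    decide
  have h1 : ∀ m s, s = 1 ∨ s = 4 →
      runParityDFA.evalFrom s (List.replicate (2 * m) 1) = s := by
    intro m s hs
    induction m with
    | zero => rfl
    | succ m ih =>
      rw [show 2 * (m + 1) = 2 * m + 1 + 1 by ring, List.replicate_succ, List.replicate_succ,
        DFA.evalFrom_cons, DFA.evalFrom_cons]
      rcases hs with rfl | rfl <;> exact ih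
  have h0 : ∀ m s, s = 2 ∨ s = 4 → runParityDFA.evalFrom s (List.replicate (2 * m) 0) = s := by
    intro m s hs
    induction m with
    | zero => rfl
    | succ m ih =>
      rw [show 2 * (m + 1) = 2 * m + 1 + 1 by ring, List.replicate_succ, List.replicate_succ,
        DFA.evalFrom_cons, DFA.evalFrom_cons]
      rcases hs with rfl | rfl <;> exact ih
  have h4 : ∀ v, runParityDFA.evalFrom 4 v = 4 := by
    intro v
    induction v with
    | nil => rfl
    | cons a v ih =>
      rw [DFA.evalFrom_cons]
      fin_cases a <;> exact ih
  obtain ⟨k, rfl⟩ := hi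
  obtain ⟨l, rfl⟩ := hj
  rw [DFA.eval, DFA.evalFrom_of_append, DFA.evalFrom_of_append, DFA.evalFrom_of_append,
    List.replicate_succ, List.replicate_succ, DFA.evalFrom_cons, DFA.evalFrom_cons]
  change runParityDFA.eval u ≠ 1 at hu1
  rw [DFA.eval] at hu1
  generalize runParityDFA.evalFrom runParityDFA.start u = s at hu1 ⊢
  rw [h1 k _ (hstep1 s hu1)]
  obtain ⟨t, ht, hst⟩ : ∃ t, (t = 2 ∨ t = 4) ∧
      runParityDFA.step (runParityDFA.step s 1) 0 = t := by
    rcases hstep1 s hu1 with h | h <;> rw [h]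
    · exact ⟨2, Or.inl rfl, rfl⟩
    · exact ⟨4, Or.inr rfl, rfl⟩
  rw [hst, h0 l t ht]
  rcases v with _ | ⟨a, v⟩
  · rintro ⟨ha, hb⟩
    exact ht.elim ha hb
  · obtain rfl : a = 1 := Fin.eq_one_of_ne_zero a fun h => hv (congrArg some h)
    rw [DFA.evalFrom_cons, show runParityDFA.step t 1 = 4 by rcases ht with rfl | rfl <;> rfl, h4]
    exact fun h => h.2 rfl

theorem accepts_runParityDFA : runParityDFA.accepts = tomita3 := by
  ext w
  rw [← not_iff_not, not_mem_tomita3_iff, DFA.mem_accepts]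
  constructor
  · intro h
    have htr := runParityTrace_eval w
    have hs : runParityDFA.eval w = 2 ∨ runParityDFA.eval w = 4 := by
      by_contra! hne
      exact h hne
    rcases hs with hs | hs <;> rw [hs] at htr
    · obtain ⟨u, i, j, hu, hi, hj, rfl⟩ := htr
      exact ⟨u, [], i, j, by simp, hu, by simp, hi, hj⟩
    · obtain ⟨u, v, i, j, hu, hi, hj, rfl⟩ := htr
      exact ⟨u, 1 :: v, i, j, rfl, hu, by simp, hi, hj⟩
  · rintro ⟨u, v, i, j, rfl, hu, hv, hi, hj⟩
    exact eval_runParityDFA_of_violation hu hv hi hj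

theorem isRegular_tomita3 : tomita3.IsRegular := ⟨Fin 5, inferInstance, _, accepts_runParityDFA⟩

/-- The factor `1 - z` of the determinant of the linear system for `runParityDFA` cancels. -/
theorem countSeries_tomita3 :
    countSeries tomita3 * (1 - (PowerSeries.C 0 * PowerSeries.X +
      PowerSeries.C 2 * PowerSeries.X ^ 2 + PowerSeries.C 2 * PowerSeries.X ^ 3)) =
      1 + PowerSeries.C 2 * PowerSeries.X + PowerSeries.C 1 * PowerSeries.X ^ 2 := by
  set x : Fin 5 → PowerSeries ℝ := fun s => countSeries (runParityDFA.acceptsFrom s) with hx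
  have hstep : ∀ s, countSeries (runParityDFA.acceptsFrom s) = _ := fun s =>
    countSeries_eq (L₀ := runParityDFA.acceptsFrom (runParityDFA.step s 0))
      (L₁ := runParityDFA.acceptsFrom (runParityDFA.step s 1)) (fun w => Iff.rfl) fun w => Iff.rfl
  have hacc : ∀ s : Fin 5, [] ∈ runParityDFA.acceptsFrom s ↔ (s ≠ 2 ∧ s ≠ 4) := fun s => Iff.rfl
  have e0 : x 0 = PowerSeries.X * (x 0 + x 1) + 1 := by
    have := hstep 0
    rw [if_pos ((hacc 0).2 (by decide)), Nat.cast_one] at this; exact this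
  have e1 : x 1 = PowerSeries.X * (x 2 + x 0) + 1 := by
    have := hstep 1
    rw [if_pos ((hacc 1).2 (by decide)), Nat.cast_one] at this; exact this
  have e2 : x 2 = PowerSeries.X * (x 3 + x 4) + 0 := by
    have := hstep 2
    rw [if_neg (mt (hacc 2).1 (by decide)), Nat.cast_zero] at this; exact this
  have e3 : x 3 = PowerSeries.X * (x 2 + x 1) + 1 := by
    have := hstep 3
    rw [if_pos ((hacc 3).2 (by decide)), Nat.cast_one] at this; exact this
  have e4 : x 4 = PowerSeries.X * (x 4 + x 4) + 0 := by
    have := hstep 4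
    rw [if_neg (mt (hacc 4).1 (by decide)), Nat.cast_zero] at this; exact this
  have hne : ∀ c : ℝ, (1 - PowerSeries.C c * PowerSeries.X : PowerSeries ℝ) ≠ 0 := fun c h => by
    have := congrArg PowerSeries.constantCoeff h
    simp at this
  have z4 : x 4 = 0 := by
    refine mul_left_cancel₀ (hne 2) ?_
    rw [map_ofNat]
    linear_combination e4
  rw [z4, add_zero, add_zero] at e2
  have z3 : x 3 * (1 + PowerSeries.X) = x 0 := by
    refine mul_left_cancel₀ (hne 1) ?_
    rw [map_one]
    linear_combination e3 - e0 + PowerSeries.X * e2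
  have hL : countSeries tomita3 = x 0 := by rw [← accepts_runParityDFA]; rfl
  rw [hL, map_zero, map_one, map_ofNat]
  linear_combination (1 + PowerSeries.X) * e0 + PowerSeries.X * (1 + PowerSeries.X) * e1 +
    PowerSeries.X ^ 2 * (1 + PowerSeries.X) * e2 + PowerSeries.X ^ 3 * z3

theorem entropy_tomita_eq_logb : ∀ L ∈ ({tomita3, tomita4} : Set (Language (Fin 2))),
    L.IsRegular ∧ (∃ᶠ N in atTop, 0 < posCount L N ∧ 0 < negCount L N) ∧
      ∃ b β : ℝ, 1 < b ∧ b < 2 ∧ 0 < β ∧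
        entropy L = ((Real.logb 2 b : ℝ) : EReal) ∧
        (fun N => (posCount L N : ℝ)) ~[atTop] (fun N => β * b ^ N) := by
  rintro L (rfl | rfl)
  · obtain ⟨b, β, hb1, hb2, hβ, ht⟩ := tendsto_posCount_of_cubic le_rfl two_pos two_pos zero_le_two
      zero_le_one (by norm_num) (by norm_num) countSeries_tomita3
    exact entropy_eq_logb_of_tendsto isRegular_tomita3 hb1 hb2 hβ ht
  · obtain ⟨b, β, hb1, hb2, hβ, ht⟩ := tendsto_posCount_of_cubic zero_le_one one_pos one_pos
      zero_le_one zero_le_one (by norm_num) (by norm_num) countSeries_tomita4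
    exact entropy_eq_logb_of_tendsto isRegular_tomita4 hb1 hb2 hβ ht

/-! ### The classification -/

theorem theorem1 :
    (∀ L : Language (Fin 2), L.IsRegular →
      (∃ᶠ N in atTop, 0 < posCount L N ∧ 0 < negCount L N) →
      (entropy L = 0 ∨
        (∃ b : ℝ, 1 < b ∧ b < 2 ∧ entropy L = ((Real.logb 2 b : ℝ) : EReal)) ∨
        entropy L = 1) ∧
      EntropyClassifiedBy L (minorityCount L) ∧
      ((∃ c : ℝ, c < 1 ∧ ∀ᶠ N in atTop, posRatio L N ≤ c) →
        EntropyClassifiedBy L (posCount L)) ∧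
      ((∃ c : ℝ, 0 < c ∧ ∀ᶠ N in atTop, c ≤ posRatio L N) →
        EntropyClassifiedBy L (negCount L))) ∧
    (∀ L ∈ ({tomita1, tomita2, tomita7} : Set (Language (Fin 2))),
      L.IsRegular ∧ (∃ᶠ N in atTop, 0 < posCount L N ∧ 0 < negCount L N) ∧
      entropy L = 0 ∧ PolynomialGrowth (posCount L)) ∧
    (∀ L ∈ ({tomita3, tomita4} : Set (Language (Fin 2))),
      L.IsRegular ∧ (∃ᶠ N in atTop, 0 < posCount L N ∧ 0 < negCount L N) ∧
      ∃ b β : ℝ, 1 < b ∧ b < 2 ∧ 0 < β ∧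
        entropy L = ((Real.logb 2 b : ℝ) : EReal) ∧
        (fun N => (posCount L N : ℝ)) ~[atTop] (fun N => β * b ^ N)) ∧
    (∀ L ∈ ({tomita5, tomita6} : Set (Language (Fin 2))),
      L.IsRegular ∧ (∃ᶠ N in atTop, 0 < posCount L N ∧ 0 < negCount L N) ∧
      entropy L = 1 ∧ ProportionalGrowth (posCount L)) :=
  ⟨fun _ hL h => regular_classification hL h, entropy_tomita_eq_zero, entropy_tomita_eq_logb,
    entropy_tomita_eq_one⟩

end
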